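/- Let $\mathbf k$ be an algebraically closed field of characteristic $0$; all schemes and morphisms are over $\mathbf k$. Let $Y=\mathbf P^1$. A rope on $Y$ with conormal bundle $\mathcal E$ (a vector bundle on $Y$) is a scheme $\widetilde Y$ together with a closed immersion $Y\hookrightarrow\widetilde Y$ whose ideal sheaf $\mathcal I$ satisfies $\mathcal I^2=0$ and $\mathcal I\simeq\mathcal E$ as $\mathcal O_Y$-modules; if $\mathcal E$ is a line bundle, it is called a ribbon. A projection of $\widetilde Y$ onto a ribbon $\widehat Y$ on $Y$ is a morphism $p:\widetilde Y\to\widehat Y$ that restricts to the identity on $Y$ and for which $\mathcal O_{\widehat Y}\to p_*\mathcal O_{\widetilde Y}$ is injective. Let $i:Y\hookrightarrow\mathbf P^N$, $N\ge 1$, be an embedding of $Y$ as a rational normal curve of degree $N$, that is, $i=[f_0:\cdots:f_N]$ for a basis $f_0,\dots,f_N$ of the binary forms of degree $N$. A morphism $\tilde i:\widetilde Y\to\mathbf P^N$ extends $i$ if its restriction to $Y$ is $i$. Theorem. Let $a\ge b$ be integers and let $\widetilde Y$ be a rope on $Y=\mathbf P^1$ with conormal bundle $\mathcal E=\mathcal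 O_{\mathbf P^1}(-a)\oplus\mathcal O_{\mathbf P^1}(-b)$. 1. If $N=a-2$, $N\ge 4$, and $\widetilde Y$ does not admit a projection onto a ribbon with conormal bundle $\mathcal O_{\mathbf P^1}(-b)$, then there exist embeddings (closed immersions) $\tilde i:\widetilde Y\hookrightarrow\mathbf P^N$ extending $i$. 2. If $N=a-2$ and $\widetilde Y$ admits a projection onto a ribbon with conormal bundle $\mathcal O_{\mathbf P^1}(-b)$, then there exist morphisms $\tilde i:\widetilde Y\to\mathbf P^N$ extending $i$, and all of them factor through a projection of $\widetilde Y$ onto a ribbon (the same for all of them) whose conormal bundle is a subsheaf of $\mathcal O_{\mathbf P^1}(-b)$. 3. If $N\le a-3$, then there exist morphisms $\widetilde Y\to\mathbf P^N$ extending $i$ only if $\widetilde Y$ admits a projection $p$ onto a ribbon $\widehat Y$ whose conormal bundle is a subsheaf of $\mathcal O_{\mathbf P^1}(-b)$, and then $p$ can be chosen so that all morphisms extending $i$ factor through $p:\widetilde Y\to\widehat Y$. In particular, suppose $N<a-1$. If $\widetilde Y$ can be embedded in $\mathbf P^N$ supported on a rational normal curve of degree $N$, then $N=a-2$ and $\widetilde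 Y$ does not admit a projection onto a ribbon with conormal bundle $\mathcal O_{\mathbf P^1}(-b)$; and the converse holds if $N\ge 4$. -/

import Mathlib

universe u

open AlgebraicGeometry CategoryTheory CategoryTheory.Limits TopologicalSpace

namespace RopesOnP1

section Glued

variable {X : Scheme.{u}} {A B : X.Opens} (t : Γ(X, A ⊓ B)ˣ)

/-- Restriction of regular functions to a smaller open set. -/
abbrev res {X : Scheme.{u}} {U V : X.Opens} (h : V ≤ U) : Γ(X, U) →+* Γ(X, V) :=
  (X.presheaf.map (homOfLE h).op).hom

lemma res_res {X : Scheme.{u}} {U V W : X.Opens} (h : V ≤ U) (h' : W ≤ V) (s : Γ(X, U)) :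
    res h' (res h s) = res (h'.trans h) s := by
  simp only [res, ← CommRingCat.comp_apply, ← Functor.map_comp]
  rfl

lemma res_self {X : Scheme.{u}} {U : X.Opens} (s : Γ(X, U)) : res le_rfl s = s :=
  congr($(X.presheaf.map_id (.op U)) s)

/-- The sections over `U` of the line bundle obtained by gluing the trivial bundles on `A` and `B`
along `A ⊓ B` by the unit `t`: pairs of a function `s.1` on `U ⊓ A` and a function `s.2` on `U ⊓ B`
with `s.1 = t * s.2` on `U ⊓ A ⊓ B`. -/
def gluedSections (U : X.Opens) : AddSubgroup (Γ(X, U ⊓ A) × Γ(X, U ⊓ B)) where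
  carrier := {s | res (inf_le_inf_left U inf_le_left : U ⊓ (A ⊓ B) ≤ U ⊓ A) s.1 =
    res (inf_le_right : U ⊓ (A ⊓ B) ≤ A ⊓ B) (t : Γ(X, A ⊓ B)) *
      res (inf_le_inf_left U inf_le_right : U ⊓ (A ⊓ B) ≤ U ⊓ B) s.2}
  zero_mem' := by simp
  add_mem' := by
    intro x y hx hy
    simp only [Set.mem_ofPred_eq, Prod.fst_add, Prod.snd_add, map_add, mul_add] at *
    rw [hx, hy]
  neg_mem' := by
    intro x hx
    simp only [Set.mem_ofPred_eq, Prod.fst_neg, Prod.snd_neg, map_neg, mul_neg] at *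
    rw [hx]

/-- Functions on `U` act on glued sections by multiplication in both components. -/
instance (U : X.Opens) : Module Γ(X, U) (gluedSections t U) where
  smul r s := ⟨(res inf_le_left r * s.1.1, res inf_le_left r * s.1.2), by
    have := s.2
    simp only [gluedSections, AddSubgroup.mem_mk] at this ⊢
    change res _ _ = _ * res _ _
    rw [map_mul, map_mul, this, res_res, res_res]
    ring⟩
  one_smul s := Subtype.ext (Prod.ext (by change res _ 1 * _ = _; simp)
    (by change res _ 1 * _ = _; simp))
  mul_smul r r' s := Subtype.ext (Prod.ext
    (by change res _ (r * r') * _ = _ * (_ * _); simp [mul_assoc])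
    (by change res _ (r * r') * _ = _ * (_ * _); simp [mul_assoc]))
  smul_zero r := Subtype.ext (Prod.ext (mul_zero _) (mul_zero _))
  smul_add r s s' := Subtype.ext (Prod.ext (mul_add _ _ _) (mul_add _ _ _))
  add_smul r r' s := Subtype.ext (Prod.ext
    (by change res _ (r + r') * _ = _ * _ + _ * _; simp [add_mul])
    (by change res _ (r + r') * _ = _ * _ + _ * _; simp [add_mul]))
  zero_smul s := Subtype.ext (Prod.ext (by change res _ 0 * _ = _; simp)
    (by change res _ 0 * _ = _; simp))


/-- Restriction of glued sections, componentwise. -/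
def gluedRes {U V : X.Opens} (h : V ≤ U) : gluedSections t U →+ gluedSections t V where
  toFun s := ⟨(res (inf_le_inf_right A h) s.1.1, res (inf_le_inf_right B h) s.1.2), by
    have := congr(res (inf_le_inf_right (A ⊓ B) h) $(s.2))
    rw [map_mul] at this
    change res _ (res _ _) = _ * res _ (res _ _)
    simp only [res_res] at this ⊢
    exact this⟩
  map_zero' := Subtype.ext (Prod.ext (map_zero _) (map_zero _))
  map_add' s s' := Subtype.ext (Prod.ext (map_add _ _ _) (map_add _ _ _))

lemma gluedRes_smul {U V : X.Opens} (h : V ≤ U) (r : Γ(X, U)) (s : gluedSections t U) :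
    gluedRes t h (r • s) = res h r • gluedRes t h s := by
  refine Subtype.ext (Prod.ext ?_ ?_)
  · change res _ (res _ r * _) = res _ (res _ r) * res _ _
    rw [map_mul, res_res, res_res]
  · change res _ (res _ r * _) = res _ (res _ r) * res _ _
    rw [map_mul, res_res, res_res]

/-- The presheaf of glued sections. -/
def gluedPresheaf : TopCat.Presheaf Ab.{u} X where
  obj U := AddCommGrpCat.of (gluedSections t U.unop)
  map f := AddCommGrpCat.ofHom (gluedRes t (leOfHom f.unop))
  map_id U := by
    refine AddCommGrpCat.hom_ext (AddMonoidHom.ext fun s ↦ Subtype.ext (Prod.ext ?_ ?_)) <;>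
    · change res _ _ = _
      exact res_self _
  map_comp f g := by
    refine AddCommGrpCat.hom_ext (AddMonoidHom.ext fun s ↦ Subtype.ext (Prod.ext ?_ ?_)) <;>
    · change res _ _ = res _ (res _ _)
      rw [res_res]

lemma res_existsUnique {X : Scheme.{u}} {ι : Type u} (U : ι → X.Opens) (V : X.Opens)
    (hUV : ∀ i, U i ≤ V) (hV : V ≤ iSup U) (s : ∀ i, Γ(X, U i))
    (hs : ∀ i i', res (inf_le_left : U i ⊓ U i' ≤ U i) (s i) = res inf_le_right (s i')) :
    ∃! g : Γ(X, V), ∀ i, res (hUV i) g = s i :=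
  X.sheaf.existsUnique_gluing' U V (fun i ↦ homOfLE (hUV i)) hV s hs

lemma gluedPresheaf_isSheaf : (gluedPresheaf t).IsSheaf := by
  rw [TopCat.Presheaf.isSheaf_iff_isSheafUniqueGluing]
  intro ι U sf hsf
  have key : ∀ C : X.Opens, iSup U ⊓ C ≤ ⨆ i, U i ⊓ C := fun C ↦ by rw [iSup_inf_eq]
  have h1 : ∀ i i', gluedRes t (inf_le_left : U i ⊓ U i' ≤ U i) (sf i) =
    gluedRes t inf_le_right (sf i') := hsf
  obtain ⟨g₁, hg₁, hu₁⟩ := res_existsUnique (fun i ↦ U i ⊓ A) (iSup U ⊓ A)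
    (fun i ↦ inf_le_inf_right A (le_iSup U i)) (key A) (fun i ↦ (sf i).1.1) fun i i' ↦ by
      have := congr(res (show (U i ⊓ A) ⊓ (U i' ⊓ A) ≤ (U i ⊓ U i') ⊓ A from
        le_inf (inf_le_inf inf_le_left inf_le_left) (inf_le_left.trans inf_le_right))
          ($(h1 i i')).1.1)
      change res _ (res _ _) = res _ (res _ _) at this
      simpa only [res_res] using this
  obtain ⟨g₂, hg₂, hu₂⟩ := res_existsUnique (fun i ↦ U i ⊓ B) (iSup U ⊓ B)
    (fun i ↦ inf_le_inf_right B (le_iSup U i)) (key B) (fun i ↦ (sf i).1.2) fun i i' ↦ by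
      have := congr(res (show (U i ⊓ B) ⊓ (U i' ⊓ B) ≤ (U i ⊓ U i') ⊓ B from
        le_inf (inf_le_inf inf_le_left inf_le_left) (inf_le_left.trans inf_le_right))
          ($(h1 i i')).1.2)
      change res _ (res _ _) = res _ (res _ _) at this
      simpa only [res_res] using this
  refine ⟨⟨(g₁, g₂), ?_⟩, fun i ↦ Subtype.ext (Prod.ext (hg₁ i) (hg₂ i)), fun s hs ↦
    Subtype.ext (Prod.ext (hu₁ _ fun i ↦ congr(($(hs i)).1.1)) (hu₂ _ fun i ↦ congr(($(hs i)).1.2)))⟩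
  have hle : ∀ i, U i ⊓ (A ⊓ B) ≤ iSup U ⊓ (A ⊓ B) := fun i ↦ inf_le_inf_right _ (le_iSup U i)
  refine (res_existsUnique (fun i ↦ U i ⊓ (A ⊓ B)) (iSup U ⊓ (A ⊓ B)) hle (key _)
    (fun i ↦ res (hle i) (res (inf_le_inf_left (iSup U) inf_le_left) g₁))
    fun i i' ↦ ?_).unique (fun i ↦ rfl) fun i ↦ ?_
  · simp only [res_res]
  · rw [map_mul]
    simp only [res_res]
    have h := (sf i).2
    change res _ (sf i).1.1 = _ * res _ (sf i).1.2 at h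
    rw [← hg₁ i, ← hg₂ i] at h
    simp only [res_res] at h
    exact h.symm

instance (U : X.Opensᵒᵖ) : Module (X.ringCatSheaf.obj.obj U) ((gluedPresheaf t).obj U) :=
  inferInstanceAs (Module Γ(X, U.unop) (gluedSections t U.unop))

/-- The sheaf of modules glued from `𝒪` on `A` and `𝒪` on `B` with transition function `t`. It is a
line bundle when `A` and `B` cover `X`. -/
noncomputable def glued : X.Modules where
  val := PresheafOfModules.ofPresheaf (gluedPresheaf t)
    fun _ _ f r m ↦ gluedRes_smul t (leOfHom f.unop) r m
  isSheaf := gluedPresheaf_isSheaf t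

end Glued

noncomputable section ProjectiveSpace

variable (k : Type u) [Field k]

/-- The homogeneous coordinate ring `k[X₀, …, Xₙ]`, graded by degree: `forms k n d` is the space of
forms of degree `d` in `n + 1` variables. -/
abbrev forms (n : ℕ) : ℕ → Submodule k (MvPolynomial (Fin (n + 1)) k) :=
  MvPolynomial.homogeneousSubmodule (Fin (n + 1)) k

instance (n : ℕ) : GradedAlgebra (forms k n) := MvPolynomial.gradedAlgebra

/-- Projective `n`-space over `k`, as a `k`-scheme. -/
def projSpace (n : ℕ) : Over (Spec (.of k)) :=
  Over.mk (Y := Proj (forms k n)) (Proj.toSpecZero (forms k n) ≫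
    Spec.map (CommRingCat.ofHom (algebraMap k (forms k n 0))))

/-- The coordinate `Xₗ` as a form of degree one. -/
def coord (n : ℕ) (l : Fin (n + 1)) : forms k n 1 :=
  ⟨MvPolynomial.X l, MvPolynomial.isHomogeneous_X k l⟩

variable {k}

/-- The open subset `D₊(q)` of projective space where the form `q` does not vanish. -/
def Dplus {n d : ℕ} (q : forms k n d) : (projSpace k n).left.Opens :=
  Proj.basicOpen (forms k n) q.1

/-- The regular function `p / q` on `D₊(q)`, for forms `p` and `q` of the same degree. -/
def frac {n d : ℕ} (p q : forms k n d) : Γ((projSpace k n).left, Dplus q) :=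
  Proj.awayToSection (forms k n) q.1
    (HomogeneousLocalization.mk ⟨d, p, q, Submonoid.mem_powers _⟩)

lemma frac_mul_frac {n d : ℕ} (p q : forms k n d) :
    res (inf_le_left : Dplus p ⊓ Dplus q ≤ Dplus p) (frac q p) * res (inf_le_right) (frac p q) = 1 := by
  refine Subtype.ext (funext fun x ↦ HomogeneousLocalization.val_injective _ ?_)
  have := (show ProjectiveSpectrum (forms k n) from x.1).isPrime
  change (HomogeneousLocalization.mk _ * HomogeneousLocalization.mk _ :
    HomogeneousLocalization.AtPrime (forms k n)
      (x.1 : ProjectiveSpectrum (forms k n)).asHomogeneousIdeal.toIdeal).val = _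
  rw [HomogeneousLocalization.val_mul, HomogeneousLocalization.val_mk,
    HomogeneousLocalization.val_mk, Localization.mk_mul]
  refine .trans ?_ HomogeneousLocalization.val_one.symm
  rw [← Localization.mk_one]
  refine Localization.mk_eq_mk_iff.mpr (Localization.r_of_eq ?_)
  change 1 * (q.1 * p.1) = (p.1 * q.1) * 1
  ring

variable (k)

/-- The function `X₁ / X₀`, a unit on the intersection of the two standard charts of `ℙ¹`. -/
def transition :
    Γ((projSpace k 1).left, Dplus (coord k 1 0) ⊓ Dplus (coord k 1 1))ˣ where
  val := res inf_le_left (frac (coord k 1 1) (coord k 1 0))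
  inv := res inf_le_right (frac (coord k 1 0) (coord k 1 1))
  val_inv := frac_mul_frac _ _
  inv_val := by rw [mul_comm]; exact frac_mul_frac _ _

/-- The line bundle `𝒪(d)` on `ℙ¹`: the pair `(s₀, s₁)` stands for the section which is
`s₀ X₀ ^ d` where `X₀ ≠ 0` and `s₁ X₁ ^ d` where `X₁ ≠ 0`, so that `s₀ = (X₁ / X₀) ^ d s₁`. -/
def twist (d : ℤ) : (projSpace k 1).left.Modules :=
  glued (transition k ^ d)

variable {k}

/-- A morphism `i : ℙ¹ ⟶ ℙᴺ` is the embedding of `ℙ¹` as a rational normal curve (of degree `N`) if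
it is `[f₀ : ⋯ : f_N]` for some basis `f₀, …, f_N` of the space of binary forms of degree `N`: the
inverse image of `D₊(Xₘ)` is `D₊(fₘ)`, and `Xₗ / Xₘ` pulls back to `fₗ / fₘ`. -/
def IsRationalNormalCurve {N : ℕ} (i : projSpace k 1 ⟶ projSpace k N) : Prop :=
  ∃ f : Module.Basis (Fin (N + 1)) k (forms k 1 N), ∀ m : Fin (N + 1),
    ∃ h : i.left ⁻¹ᵁ Dplus (coord k N m) = Dplus (f m), ∀ l : Fin (N + 1),
      i.left.appLE (Dplus (coord k N m)) (Dplus (f m)) h.ge (frac (coord k N l) (coord k N m)) =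
        frac (f l) (f m)

end ProjectiveSpace

section Ropes

/-- For `j : Y ⟶ X`, an isomorphism of the ideal sheaf `U ↦ ker (Γ(X, U) → Γ(Y, j⁻¹ U))` of `Y` in
`X` with the direct image of an `𝒪_Y`-module `E`. When `j` is a closed immersion whose ideal sheaf
has square zero, this is an isomorphism of `𝒪_Y`-modules between the ideal sheaf and `E`. -/
structure ConormalIso {Y X : Scheme.{u}} (j : Y ⟶ X) (E : Y.Modules) where
  /-- The isomorphism on sections over `U`. -/
  equiv (U : X.Opens) : RingHom.ker (j.app U).hom ≃+ Γ(E, j ⁻¹ᵁ U)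
  map_smul (U : X.Opens) (r : Γ(X, U)) (x : RingHom.ker (j.app U).hom) :
    equiv U (r • x) = (j.app U r : Γ(Y, j ⁻¹ᵁ U)) • equiv U x
  map_res {U V : X.Opens} (h : V ≤ U) (x : RingHom.ker (j.app U).hom)
    (y : RingHom.ker (j.app V).hom) (hxy : y.1 = res h x.1) :
    equiv V y = E.presheaf.map (homOfLE (j.preimage_mono h)).op (equiv U x)

/-- `E` is locally free of rank one. -/
def IsLineBundle {Y : Scheme.{u}} (E : Y.Modules) : Prop :=
  ∀ y : Y, ∃ U : Y.Opens, y ∈ U ∧ Nonempty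
    (E.restrict U.ι ≅ (SheafOfModules.unit U.toScheme.ringCatSheaf : U.toScheme.Modules))

variable {S : Scheme.{u}} {Y Yt Yh : Over S}

/-- `j : Y ⟶ Yt` exhibits the `S`-scheme `Yt` as a rope on `Y` with conormal bundle `E`: it is a
closed immersion, its ideal sheaf has square zero and is isomorphic to `E`. If `Y` is reduced then
`Y` is the reduced structure of `Yt`; if `E` is locally free of rank `m - 1` the rope has
multiplicity `m`. -/
structure IsRope (j : Y ⟶ Yt) (E : Y.left.Modules) : Prop where
  isClosedImmersion : IsClosedImmersion j.left
  ker_sq : j.left.ker ^ 2 = ⊥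
  conormal : Nonempty (ConormalIso j.left E)

/-- A ribbon is a rope whose conormal bundle is a line bundle. -/
structure IsRibbon (j : Y ⟶ Yt) (L : Y.left.Modules) : Prop extends IsRope j L where
  isLineBundle : IsLineBundle L

/-- `p` is a projection of the rope `j : Y ⟶ Yt` onto the rope `j' : Y ⟶ Yh`: a morphism which is
the identity on `Y` and is onto in the scheme-theoretic sense, that is, `𝒪_Yh → p_* 𝒪_Yt` is
injective. -/
structure IsProjection (j : Y ⟶ Yt) (j' : Y ⟶ Yh) (p : Yt ⟶ Yh) : Prop where
  comp_eq : j ≫ p = j'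
  dominant : IsSchemeTheoreticallyDominant p.left

/-- The rope `j : Y ⟶ Yt` admits a projection onto a ribbon with conormal bundle `L`. -/
def ProjectsOntoRibbon (j : Y ⟶ Yt) (L : Y.left.Modules) : Prop :=
  ∃ (Yh : Over S) (j' : Y ⟶ Yh) (p : Yt ⟶ Yh), IsRibbon j' L ∧ IsProjection j j' p

/-- For a rope `j : Y ⟶ Yt` and `i : Y ⟶ Z`: there is a projection `p` of `Yt` onto a ribbon whose
conormal bundle is a subsheaf of `M`, and all morphisms `Yt ⟶ Z` extending `i` factor through `p`. -/
def ExtensionsFactorThroughRibbon {Z : Over S} (j : Y ⟶ Yt) (i : Y ⟶ Z) (M : Y.left.Modules) :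
    Prop :=
  ∃ (Yh : Over S) (j' : Y ⟶ Yh) (p : Yt ⟶ Yh) (L : Y.left.Modules),
    IsRibbon j' L ∧ (∃ φ : L ⟶ M, Mono φ) ∧ IsProjection j j' p ∧
      ∀ i' : Yt ⟶ Z, j ≫ i' = i → ∃ g : Yh ⟶ Z, p ≫ g = i'

end Ropes

end RopesOnP1

open RopesOnP1

/-! Write `T = X₁ / X₀`. On the two standard charts, lift the affine coordinates of the line to
functions `x` and `y` on the rope. On the overlap `x y = 1 + ε`, where `ε` is a section of the
ideal, that is, a pair of Laurent polynomials. Changing `x` and `y` alters a component of `ε` of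
degree `d` by `T⁻¹ u(T) + T^(1+d) v(T⁻¹)` (`GluedRings.eps_change`). The class of `ε` therefore lies
in `H¹(𝒪(2-a)) ⊕ H¹(𝒪(2-b))`; this is the class of the rope.

A linear change of coordinates reduces everything to the monomial curve
(`IsRationalNormalCurve.exists_iso`). An extension of it has coordinates `F₀ = 1, F₁, …, F_N` on the
first chart lifting the powers of `T`, and similarly on the second chart. Put `F_{l+1} = x F_l -
w_l`. The two families glue exactly when, for each `l < N`, `T^(l+1) ε` is the Čech coboundary of
the corrections in the twist by `N + 1` (`exists_extension`, `exists_rel_of_extension`). So the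
groups that matter are `H⁰` and `H¹` of `𝒪(N+1-a)` and `𝒪(N+1-b)`.

A projection onto a ribbon with conormal bundle `𝒪(-b)` is the same as a nonzero constant functional
`ψ`, supported on the summands of degree `-a`, with `ψ(ε) = 0` for suitable lifts. One direction
holds because maps `𝒪(-b) → 𝒪(-a)` and `𝒪(-b) → 𝒪(-b)` are given by constants
(`GluedRings.exists_functional`). For the other, the ribbon is the scheme-theoretic image of the
rope in a projective space of large dimension (`exists_ribbon`). If such a `ψ` exists and `N ≤ a -
2`, then `ψ(w_l)` is a global section of a bundle of negative degree, hence zero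
(`GluedRings.Rel.func_eq_zero`). So all extensions factor through the ribbon and none is an
embedding. If `N ≤ a - 3`, an extension can exist only if the class along `𝒪(-a)` vanishes
(`GluedRings.Rel.coeff_eq_zero`), which yields such a `ψ`.

If `N = a - 2`, both `H¹` groups vanish and extensions exist. The coordinate functions generate the
part of the ideal spanned by the vectors `T w_l - w_{l+1}`. Their first components are constants
read off from `ε`. The second components can be adjusted by polynomials of degree less than `a - b`,
and when no `ψ` kills the class they can be chosen so that the `2 × 2` minors have no common zero on
the line (`exists_coprime_minors`, `GluedRings.exists_rel_generating`). The extension is then a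
closed immersion. -/

namespace RopesOnP1

/-! ### Morphisms into affine open sets, and gluing them -/

section Gluing

variable {X Y Z : Scheme.{u}}

/-- Pullback of functions along `f`, as a ring homomorphism. -/
abbrev pull (f : X ⟶ Y) {U : Y.Opens} {V : X.Opens} (h : V ≤ f ⁻¹ᵁ U) : Γ(Y, U) →+* Γ(X, V) :=
  (f.appLE U V h).hom

lemma res_pull (f : X ⟶ Y) {U : Y.Opens} {V V' : X.Opens} (h : V ≤ f ⁻¹ᵁ U) (h' : V' ≤ V)
    (s : Γ(Y, U)) : res h' (pull f h s) = pull f (h'.trans h) s := by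
  simp only [res, pull, ← CommRingCat.comp_apply, Scheme.Hom.appLE_map]

lemma pull_res (f : X ⟶ Y) {U U' : Y.Opens} {V : X.Opens} (h : V ≤ f ⁻¹ᵁ U') (h' : U' ≤ U)
    (s : Γ(Y, U)) : pull f h (res h' s) = pull f (h.trans (f.preimage_mono h')) s := by
  simp only [res, pull, ← CommRingCat.comp_apply, Scheme.Hom.map_appLE]

lemma pull_pull (f : X ⟶ Y) (g : Y ⟶ Z) {U : Z.Opens} {V : Y.Opens} {W : X.Opens}
    (h : V ≤ g ⁻¹ᵁ U) (h' : W ≤ f ⁻¹ᵁ V) (s : Γ(Z, U)) :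
    pull f h' (pull g h s) = pull (f ≫ g) (h'.trans (f.preimage_mono h)) s := by
  simp only [pull, ← CommRingCat.comp_apply, Scheme.Hom.appLE_comp_appLE]

lemma pull_congr {f g : X ⟶ Y} (h : f = g) {U : Y.Opens} {V : X.Opens} (e : V ≤ f ⁻¹ᵁ U)
    (s : Γ(Y, U)) : pull f e s = pull g (h ▸ e) s := by
  subst h; rfl

lemma app_eq_pull (f : X ⟶ Y) (U : Y.Opens) (s : Γ(Y, U)) : f.app U s = pull f le_rfl s := by
  rw [Scheme.Hom.app_eq_appLE]

lemma toSpecΓ_appLE_fromSpec (f : X ⟶ Y) {U : Y.Opens} (hU : IsAffineOpen U) {V : X.Opens}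
    (h : V ≤ f ⁻¹ᵁ U) : V.toSpecΓ ≫ Spec.map (f.appLE U V h) ≫ hU.fromSpec = V.ι ≫ f := by
  rw [← f.resLE_comp_ι h, ← hU.toSpecΓ_fromSpec, Scheme.Opens.toSpecΓ_SpecMap_appLE_assoc]

/-- On `V` each morphism factors through the spectrum of the functions on `U`, so it is determined
by its pullback of those functions; the sets `V` cover `X`. -/
lemma hom_ext_of_pull (f g : X ⟶ Y)
    (H : ∀ x : X, ∃ (U : Y.Opens) (V : X.Opens) (hf : V ≤ f ⁻¹ᵁ U) (hg : V ≤ g ⁻¹ᵁ U),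
      x ∈ V ∧ IsAffineOpen U ∧ pull f hf = pull g hg) : f = g := by
  refine Scheme.hom_ext_of_forall _ _ fun x ↦ ?_
  obtain ⟨U, V, hf, hg, hx, hU, h⟩ := H x
  refine ⟨V, hx, ?_⟩
  rw [← toSpecΓ_appLE_fromSpec f hU hf, ← toSpecΓ_appLE_fromSpec g hU hg]
  congr 2
  exact congrArg Spec.map (CommRingCat.hom_ext h)

/-- The morphism `V ⟶ Y` which lands in the affine open set `U` and pulls back functions on `U`
by `φ`. -/
noncomputable def homOfAffine {U : Y.Opens} (hU : IsAffineOpen U) {V : X.Opens}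
    (φ : Γ(Y, U) →+* Γ(X, V)) : V.toScheme ⟶ Y :=
  V.toSpecΓ ≫ Spec.map (CommRingCat.ofHom φ) ≫ hU.fromSpec

lemma le_preimage_of_ι_comp {U : Y.Opens} (hU : IsAffineOpen U) {V : X.Opens}
    (φ : Γ(Y, U) →+* Γ(X, V)) {g : X ⟶ Y} (hg : V.ι ≫ g = homOfAffine hU φ) : V ≤ g ⁻¹ᵁ U := by
  have h : V.ι ⁻¹ᵁ g ⁻¹ᵁ U = ⊤ := by
    rw [← Scheme.Hom.comp_preimage, hg]
    simp [homOfAffine]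
  intro x hx
  have : (⟨x, hx⟩ : V) ∈ V.ι ⁻¹ᵁ g ⁻¹ᵁ U := by rw [h]; trivial
  exact this

lemma pull_of_ι_comp {U : Y.Opens} (hU : IsAffineOpen U) {V : X.Opens}
    (φ : Γ(Y, U) →+* Γ(X, V)) {g : X ⟶ Y} (hg : V.ι ≫ g = homOfAffine hU φ) (h : V ≤ g ⁻¹ᵁ U) :
    pull g h = φ := by
  have h1 := toSpecΓ_appLE_fromSpec g hU h
  rw [hg, homOfAffine] at h1
  simp only [← Category.assoc, cancel_mono] at h1
  have h2 := congr(($h1).appTop)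
  simp only [Scheme.Hom.comp_appTop, Scheme.Opens.toSpecΓ_appTop] at h2
  rw [Scheme.ΓSpecIso_naturality_assoc, Scheme.ΓSpecIso_naturality_assoc] at h2
  have h3 := (cancel_epi (Scheme.ΓSpecIso Γ(Y, U)).hom).mp h2
  exact congr(($((cancel_mono V.topIso.inv).mp h3)).hom)

lemma homOfLE_comp_homOfAffine {U : Y.Opens} (hU : IsAffineOpen U) {V W : X.Opens} (h : W ≤ V)
    (φ : Γ(Y, U) →+* Γ(X, V)) :
    X.homOfLE h ≫ homOfAffine hU φ = homOfAffine hU ((res h).comp φ) := by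
  simp [homOfAffine, CommRingCat.ofHom_comp, Spec.map_comp, res,
    Scheme.Opens.toSpecΓ_SpecMap_presheaf_map_assoc]

lemma le_ι_preimage (V : X.Opens) : ⊤ ≤ V.ι ⁻¹ᵁ V := V.ι_preimage_self.ge

lemma ι_top_comp_homOfAffine {U : Y.Opens} (hU : IsAffineOpen U) {V : X.Opens}
    (φ : Γ(Y, U) →+* Γ(X, V)) : Scheme.Opens.ι ⊤ ≫ homOfAffine hU φ =
      homOfAffine hU ((pull V.ι (le_ι_preimage V)).comp φ) := by
  have h : V.ι.resLE V ⊤ (le_ι_preimage V) = Scheme.Opens.ι ⊤ := by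
    rw [← cancel_mono V.ι, Scheme.Hom.resLE_comp_ι]
  rw [homOfAffine, homOfAffine, CommRingCat.ofHom_comp, Spec.map_comp, ← h, Category.assoc]
  change _ = Scheme.Opens.toSpecΓ ⊤ ≫ Spec.map (V.ι.appLE V ⊤ (le_ι_preimage V)) ≫ _
  rw [Scheme.Opens.toSpecΓ_SpecMap_appLE_assoc]

lemma le_preimage_homOfAffine {U : Y.Opens} (hU : IsAffineOpen U) {V : X.Opens}
    (φ : Γ(Y, U) →+* Γ(X, V)) : ⊤ ≤ homOfAffine hU φ ⁻¹ᵁ U :=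
  le_preimage_of_ι_comp hU _ (ι_top_comp_homOfAffine hU φ)

lemma pull_homOfAffine {U : Y.Opens} (hU : IsAffineOpen U) {V : X.Opens}
    (φ : Γ(Y, U) →+* Γ(X, V)) :
    pull (homOfAffine hU φ) (le_preimage_homOfAffine hU φ) =
      (pull V.ι (le_ι_preimage V)).comp φ :=
  pull_of_ι_comp hU _ (ι_top_comp_homOfAffine hU φ) _

lemma exists_glue₂ {A B : X.Opens} (hAB : A ⊔ B = ⊤) (f : A.toScheme ⟶ Z) (g : B.toScheme ⟶ Z)
    (h : X.homOfLE (inf_le_left : A ⊓ B ≤ A) ≫ f = X.homOfLE (inf_le_right : A ⊓ B ≤ B) ≫ g) :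
    ∃ F : X ⟶ Z, A.ι ≫ F = f ∧ B.ι ≫ F = g := by
  let U : ULift.{u} Bool → X.Opens := fun i ↦ bif i.down then A else B
  let 𝒰 : X.OpenCover := X.openCoverOfIsOpenCover U (top_unique (by
    rw [← hAB]
    exact sup_le (le_iSup U ⟨true⟩) (le_iSup U ⟨false⟩)))
  have key {A B : X.Opens} (f : A.toScheme ⟶ Z) (g : B.toScheme ⟶ Z) (h : X.homOfLE
      (inf_le_left : A ⊓ B ≤ A) ≫ f = X.homOfLE (inf_le_right : A ⊓ B ≤ B) ≫ g) :
      pullback.fst A.ι B.ι ≫ f = pullback.snd A.ι B.ι ≫ g := by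
    rw [← cancel_epi (isPullback_opens_inf A B).isoPullback.hom,
      IsPullback.isoPullback_hom_fst_assoc, IsPullback.isoPullback_hom_snd_assoc]
    exact h
  let F : ∀ i, (U i).toScheme ⟶ Z := fun i ↦ match i with
    | ⟨true⟩ => f
    | ⟨false⟩ => g
  have h' : X.homOfLE (inf_le_left : B ⊓ A ≤ B) ≫ g = X.homOfLE (inf_le_right : B ⊓ A ≤ A) ≫ f := by
    have e : B ⊓ A ≤ A ⊓ B := (inf_comm B A).le
    have := congrArg (X.homOfLE e ≫ ·) h
    simpa using this.symm
  have hF (i j : ULift.{u} Bool) : pullback.fst (U i).ι (U j).ι ≫ F i =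
      pullback.snd (U i).ι (U j).ι ≫ F j :=
    match i, j with
    | ⟨true⟩, ⟨true⟩ => key f f rfl
    | ⟨true⟩, ⟨false⟩ => key f g h
    | ⟨false⟩, ⟨true⟩ => key g f h'
    | ⟨false⟩, ⟨false⟩ => key g g rfl
  exact ⟨𝒰.glueMorphisms F hF, 𝒰.ι_glueMorphisms F hF ⟨true⟩, 𝒰.ι_glueMorphisms F hF ⟨false⟩⟩

end Gluing

/-! ### Constants on a scheme over a field -/

noncomputable section Scalars

variable {k : Type u} [Field k]

lemma le_preimage_top {X Y : Scheme.{u}} (f : X ⟶ Y) (U : X.Opens) : U ≤ f ⁻¹ᵁ ⊤ := le_top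

/-- The structure morphism of a `k`-scheme. -/
abbrev toSpec (X : Over (Spec (.of k))) : X.left ⟶ Spec (.of k) := X.hom

/-- The constants in the ring of functions on an open set of a `k`-scheme. -/
def scal (X : Over (Spec (.of k))) (U : X.left.Opens) : k →+* Γ(X.left, U) :=
  (pull (toSpec X) (le_preimage_top (toSpec X) U)).comp (Scheme.ΓSpecIso (.of k)).inv.hom

variable {X Y : Over (Spec (.of k))}

lemma scal_apply (U : X.left.Opens) (c : k) : scal X U c =
    pull (toSpec X) (le_preimage_top (toSpec X) U) ((Scheme.ΓSpecIso (.of k)).inv.hom c) := rfl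

lemma res_scal {U V : X.left.Opens} (h : V ≤ U) (c : k) : res h (scal X U c) = scal X V c := by
  rw [scal_apply, res_pull, scal_apply]

lemma pull_scal (f : X ⟶ Y) {U : Y.left.Opens} {V : X.left.Opens} (h : V ≤ f.left ⁻¹ᵁ U) (c : k) :
    pull f.left h (scal Y U c) = scal X V c := by
  rw [scal_apply, pull_pull, scal_apply]
  exact pull_congr (Over.w f) _ _

/-- A morphism of schemes which respects constants locally is a morphism of `k`-schemes. -/
lemma comp_toSpec_eq_of_pull_scal (f : X.left ⟶ Y.left)
    (H : ∀ x : X.left, ∃ (U : Y.left.Opens) (V : X.left.Opens) (h : V ≤ f ⁻¹ᵁ U),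
      x ∈ V ∧ ∀ c, pull f h (scal Y U c) = scal X V c) : f ≫ toSpec Y = toSpec X := by
  refine hom_ext_of_pull _ _ fun x ↦ ?_
  obtain ⟨U, V, h, hx, H⟩ := H x
  refine ⟨⊤, V, le_preimage_top _ _, le_preimage_top _ _, hx, isAffineOpen_top _, RingHom.ext fun s ↦ ?_⟩
  obtain ⟨c, rfl⟩ : ∃ c, (Scheme.ΓSpecIso (.of k)).inv.hom c = s :=
    ⟨(Scheme.ΓSpecIso (.of k)).hom.hom s, by simp⟩
  have := H c
  rw [scal_apply, pull_pull, scal_apply] at this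
  exact this

end Scalars

section Homogeneous

lemma _root_.MvPolynomial.IsHomogeneous.pow_mul_eval₂ {σ k R : Type*} [CommRing k] [CommRing R]
    (c : k →+* R) (g : σ → R) (l : R) {d : ℕ} {p : MvPolynomial σ k} (hp : p.IsHomogeneous d) :
    l ^ d * p.eval₂ c g = p.eval₂ c (fun i ↦ l * g i) := by
  rw [MvPolynomial.eval₂_eq, MvPolynomial.eval₂_eq, Finset.mul_sum]
  refine Finset.sum_congr rfl fun m hm ↦ ?_
  have h := hp (MvPolynomial.mem_support_iff.mp hm)
  rw [Finsupp.weight_apply, Finsupp.sum] at h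
  simp only [smul_eq_mul, mul_one, Pi.one_apply] at h
  simp only [mul_pow, Finset.prod_mul_distrib, Finset.prod_pow_eq_pow_sum, h]
  ring

end Homogeneous

/-! ### Functions on the standard charts of projective space -/

noncomputable section Charts

variable {k : Type u} [Field k] {n : ℕ}

lemma pull_comp_ΓSpecIso_inv {X : Scheme.{u}} {R : CommRingCat.{u}} (g : X ⟶ Spec R) {V : X.Opens}
    (ψ : R ⟶ Γ(X, V)) (h : V.ι ≫ g = V.toSpecΓ ≫ Spec.map ψ) (r : R) :
    pull g (le_preimage_top g V) ((Scheme.ΓSpecIso R).inv r) = ψ r := by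
  have h2 : V.toSpecΓ ≫ Spec.map ((Scheme.ΓSpecIso R).inv ≫ g.appLE ⊤ V (le_preimage_top g V)) =
      V.toSpecΓ ≫ Spec.map ψ := by
    rw [← h, ← toSpecΓ_appLE_fromSpec g (isAffineOpen_top _) (le_preimage_top g V)]
    rw [Spec.map_comp, IsAffineOpen.fromSpec_top]
    congr 2
    simp [Scheme.isoSpec_Spec]
  have h3 := congr(($h2).appTop)
  simp only [Scheme.Hom.comp_appTop, Scheme.Opens.toSpecΓ_appTop] at h3
  rw [Scheme.ΓSpecIso_naturality_assoc, Scheme.ΓSpecIso_naturality_assoc] at h3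
  have h4 := (cancel_epi (Scheme.ΓSpecIso R).hom).mp h3
  exact congr(($((cancel_mono V.topIso.inv).mp h4)).hom r)

/-- The fraction `Xₗ / Xₘ`. -/
def awayFrac (m l : Fin (n + 1)) : HomogeneousLocalization.Away (forms k n) (MvPolynomial.X m) :=
  HomogeneousLocalization.mk
    ⟨1, coord k n l, ⟨MvPolynomial.X m, (coord k n m).2⟩, Submonoid.mem_powers _⟩

/-- Elements of the homogeneous localization as functions on the chart. -/
def awaySec (m : Fin (n + 1)) : HomogeneousLocalization.Away (forms k n) (MvPolynomial.X m) →+*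
    Γ((projSpace k n).left, Dplus (coord k n m)) :=
  (Proj.awayToSection (forms k n) (MvPolynomial.X m)).hom

lemma scal_eq_awaySec (m : Fin (n + 1)) (c : k) :
    scal (projSpace k n) (Dplus (coord k n m)) c = awaySec m
      (HomogeneousLocalization.fromZeroRingHom (forms k n) _ (algebraMap k (forms k n 0) c)) := by
  have hX : (MvPolynomial.X m : MvPolynomial (Fin (n + 1)) k) ∈ forms k n 1 := (coord k n m).2
  refine pull_comp_ΓSpecIso_inv (X := Proj (forms k n)) (R := .of k) (toSpec (projSpace k n))
    (V := Proj.basicOpen _ (MvPolynomial.X m)) (CommRingCat.ofHom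
      (S := Γ((projSpace k n).left, Dplus (coord k n m)))
      (((awaySec m).comp
        (HomogeneousLocalization.fromZeroRingHom (forms k n) _)).comp
          (algebraMap k (forms k n 0)))) ?_ c
  have h := Proj.awayι_toSpecZero (forms k n) (MvPolynomial.X m) hX one_pos
  have h0 : (Proj.basicOpen (forms k n) (MvPolynomial.X m)).ι =
      Proj.basicOpenToSpec _ _ ≫ Proj.awayι _ _ hX one_pos := by
    rw [← Proj.basicOpenIsoSpec_hom _ _ hX one_pos, ← Proj.basicOpenIsoSpec_inv_ι,
      Iso.hom_inv_id_assoc]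
  change _ ≫ Proj.toSpecZero _ ≫ Spec.map _ = _
  rw [h0, Category.assoc, reassoc_of% h, Proj.basicOpenToSpec, Category.assoc]
  rw [← Spec.map_comp, ← Spec.map_comp]
  rfl

lemma res_frac_mul_res_frac {d : ℕ} (p q r : forms k n d) {W : (projSpace k n).left.Opens}
    (hq : W ≤ Dplus q) (hr : W ≤ Dplus r) :
    res hq (frac p q) * res hr (frac q r) = res hr (frac p r) := by
  refine Subtype.ext (funext fun x ↦ HomogeneousLocalization.val_injective _ ?_)
  have := (show ProjectiveSpectrum (forms k n) from x.1).isPrime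
  change (HomogeneousLocalization.mk _ * HomogeneousLocalization.mk _ :
    HomogeneousLocalization.AtPrime (forms k n)
      (x.1 : ProjectiveSpectrum (forms k n)).asHomogeneousIdeal.toIdeal).val =
      (HomogeneousLocalization.mk _).val
  rw [HomogeneousLocalization.val_mul, HomogeneousLocalization.val_mk,
    HomogeneousLocalization.val_mk, HomogeneousLocalization.val_mk, Localization.mk_mul]
  refine Localization.mk_eq_mk_iff.mpr (Localization.r_of_eq ?_)
  change r.1 * (p.1 * q.1) = (q.1 * r.1) * p.1
  ring

lemma res_frac_self {d : ℕ} (p : forms k n d) {W : (projSpace k n).left.Opens}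
    (hp : W ≤ Dplus p) : res hp (frac p p) = 1 := by
  refine Subtype.ext (funext fun x ↦ HomogeneousLocalization.val_injective _ ?_)
  have := (show ProjectiveSpectrum (forms k n) from x.1).isPrime
  change (HomogeneousLocalization.mk _ : HomogeneousLocalization.AtPrime (forms k n)
      (x.1 : ProjectiveSpectrum (forms k n)).asHomogeneousIdeal.toIdeal).val = _
  rw [HomogeneousLocalization.val_mk]
  refine .trans ?_ HomogeneousLocalization.val_one.symm
  rw [← Localization.mk_one]
  exact Localization.mk_eq_mk_iff.mpr (Localization.r_of_eq (mul_comm _ _))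

/-- The `m`-th standard chart of projective space. -/
abbrev chart (k : Type u) [Field k] (n : ℕ) (m : Fin (n + 1)) : (projSpace k n).left.Opens :=
  Dplus (coord k n m)

/-- The affine coordinates on the `m`-th chart. -/
abbrev aff (k : Type u) [Field k] (n : ℕ) (m l : Fin (n + 1)) :
    Γ((projSpace k n).left, chart k n m) :=
  frac (coord k n l) (coord k n m)

lemma isAffineOpen_chart (m : Fin (n + 1)) : IsAffineOpen (chart k n m) :=
  Proj.isAffineOpen_basicOpen _ _ (coord k n m).2 one_pos

lemma aff_self (m : Fin (n + 1)) : aff k n m m = 1 := by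
  simpa [res_self] using res_frac_self (coord k n m) le_rfl

/-- Substitution of the affine coordinates of the `m`-th chart. -/
def dehom (k : Type u) [Field k] (n : ℕ) (m : Fin (n + 1)) :
    MvPolynomial (Fin (n + 1)) k →+* Γ((projSpace k n).left, chart k n m) :=
  MvPolynomial.eval₂Hom (scal _ _) (aff k n m)

/-- Both sides are compared in the ungraded localization, where they become evaluations of `p`.
Since `p` is homogeneous of degree `d`, the denominator `X_m ^ d` can be absorbed into the
variables, turning `X_l / X_m` into `X_l`. -/
lemma awaySec_mk (m : Fin (n + 1)) {d : ℕ} (p : forms k n d) :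
    awaySec m (HomogeneousLocalization.mk ⟨d, p, ⟨MvPolynomial.X m ^ d,
        (MvPolynomial.mem_homogeneousSubmodule _ _).mpr (MvPolynomial.isHomogeneous_X_pow m d)⟩, ⟨d, rfl⟩⟩) = dehom k n m p.1 := by
  let c : k →+* HomogeneousLocalization.Away (forms k n) (MvPolynomial.X m) :=
    (HomogeneousLocalization.fromZeroRingHom (forms k n) _).comp (algebraMap k (forms k n 0))
  have h1 : dehom k n m = (awaySec m).comp
      (MvPolynomial.eval₂Hom c (awayFrac m)) := by
    refine MvPolynomial.ringHom_ext (fun a ↦ ?_) fun l ↦ ?_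
    · simp only [dehom, MvPolynomial.coe_eval₂Hom, MvPolynomial.eval₂_C, RingHom.comp_apply]
      exact scal_eq_awaySec m a
    · simp only [dehom, MvPolynomial.coe_eval₂Hom, MvPolynomial.eval₂_X, RingHom.comp_apply]
      rfl
  rw [h1, RingHom.comp_apply]
  congr 1
  refine HomogeneousLocalization.val_injective _ ?_
  let A := Localization.Away (MvPolynomial.X m : MvPolynomial (Fin (n + 1)) k)
  have h2 : (algebraMap _ A).comp (MvPolynomial.eval₂Hom c (awayFrac m)) =
      MvPolynomial.eval₂Hom (algebraMap k A)
        fun l ↦ Localization.mk (MvPolynomial.X l) ⟨MvPolynomial.X m, Submonoid.mem_powers _⟩ := by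
    refine MvPolynomial.ringHom_ext (fun a ↦ ?_) fun l ↦ ?_
    · simp only [MvPolynomial.coe_eval₂Hom, MvPolynomial.eval₂_C, RingHom.comp_apply]
      exact Localization.mk_one_eq_algebraMap _
    · simp only [MvPolynomial.coe_eval₂Hom, MvPolynomial.eval₂_X, RingHom.comp_apply]
      rfl
  refine .trans ?_ (DFunLike.congr_fun h2 p.1).symm
  rw [HomogeneousLocalization.val_mk, Localization.mk_eq_mk', IsLocalization.mk'_eq_iff_eq_mul,
    mul_comm, MvPolynomial.coe_eval₂Hom, map_pow, p.2.pow_mul_eval₂]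
  have h3 : (algebraMap (MvPolynomial (Fin (n + 1)) k) A) = MvPolynomial.eval₂Hom (algebraMap k A)
      fun l ↦ algebraMap (MvPolynomial (Fin (n + 1)) k) A (MvPolynomial.X l) := by
    refine MvPolynomial.ringHom_ext (fun a ↦ ?_) fun l ↦ ?_
    · rw [MvPolynomial.coe_eval₂Hom, MvPolynomial.eval₂_C, ← MvPolynomial.algebraMap_eq,
        ← IsScalarTower.algebraMap_apply]
    · rw [MvPolynomial.coe_eval₂Hom, MvPolynomial.eval₂_X]
  have h4 (l : Fin (n + 1)) : algebraMap (MvPolynomial (Fin (n + 1)) k) A (MvPolynomial.X m) *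
      IsLocalization.mk' A (MvPolynomial.X l : MvPolynomial (Fin (n + 1)) k)
        (⟨MvPolynomial.X m, Submonoid.mem_powers _⟩ :
          Submonoid.powers (MvPolynomial.X m : MvPolynomial (Fin (n + 1)) k)) =
      algebraMap (MvPolynomial (Fin (n + 1)) k) A (MvPolynomial.X l) := by
    rw [mul_comm]
    exact IsLocalization.mk'_spec _ _ _
  refine (DFunLike.congr_fun h3 p.1).trans ?_
  rw [MvPolynomial.coe_eval₂Hom]
  exact congrArg (fun v ↦ p.1.eval₂ (algebraMap k A) v) (funext fun l ↦ (h4 l).symm)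

lemma exists_dehom_eq (m : Fin (n + 1)) (s : Γ((projSpace k n).left, chart k n m)) :
    ∃ (d : ℕ) (p : forms k n d), dehom k n m p.1 = s := by
  obtain ⟨t, rfl⟩ := (Proj.basicOpenIsoAway (forms k n) _ (coord k n m).2
    one_pos).commRingCatIsoToRingEquiv.surjective s
  obtain ⟨d, p, hp, rfl⟩ := HomogeneousLocalization.Away.mk_surjective _ (coord k n m).2 t
  have hd : d • 1 = d := by simp
  refine ⟨d • 1, ⟨p, hp⟩, ?_⟩
  rw [← awaySec_mk]
  change _ = awaySec m _
  congr 1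
  refine HomogeneousLocalization.val_injective _ ?_
  simp [HomogeneousLocalization.val_mk]
  rfl

lemma chart_hom_ext {R : Type*} [CommRing R] {m : Fin (n + 1)}
    {φ ψ : Γ((projSpace k n).left, chart k n m) →+* R} (h : ∀ l, φ (aff k n m l) = ψ (aff k n m l))
    (h' : ∀ c, φ (scal _ _ c) = ψ (scal _ _ c)) : φ = ψ := by
  ext s
  obtain ⟨d, p, rfl⟩ := exists_dehom_eq m s
  refine DFunLike.congr_fun (f := φ.comp (dehom k n m)) (g := ψ.comp (dehom k n m)) ?_ p.1
  exact MvPolynomial.ringHom_ext (by simpa [dehom] using h') (by simpa [dehom] using h)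

/-- The values of the affine coordinates on the `m`-th chart can be prescribed. -/
lemma exists_chart_hom {R : Type*} [CommRing R] (m : Fin (n + 1)) (c : k →+* R)
    (g : Fin (n + 1) → R) (hg : g m = 1) :
    ∃ φ : Γ((projSpace k n).left, chart k n m) →+* R, (∀ l, φ (aff k n m l) = g l) ∧
      ∀ a, φ (scal _ _ a) = c a := by
  let e : HomogeneousLocalization.Away (forms k n) (MvPolynomial.X m) ≃+*
      Γ((projSpace k n).left, Dplus (coord k n m)) := (Proj.basicOpenIsoAway (forms k n) _ (coord k n m).2 one_pos).commRingCatIsoToRingEquiv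
  have hu : IsUnit (MvPolynomial.eval₂Hom c g (MvPolynomial.X m)) := by simp [hg]
  let A := Localization.Away (MvPolynomial.X m : MvPolynomial (Fin (n + 1)) k)
  let lft : A →+* R := IsLocalization.Away.lift (MvPolynomial.X m) hu
  have hl (p : MvPolynomial (Fin (n + 1)) k) : lft (algebraMap _ A p) = p.eval₂ c g :=
    IsLocalization.Away.lift_eq _ hu p
  refine ⟨(lft.comp (algebraMap _ A)).comp e.symm.toRingHom, fun l ↦ ?_, fun a ↦ ?_⟩
  · have h : e.symm (aff k n m l) =
        awayFrac m l :=
      e.symm_apply_eq.mpr rfl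
    change lft (algebraMap _ A (e.symm _)) = _
    rw [h]
    have h2 := congrArg lft (IsLocalization.mk'_spec A (MvPolynomial.X l : MvPolynomial (Fin (n + 1)) k)
      (⟨MvPolynomial.X m, Submonoid.mem_powers _⟩ : Submonoid.powers (MvPolynomial.X m)))
    rw [map_mul, hl, hl, MvPolynomial.eval₂_X, MvPolynomial.eval₂_X, hg, mul_one] at h2
    exact (congrArg lft (congrFun₂ Localization.mk_eq_mk' _ _)).trans h2
  · have h : e.symm (scal _ _ a) = HomogeneousLocalization.fromZeroRingHom (forms k n) _
        (algebraMap k (forms k n 0) a) :=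
      e.symm_apply_eq.mpr (scal_eq_awaySec m a)
    change lft (algebraMap _ A (e.symm _)) = _
    rw [h]
    have h2 := hl (MvPolynomial.C a)
    rw [MvPolynomial.eval₂_C] at h2
    exact (congrArg lft (Localization.mk_one_eq_algebraMap _)).trans h2

lemma res_frac_eq_dehom (m : Fin (n + 1)) {d : ℕ} (p q : forms k n d)
    {W : (projSpace k n).left.Opens} (hq : W ≤ Dplus q) (hm : W ≤ chart k n m) :
    res hq (frac p q) * res hm (dehom k n m q.1) = res hm (dehom k n m p.1) := by
  rw [← awaySec_mk, ← awaySec_mk]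
  refine Subtype.ext (funext fun x ↦ HomogeneousLocalization.val_injective _ ?_)
  have := (show ProjectiveSpectrum (forms k n) from x.1).isPrime
  change (HomogeneousLocalization.mk _ * HomogeneousLocalization.mk _ :
    HomogeneousLocalization.AtPrime (forms k n)
      (x.1 : ProjectiveSpectrum (forms k n)).asHomogeneousIdeal.toIdeal).val =
      (HomogeneousLocalization.mk _).val
  rw [HomogeneousLocalization.val_mul, HomogeneousLocalization.val_mk,
    HomogeneousLocalization.val_mk, HomogeneousLocalization.val_mk, Localization.mk_mul]
  refine Localization.mk_eq_mk_iff.mpr (Localization.r_of_eq ?_)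
  change MvPolynomial.X m ^ d * (p.1 * q.1) = (q.1 * MvPolynomial.X m ^ d) * p.1
  ring

end Charts

/-! ### Morphisms to projective space given by coordinate functions -/

section

variable {k : Type u} [Field k] {n : ℕ}

lemma iSup_chart : ⨆ m, chart k n m = ⊤ := by
  refine Proj.iSup_basicOpen_eq_top' (forms k n) (fun m ↦ MvPolynomial.X m)
    (fun m ↦ ⟨1, (coord k n m).2⟩) ?_
  refine top_unique fun p _ ↦ ?_
  induction p using MvPolynomial.induction_on with
  | C a => exact Subalgebra.algebraMap_mem _ (algebraMap k (forms k n 0) a)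
  | add p q hp hq => exact add_mem (hp trivial) (hq trivial)
  | mul_X p m hp => exact mul_mem (hp trivial) (Algebra.subset_adjoin ⟨m, rfl⟩)

lemma exists_mem_chart (x : (projSpace k n).left) : ∃ m, x ∈ chart k n m := by
  have : x ∈ ⨆ m, chart k n m := by rw [iSup_chart]; trivial
  simpa using this

lemma basicOpen_frac {d : ℕ} (p q : forms k n d) :
    (projSpace k n).left.basicOpen (frac p q) = Dplus q ⊓ Dplus p := by
  refine le_antisymm (le_inf (Scheme.basicOpen_le _ _) fun x hx ↦ ?_) fun x ⟨hq, hp⟩ ↦ ?_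
  · have := (show ProjectiveSpectrum (forms k n) from x).isPrime
    have hu := (projSpace k n).left.toRingedSpace.isUnit_res_basicOpen (frac p q)
    obtain ⟨r, hr⟩ := hu.exists_right_inv
    have h1 := congrArg HomogeneousLocalization.val (congrFun (congrArg Subtype.val hr) ⟨x, hx⟩)
    change (HomogeneousLocalization.mk _ * (r.1 ⟨x, hx⟩ : HomogeneousLocalization.AtPrime (forms k n)
      (x : ProjectiveSpectrum (forms k n)).asHomogeneousIdeal.toIdeal)).val =
        (1 : HomogeneousLocalization.AtPrime (forms k n)
      (x : ProjectiveSpectrum (forms k n)).asHomogeneousIdeal.toIdeal).val at h1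
    rw [HomogeneousLocalization.val_mul, HomogeneousLocalization.val_one,
      HomogeneousLocalization.val_mk, Localization.mk_eq_mk'] at h1
    exact (IsLocalization.AtPrime.isUnit_mk'_iff _
      (x : ProjectiveSpectrum (forms k n)).asHomogeneousIdeal.toIdeal _ _).mp
        (IsUnit.of_mul_eq_one _ h1)
  · have h1 : IsUnit (res (inf_le_right : Dplus p ⊓ Dplus q ≤ Dplus q) (frac p q)) :=
      IsUnit.of_mul_eq_one _ ((mul_comm _ _).trans (frac_mul_frac p q))
    have h2 := (projSpace k n).left.basicOpen_res (frac p q)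
      (homOfLE (inf_le_right : Dplus p ⊓ Dplus q ≤ Dplus q)).op
    have h3 := ((projSpace k n).left.basicOpen_of_isUnit h1).symm.trans h2
    have h4 : x ∈ (Dplus p ⊓ Dplus q) ⊓ (projSpace k n).left.basicOpen (frac p q) :=
      h3.le ⟨hp, hq⟩
    exact h4.2

lemma chart_inf_chart (p m : Fin (n + 1)) :
    (projSpace k n).left.basicOpen (aff k n p m) = chart k n p ⊓ chart k n m :=
  basicOpen_frac _ _

/-- Inside chart `p`, chart `m` is the locus where `X_m / X_p` is invertible. Hence the preimages of
all charts can be read off from the pulled-back coordinates. -/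
lemma preimage_chart_inf {X : Scheme.{u}} (i : X ⟶ (projSpace k n).left) {A : X.Opens}
    {p : Fin (n + 1)} (h : A ≤ i ⁻¹ᵁ chart k n p) (m : Fin (n + 1)) :
    X.basicOpen (pull i h (aff k n p m)) = A ⊓ i ⁻¹ᵁ chart k n m := by
  rw [Scheme.basicOpen_appLE, chart_inf_chart, Scheme.Hom.preimage_inf, ← inf_assoc,
    inf_eq_left.mpr h]

lemma res_aff_mul_res_aff (p q l : Fin (n + 1)) {W : (projSpace k n).left.Opens}
    (hp : W ≤ chart k n p) (hq : W ≤ chart k n q) :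
    res hq (aff k n q p) * res hp (aff k n p l) = res hq (aff k n q l) := by
  rw [mul_comm]
  exact res_frac_mul_res_frac _ _ _ _ _

lemma pull_aff_mul_pull_aff {X : Scheme.{u}} (i : X ⟶ (projSpace k n).left) {A : X.Opens}
    {p q : Fin (n + 1)} (hp : A ≤ i ⁻¹ᵁ chart k n p) (hq : A ≤ i ⁻¹ᵁ chart k n q)
    (l : Fin (n + 1)) :
    pull i hq (aff k n q p) * pull i hp (aff k n p l) = pull i hq (aff k n q l) := by
  have h : A ≤ i ⁻¹ᵁ (chart k n p ⊓ chart k n q) := le_inf hp hq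
  have := congrArg (pull i h) (res_aff_mul_res_aff (k := k) p q l inf_le_left inf_le_right)
  rw [map_mul] at this
  simpa only [pull_res] using this

/-- `F` and `G` define maps from `A` to chart `p` and from `B` to chart `q`. Taking `l = p` in `hFG`
gives `F_q G_p = 1` on the overlap. There the second map also lands in chart `p`, and its affine
coordinates `G_l / G_p = F_q G_l = F_l` are those of the first. -/
lemma exists_hom_projSpace {X : Over (Spec (.of k))} {A B : X.left.Opens} (hAB : A ⊔ B = ⊤)
    {p q : Fin (n + 1)} (F : Fin (n + 1) → Γ(X.left, A)) (G : Fin (n + 1) → Γ(X.left, B))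
    (hF : F p = 1) (hG : G q = 1) (hFG : ∀ l, res (inf_le_left : A ⊓ B ≤ A) (F l) =
      res inf_le_left (F q) * res (inf_le_right : A ⊓ B ≤ B) (G l)) :
    ∃ (i : X ⟶ projSpace k n) (hA : A ≤ i.left ⁻¹ᵁ chart k n p) (hB : B ≤ i.left ⁻¹ᵁ chart k n q),
      (∀ l, pull i.left hA (aff k n p l) = F l) ∧ ∀ l, pull i.left hB (aff k n q l) = G l := by
  obtain ⟨φ, hφ, hφ'⟩ := exists_chart_hom p (scal X A) F hF
  obtain ⟨ψ, hψ, hψ'⟩ := exists_chart_hom q (scal X B) G hG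
  have hp := isAffineOpen_chart (k := k) (n := n) p
  have hq := isAffineOpen_chart (k := k) (n := n) q
  have key : X.left.homOfLE (inf_le_left : A ⊓ B ≤ A) ≫ homOfAffine hp φ =
      X.left.homOfLE (inf_le_right : A ⊓ B ≤ B) ≫ homOfAffine hq ψ := by
    rw [homOfLE_comp_homOfAffine, homOfLE_comp_homOfAffine]
    set φ' := (res (inf_le_left : A ⊓ B ≤ A)).comp φ with hφd
    set ψ' := (res (inf_le_right : A ⊓ B ≤ B)).comp ψ with hψd
    have hu : res (inf_le_left : A ⊓ B ≤ A) (F q) * res (inf_le_right : A ⊓ B ≤ B) (G p) = 1 := by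
      rw [← hFG, hF, map_one]
    have h1 : ⊤ ≤ homOfAffine hq ψ' ⁻¹ᵁ chart k n p := by
      have h2 := preimage_chart_inf (homOfAffine hq ψ') (le_preimage_homOfAffine hq ψ') p
      rw [Scheme.basicOpen_of_isUnit] at h2
      · exact (le_inf_iff.mp h2.le).2
      · rw [DFunLike.congr_fun (pull_homOfAffine hq ψ') _]
        have h3 : IsUnit (ψ' (aff k n q p)) := by
          rw [hψd, RingHom.comp_apply, hψ]
          exact IsUnit.of_mul_eq_one_right _ hu
        exact h3.map (pull (A ⊓ B).ι (le_ι_preimage _))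
    refine hom_ext_of_pull _ _ fun x ↦ ⟨_, ⊤, le_preimage_homOfAffine hp φ', h1, trivial, hp, ?_⟩
    have hs (c : k) : ψ' (scal _ _ c) = scal X (A ⊓ B) c := by
      rw [hψd, RingHom.comp_apply, hψ', res_scal]
    refine chart_hom_ext (fun l ↦ ?_) fun c ↦ ?_
    · have h3 := pull_aff_mul_pull_aff (homOfAffine hq ψ') h1 (le_preimage_homOfAffine hq ψ') l
      have h4 := congrArg (pull (A ⊓ B).ι (le_ι_preimage _)) (hFG l)
      have h5 := congrArg (pull (A ⊓ B).ι (le_ι_preimage _)) hu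
      rw [map_mul] at h4 h5
      rw [map_one] at h5
      have h6 (m : Fin (n + 1)) : pull (homOfAffine hq ψ') (le_preimage_homOfAffine hq ψ')
          (aff k n q m) = pull (A ⊓ B).ι (le_ι_preimage _) (res inf_le_right (G m)) := by
        rw [← hψ]
        exact DFunLike.congr_fun (pull_homOfAffine hq ψ') _
      rw [h6, h6] at h3
      refine (DFunLike.congr_fun (pull_homOfAffine hp φ') _).trans ?_
      rw [RingHom.comp_apply, hφd, RingHom.comp_apply, hφ, h4, ← h3, ← mul_assoc, h5, one_mul]
    · refine (DFunLike.congr_fun (pull_homOfAffine hp φ') _).trans ?_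
      rw [RingHom.comp_apply, hφd, RingHom.comp_apply, hφ', res_scal, ← hs]
      refine (DFunLike.congr_fun (pull_homOfAffine hq ψ') _).symm.trans ?_
      have h7 : ⊤ ≤ homOfAffine hq ψ' ⁻¹ᵁ (chart k n q ⊓ chart k n p) :=
        le_inf (le_preimage_homOfAffine hq ψ') h1
      have h8 := pull_res (homOfAffine hq ψ') h7 inf_le_left (scal (projSpace k n) _ c)
      have h9 := pull_res (homOfAffine hq ψ') h7 inf_le_right (scal (projSpace k n) _ c)
      rw [res_scal] at h8 h9
      exact h8.symm.trans h9
  obtain ⟨g, hgA, hgB⟩ := exists_glue₂ hAB _ _ key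
  have hA := le_preimage_of_ι_comp hp φ hgA
  have hB := le_preimage_of_ι_comp hq ψ hgB
  have hgφ := pull_of_ι_comp hp φ hgA hA
  have hgψ := pull_of_ι_comp hq ψ hgB hB
  refine ⟨Over.homMk g (comp_toSpec_eq_of_pull_scal g fun x ↦ ?_), hA, hB, fun l ↦ ?_, fun l ↦ ?_⟩
  · have hx : x ∈ A ⊔ B := by rw [hAB]; trivial
    rcases hx with hx | hx
    · exact ⟨_, A, hA, hx, fun c ↦ by rw [hgφ, hφ']⟩
    · exact ⟨_, B, hB, hx, fun c ↦ by rw [hgψ, hψ']⟩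
  · exact (DFunLike.congr_fun hgφ _).trans (hφ l)
  · exact (DFunLike.congr_fun hgψ _).trans (hψ l)

lemma hom_projSpace_ext {X : Over (Spec (.of k))} {i i' : X ⟶ projSpace k n}
    (H : ∀ x : X.left, ∃ (A : X.left.Opens) (m : Fin (n + 1)) (h : A ≤ i.left ⁻¹ᵁ chart k n m)
      (h' : A ≤ i'.left ⁻¹ᵁ chart k n m), x ∈ A ∧
        ∀ l, pull i.left h (aff k n m l) = pull i'.left h' (aff k n m l)) : i = i' := by
  refine Over.OverMorphism.ext (hom_ext_of_pull _ _ fun x ↦ ?_)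
  obtain ⟨A, m, h, h', hx, H⟩ := H x
  exact ⟨_, A, h, h', hx, isAffineOpen_chart m, chart_hom_ext H fun c ↦ by
    rw [pull_scal, pull_scal]⟩

end

/-! ### The charts of the projective line and Laurent polynomials -/

noncomputable section

variable {k : Type u} [Field k]

/-- Polynomials as functions on the `m`-th chart of the projective line, the variable being
`Xₗ / Xₘ`, where `l` is the other index. -/
def polyChart (m l : Fin 2) : Polynomial k →+* Γ((projSpace k 1).left, chart k 1 m) :=
  Polynomial.eval₂RingHom (scal _ _) (aff k 1 m l)

lemma polyChart_C (m l : Fin 2) (c : k) : polyChart m l (.C c) = scal _ _ c := by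
  simp [polyChart]

lemma polyChart_X (m l : Fin 2) : polyChart m l .X = aff k 1 m l := by
  simp [polyChart]

lemma bijective_polyChart {m l : Fin 2} (hml : m ≠ l) :
    Function.Bijective (polyChart (k := k) m l) := by
  obtain ⟨φ, h, h'⟩ := exists_chart_hom (R := Polynomial k) m Polynomial.C
    (Function.update (fun _ ↦ Polynomial.X) m 1) (Function.update_self ..)
  have h1 : φ.comp (polyChart m l) = RingHom.id _ := by
    refine Polynomial.ringHom_ext (fun a ↦ ?_) ?_
    · rw [RingHom.comp_apply, polyChart_C, h', RingHom.id_apply]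
    · rw [RingHom.comp_apply, polyChart_X, h, RingHom.id_apply, Function.update_of_ne hml.symm]
  have h2 : (polyChart m l).comp φ = RingHom.id _ := by
    refine chart_hom_ext (fun i ↦ ?_) fun a ↦ ?_
    · rw [RingHom.comp_apply, h, RingHom.id_apply]
      by_cases hi : i = m
      · subst hi
        rw [Function.update_self, map_one, aff_self]
      · obtain rfl : i = l := by omega
        rw [Function.update_of_ne hi, polyChart_X]
    · rw [RingHom.comp_apply, h', polyChart_C, RingHom.id_apply]
  exact Function.bijective_iff_has_inverse.mpr ⟨φ, DFunLike.congr_fun h1, DFunLike.congr_fun h2⟩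

/-- The first chart of the projective line is an affine line. -/
def polyEquiv₀ : Polynomial k ≃+* Γ((projSpace k 1).left, chart k 1 0) :=
  RingEquiv.ofBijective (polyChart 0 1) (bijective_polyChart zero_ne_one)

/-- The second chart of the projective line is an affine line. -/
def polyEquiv₁ : Polynomial k ≃+* Γ((projSpace k 1).left, chart k 1 1) :=
  RingEquiv.ofBijective (polyChart 1 0) (bijective_polyChart one_ne_zero)

variable (k) in
/-- The intersection of the two standard charts of the projective line. -/
abbrev overlap : (projSpace k 1).left.Opens := chart k 1 0 ⊓ chart k 1 1

lemma exists_laurentEquiv : ∃ e : LaurentPolynomial k ≃+* Γ((projSpace k 1).left, overlap k),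
    ∀ p, e p.toLaurent = res inf_le_left (polyEquiv₀ p) := by
  let : Algebra Γ((projSpace k 1).left, chart k 1 0) Γ((projSpace k 1).left, overlap k) :=
    (res inf_le_left).toAlgebra
  have h : IsLocalization.Away (aff k 1 0 1) Γ((projSpace k 1).left, overlap k) :=
    (isAffineOpen_chart 0).isLocalization_of_eq_basicOpen _ (homOfLE inf_le_left)
      (chart_inf_chart 0 1).symm
  have hX : polyEquiv₀ (Polynomial.X : Polynomial k) = aff k 1 0 1 := polyChart_X 0 1
  have hM : (Submonoid.powers (Polynomial.X : Polynomial k)).map (polyEquiv₀ (k := k)).toMonoidHom =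
      Submonoid.powers (aff k 1 0 1) := by
    rw [Submonoid.map_powers, ← hX]
    rfl
  refine ⟨IsLocalization.ringEquivOfRingEquiv (M := Submonoid.powers (Polynomial.X : Polynomial k))
    _ _ polyEquiv₀ hM, fun p ↦ ?_⟩
  exact IsLocalization.ringEquivOfRingEquiv_eq _ p

/-- The functions on the overlap of the charts are the Laurent polynomials. -/
def laurentEquiv : LaurentPolynomial k ≃+* Γ((projSpace k 1).left, overlap k) :=
  exists_laurentEquiv.choose

lemma laurentEquiv_toLaurent (p : Polynomial k) :
    laurentEquiv p.toLaurent = res inf_le_left (polyEquiv₀ p) :=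
  exists_laurentEquiv.choose_spec p

lemma laurentEquiv_T_one : laurentEquiv (LaurentPolynomial.T 1 : LaurentPolynomial k) =
    (transition k : Γ((projSpace k 1).left, overlap k)) := by
  rw [← Polynomial.toLaurent_X, laurentEquiv_toLaurent]
  exact congrArg _ (polyChart_X 0 1)

lemma laurentEquiv_T (n : ℤ) : laurentEquiv (LaurentPolynomial.T n : LaurentPolynomial k) =
    ((transition k ^ n : Γ((projSpace k 1).left, overlap k)ˣ) :
      Γ((projSpace k 1).left, overlap k)) := by
  let t : (LaurentPolynomial k)ˣ :=
    ⟨.T 1, .T (-1), by rw [← LaurentPolynomial.T_add]; simp, by rw [← LaurentPolynomial.T_add]; simp⟩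
  have h1 : (Units.map (laurentEquiv (k := k)).toRingHom.toMonoidHom t) = transition k :=
    Units.ext laurentEquiv_T_one
  have h2 : ∀ n : ℤ, ((t ^ n : (LaurentPolynomial k)ˣ) : LaurentPolynomial k) = .T n := by
    intro n
    induction n with
    | zero => simp
    | succ n ih => rw [zpow_add_one, Units.val_mul, ih, LaurentPolynomial.T_add]
    | pred n ih => rw [zpow_sub_one, Units.val_mul, ih, sub_eq_add_neg, LaurentPolynomial.T_add]; rfl
  rw [← h1, ← map_zpow, ← h2]
  rfl

/-- The coordinate of the second chart is `X₀ / X₁ = T⁻¹`, so polynomials on that chart enter the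
overlap after inverting the variable. -/
lemma laurentEquiv_invert (p : Polynomial k) :
    laurentEquiv (LaurentPolynomial.invert p.toLaurent) = res inf_le_right (polyEquiv₁ p) := by
  refine DFunLike.congr_fun (f := (laurentEquiv (k := k)).toRingHom.comp
    (LaurentPolynomial.invert.toRingEquiv.toRingHom.comp Polynomial.toLaurent))
    (g := (res inf_le_right).comp polyEquiv₁.toRingHom) ?_ p
  refine Polynomial.ringHom_ext (fun c ↦ ?_) ?_
  · change laurentEquiv (LaurentPolynomial.invert (Polynomial.toLaurent (.C c))) =
      res inf_le_right (polyChart 1 0 (.C c))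
    rw [Polynomial.toLaurent_C, LaurentPolynomial.invert_C, ← Polynomial.toLaurent_C,
      laurentEquiv_toLaurent, polyChart_C]
    change res _ (polyChart 0 1 (.C c)) = _
    rw [polyChart_C, res_scal, res_scal]
  · change laurentEquiv (LaurentPolynomial.invert (Polynomial.toLaurent .X)) =
      res inf_le_right (polyChart 1 0 .X)
    rw [Polynomial.toLaurent_X, LaurentPolynomial.invert_T, polyChart_X, laurentEquiv_T, zpow_neg_one]
    rfl

lemma overlap_nonempty : (overlap k : Set (projSpace k 1).left).Nonempty := by
  by_contra h
  have h1 : overlap k = ⊥ := Opens.ext (Set.not_nonempty_iff_eq_empty.mp h)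
  have h2 : Subsingleton Γ((projSpace k 1).left, overlap k) := by
    rw [h1]
    infer_instance
  exact not_subsingleton _ (laurentEquiv (k := k)).toEquiv.subsingleton

lemma chart_zero_sup_chart_one : chart k 1 0 ⊔ chart k 1 1 = ⊤ := by
  rw [← iSup_chart]
  refine le_antisymm (sup_le (le_iSup (chart k 1) 0) (le_iSup (chart k 1) 1)) (iSup_le fun m ↦ ?_)
  fin_cases m
  · exact le_sup_left
  · exact le_sup_right

end

/-! ### Integrality, properness and linear automorphisms of projective space -/

noncomputable section

variable {k : Type u} [Field k] {n : ℕ}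

/-- The generic point of projective space. -/
def genPt (k : Type u) [Field k] (n : ℕ) : ProjectiveSpectrum (forms k n) where
  asHomogeneousIdeal := ⊥
  isPrime := Ideal.isPrime_bot
  not_irrelevant_le h := by
    have h1 := h (HomogeneousIdeal.mem_irrelevant_of_mem (forms k n) (i := 1) one_pos
      (coord k n 0).2)
    exact MvPolynomial.X_ne_zero _ h1

instance : IrreducibleSpace (ProjectiveSpectrum (forms k n)) where
  toNonempty := ⟨genPt k n⟩
  isPreirreducible_univ := by
    -- A nonempty basic open set is given by a nonzero element, so it contains the zero ideal.
    have key : ∀ U : Set (ProjectiveSpectrum (forms k n)), IsOpen U → U.Nonempty →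
        genPt k n ∈ U := by
      rintro U hU ⟨x, hx⟩
      obtain ⟨_, ⟨f, rfl⟩, hf, hfU⟩ := (ProjectiveSpectrum.isTopologicalBasis_basic_opens
        (forms k n)).exists_subset_of_mem_open hx hU
      refine hfU fun h0 ↦ hf ?_
      rw [show f = 0 from h0]
      exact zero_mem _
    rintro U V hU hV ⟨x, -, hx⟩ ⟨y, -, hy⟩
    exact ⟨genPt k n, trivial, key U hU ⟨x, hx⟩, key V hV ⟨y, hy⟩⟩

instance : IsReduced (projSpace k n).left := by
  have : ∀ x : (projSpace k n).left, _root_.IsReduced ((projSpace k n).left.presheaf.stalk x) := by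
    intro x
    have hx := (show ProjectiveSpectrum (forms k n) from x).isPrime
    have h1 : Function.Injective (algebraMap (HomogeneousLocalization.AtPrime (forms k n)
      (x : ProjectiveSpectrum (forms k n)).asHomogeneousIdeal.toIdeal)
        (Localization.AtPrime (x : ProjectiveSpectrum (forms k n)).asHomogeneousIdeal.toIdeal)) :=
      HomogeneousLocalization.val_injective _
    have h2 : _root_.IsReduced (HomogeneousLocalization.AtPrime (forms k n)
        (x : ProjectiveSpectrum (forms k n)).asHomogeneousIdeal.toIdeal) :=
      isReduced_of_injective _ h1
    exact isReduced_of_injective (Proj.stalkIso (forms k n) x).hom.hom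
      (Proj.stalkIso (forms k n) x).commRingCatIsoToRingEquiv.injective
  exact isReduced_of_isReduced_stalk _

instance : IsIntegral (projSpace k n).left := by
  have : IrreducibleSpace (projSpace k n).left :=
    inferInstanceAs (IrreducibleSpace (ProjectiveSpectrum (forms k n)))
  exact isIntegral_of_irreducibleSpace_of_isReduced _

lemma bijective_algebraMap_forms_zero : Function.Bijective (algebraMap k (forms k n 0)) := by
  refine ⟨fun a b h ↦ MvPolynomial.C_injective (Fin (n + 1)) k congr(($h).1), fun p ↦ ?_⟩
  obtain ⟨c, hc⟩ : ∃ c, p.1 = MvPolynomial.C c := ⟨_, MvPolynomial.totalDegree_eq_zero_iff_eq_C.mp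
    (Nat.le_zero.mp (MvPolynomial.IsHomogeneous.totalDegree_le p.2))⟩
  exact ⟨c, Subtype.ext hc.symm⟩

instance : IsProper (toSpec (projSpace k n)) := by
  have h1 : IsIso (CommRingCat.ofHom (algebraMap k (forms k n 0))) :=
    (RingEquiv.ofBijective _ (bijective_algebraMap_forms_zero (k := k) (n := n))).toCommRingCatIso.isIso_hom
  have h2 : Algebra.FiniteType (forms k n 0) (MvPolynomial (Fin (n + 1)) k) :=
    have : IsScalarTower k (forms k n 0) (MvPolynomial (Fin (n + 1)) k) :=
      .of_algebraMap_eq (R := k) (S := forms k n 0) fun _ ↦ rfl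
    .of_restrictScalars_finiteType k _ _
  change IsProper (Proj.toSpecZero (forms k n) ≫
    Spec.map (CommRingCat.ofHom (algebraMap k (forms k n 0))))
  infer_instance

/-- A morphism over `k` between proper `k`-schemes is proper. The rope has the same image as its
reduced curve, so this also gives closedness for extensions. -/
lemma isClosed_range {m : ℕ} (i : projSpace k m ⟶ projSpace k n) :
    IsClosed (Set.range i.left) := by
  have h1 : IsProper (i.left ≫ toSpec (projSpace k n)) := by
    rw [show i.left ≫ toSpec (projSpace k n) = toSpec (projSpace k m) from Over.w i]
    infer_instance
  have h2 : IsProper i.left := IsProper.of_comp i.left (toSpec (projSpace k n))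
  exact i.left.isClosedMap.isClosed_range

/-- The substitution of linear forms for the coordinates. -/
def substHom (L : Fin (n + 1) → forms k n 1) : forms k n →+*ᵍ forms k n where
  toRingHom := (MvPolynomial.aeval fun l ↦ (L l).1).toRingHom
  map_mem {d p} hp := by
    have := MvPolynomial.IsHomogeneous.aeval (n := 1) hp (fun l ↦ (L l).1) fun l ↦ (L l).2
    rw [one_mul] at this
    exact this

lemma aeval_aeval {L L' : Fin (n + 1) → forms k n 1}
    (h : ∀ l, MvPolynomial.aeval (fun l ↦ (L l).1) (L' l).1 =
      (MvPolynomial.X l : MvPolynomial (Fin (n + 1)) k)) (p : MvPolynomial (Fin (n + 1)) k) :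
    MvPolynomial.aeval (fun l ↦ (L l).1) (MvPolynomial.aeval (fun l ↦ (L' l).1) p) = p := by
  refine DFunLike.congr_fun (f := (MvPolynomial.aeval fun l ↦ (L l).1).comp
    (MvPolynomial.aeval (R := k) fun l ↦ (L' l).1)) (g := AlgHom.id _ _) ?_ p
  refine MvPolynomial.algHom_ext fun l ↦ ?_
  rw [AlgHom.comp_apply, MvPolynomial.aeval_X, h, AlgHom.id_apply]

/-- The condition under which the substitution is defined on all of `Proj`. A form `p` of positive
degree is the image of its substitute along `L'`, which has the same degree. -/
lemma irrelevant_le_map_substHom {L L' : Fin (n + 1) → forms k n 1}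
    (h : ∀ l, MvPolynomial.aeval (fun l ↦ (L l).1) (L' l).1 =
      (MvPolynomial.X l : MvPolynomial (Fin (n + 1)) k)) :
    HomogeneousIdeal.irrelevant (forms k n) ≤
      (HomogeneousIdeal.irrelevant (forms k n)).map (substHom L) := by
  rw [HomogeneousIdeal.irrelevant_le]
  intro d hd p hp
  have h1 : substHom L (substHom L' p) = p := aeval_aeval h p
  have h2 : substHom L' p ∈ HomogeneousIdeal.irrelevant (forms k n) :=
    HomogeneousIdeal.mem_irrelevant_of_mem _ hd ((substHom L').map_mem hp)
  rw [← h1]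
  exact Ideal.mem_map_of_mem (substHom L) h2

/-- A linear change of coordinates of projective space. -/
lemma exists_linear_iso {L L' : Fin (n + 1) → forms k n 1}
    (h : ∀ l, MvPolynomial.aeval (fun l ↦ (L l).1) (L' l).1 =
      (MvPolynomial.X l : MvPolynomial (Fin (n + 1)) k))
    (h' : ∀ l, MvPolynomial.aeval (fun l ↦ (L' l).1) (L l).1 =
      (MvPolynomial.X l : MvPolynomial (Fin (n + 1)) k)) :
    ∃ θ : projSpace k n ≅ projSpace k n, ∀ m, ∃ hm : Dplus (L m) ≤ θ.hom.left ⁻¹ᵁ chart k n m,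
      ∀ l, pull θ.hom.left hm (aff k n m l) = frac (L l) (L m) := by
  let f : (projSpace k n).left ⟶ (projSpace k n).left := Proj.map (substHom L) (irrelevant_le_map_substHom h)
  let g : (projSpace k n).left ⟶ (projSpace k n).left := Proj.map (substHom L') (irrelevant_le_map_substHom h')
  have hid {f : forms k n →+*ᵍ forms k n} (hf) (h : f = .id _) : Proj.map f hf = 𝟙 _ := by
    subst h
    exact Proj.map_id
  have hfg : f ≫ g = 𝟙 _ := by
    refine (Proj.map_comp _ _ _ _).symm.trans ?_
    exact hid _ (GradedRingHom.ext fun p ↦ aeval_aeval h p)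
  have hgf : g ≫ f = 𝟙 _ := by
    refine (Proj.map_comp _ _ _ _).symm.trans ?_
    exact hid _ (GradedRingHom.ext fun p ↦ aeval_aeval h' p)
  have hle (m) : Dplus (L m) ≤ f ⁻¹ᵁ chart k n m := by
    have : f ⁻¹ᵁ chart k n m = Dplus (L m) := by
      refine (Proj.map_preimage_basicOpen (substHom L) _ _).trans ?_
      change Proj.basicOpen _ (MvPolynomial.aeval (fun l ↦ (L l).1) (MvPolynomial.X m)) = _
      rw [MvPolynomial.aeval_X]
      rfl
    exact this.ge
  have hfw : f ≫ toSpec (projSpace k n) = toSpec (projSpace k n) := by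
    refine comp_toSpec_eq_of_pull_scal f fun x ↦ ?_
    obtain ⟨m, hm⟩ : ∃ m, f x ∈ chart k n m := exists_mem_chart _
    obtain ⟨m', hm'⟩ := exists_mem_chart x
    refine ⟨chart k n m, f ⁻¹ᵁ chart k n m ⊓ chart k n m', inf_le_left, ⟨hm, hm'⟩, fun c ↦ ?_⟩
    rw [← res_scal (X := projSpace k n) inf_le_right c, scal_eq_awaySec, scal_eq_awaySec]
    refine Subtype.ext (funext fun x ↦ HomogeneousLocalization.val_injective _ ?_)
    have := (show ProjectiveSpectrum (forms k n) from x.1).isPrime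
    change (HomogeneousLocalization.mk _ : HomogeneousLocalization.AtPrime (forms k n)
      (x.1 : ProjectiveSpectrum (forms k n)).asHomogeneousIdeal.toIdeal).val =
        (HomogeneousLocalization.mk _).val
    rw [HomogeneousLocalization.val_mk, HomogeneousLocalization.val_mk]
    refine Localization.mk_eq_mk_iff.mpr (Localization.r_of_eq ?_)
    change 1 * MvPolynomial.aeval (fun l ↦ (L l).1) (MvPolynomial.C c) =
      MvPolynomial.aeval (fun l ↦ (L l).1) 1 * MvPolynomial.C c
    rw [map_one, MvPolynomial.aeval_C]
    rfl
  let e : (projSpace k n).left ≅ (projSpace k n).left := ⟨f, g, hfg, hgf⟩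
  refine ⟨Over.isoMk e hfw, fun m ↦ ⟨hle m, fun l ↦ ?_⟩⟩
  change pull f _ _ = _
  refine Subtype.ext (funext fun x ↦ HomogeneousLocalization.val_injective _ ?_)
  have := (show ProjectiveSpectrum (forms k n) from x.1).isPrime
  change (HomogeneousLocalization.mk _ : HomogeneousLocalization.AtPrime (forms k n)
    (x.1 : ProjectiveSpectrum (forms k n)).asHomogeneousIdeal.toIdeal).val =
      (HomogeneousLocalization.mk _).val
  rw [HomogeneousLocalization.val_mk, HomogeneousLocalization.val_mk]
  refine Localization.mk_eq_mk_iff.mpr (Localization.r_of_eq ?_)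
  change (L m).1 * MvPolynomial.aeval (fun l ↦ (L l).1) (MvPolynomial.X l) =
    MvPolynomial.aeval (fun l ↦ (L l).1) (MvPolynomial.X m) * (L l).1
  rw [MvPolynomial.aeval_X, MvPolynomial.aeval_X]

lemma dehom_coord (m l : Fin (n + 1)) : dehom k n m (coord k n l).1 = aff k n m l := by
  change MvPolynomial.eval₂ _ _ (MvPolynomial.X l) = _
  rw [MvPolynomial.eval₂_X]

lemma isUnit_res_dehom {d : ℕ} (p : forms k n d) {m : Fin (n + 1)}
    {W : (projSpace k n).left.Opens} (hp : W ≤ Dplus p) (hm : W ≤ chart k n m) :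
    IsUnit (res hm (dehom k n m p.1)) := by
  have h : (MvPolynomial.X m ^ d : MvPolynomial (Fin (n + 1)) k) ∈ forms k n d :=
    (MvPolynomial.mem_homogeneousSubmodule _ _).mpr (MvPolynomial.isHomogeneous_X_pow m d)
  have h1 := res_frac_eq_dehom m ⟨_, h⟩ p hp hm
  have h2 : dehom k n m (MvPolynomial.X m ^ d) = 1 := by
    rw [map_pow]
    have := dehom_coord (k := k) m m
    rw [aff_self] at this
    rw [show dehom k n m (MvPolynomial.X m) = 1 from this, one_pow]
  rw [h2, map_one] at h1
  exact IsUnit.of_mul_eq_one_right _ h1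

/-- Two rational normal curves differ by a linear change of coordinates. -/
lemma IsRationalNormalCurve.exists_iso {N : ℕ} {i i₀ : projSpace k 1 ⟶ projSpace k N}
    (h₀ : IsRationalNormalCurve i₀) (h : IsRationalNormalCurve i) :
    ∃ θ : projSpace k N ≅ projSpace k N, i₀ ≫ θ.hom = i := by
  obtain ⟨f₀, hf₀⟩ := h₀
  obtain ⟨f, hf⟩ := h
  let Λ := f₀.constr k (coord k N)
  let Λ' := f.constr k (coord k N)
  have hΛ m : Λ (f₀ m) = coord k N m := f₀.constr_basis ..
  have hΛ' m : Λ' (f m) = coord k N m := f.constr_basis ..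
  have key {f f' : Module.Basis (Fin (N + 1)) k (forms k 1 N)} {Λ Λ' : forms k 1 N →ₗ[k] forms k N 1}
      (hΛ : ∀ m, Λ (f m) = coord k N m) (hΛ' : ∀ m, Λ' (f' m) = coord k N m) (m : Fin (N + 1)) :
      MvPolynomial.aeval (fun l ↦ (Λ (f' l)).1) (Λ' (f m)).1 =
        (MvPolynomial.X m : MvPolynomial (Fin (N + 1)) k) := by
    have h1 : (MvPolynomial.aeval (R := k) (fun l ↦ (Λ (f' l)).1)).toLinearMap ∘ₗ
        (forms k N 1).subtype ∘ₗ Λ' = (forms k N 1).subtype ∘ₗ Λ := by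
      refine f'.ext fun l ↦ ?_
      rw [LinearMap.comp_apply, LinearMap.comp_apply, hΛ']
      exact MvPolynomial.aeval_X ..
    refine (LinearMap.congr_fun h1 (f m)).trans ?_
    rw [LinearMap.comp_apply, hΛ]
    rfl
  -- `Λ` expresses a form in the basis `f₀` and replaces each basis element by a coordinate. The
  -- linear form `Λ (f l)` therefore pulls back along `i₀` to `f l`, and these forms are the
  -- coordinates of `θ`.
  obtain ⟨θ, hθ⟩ := exists_linear_iso (L := fun l ↦ Λ (f l)) (L' := fun l ↦ Λ' (f₀ l))
    (key hΛ hΛ') (key hΛ' hΛ)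
  refine ⟨θ, hom_projSpace_ext fun x ↦ ?_⟩
  obtain ⟨m, hm⟩ : ∃ m, i.left x ∈ chart k N m := exists_mem_chart _
  obtain ⟨m₀, hm₀⟩ : ∃ m, i₀.left x ∈ chart k N m := exists_mem_chart _
  obtain ⟨j, hj⟩ := exists_mem_chart x
  obtain ⟨e, he⟩ := hf m
  obtain ⟨e₀, he₀⟩ := hf₀ m₀
  have hm : x ∈ Dplus (f m) := e.le hm
  have hm₀ : x ∈ Dplus (f₀ m₀) := e₀.le hm₀
  let W := Dplus (f m) ⊓ Dplus (f₀ m₀) ⊓ chart k 1 j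
  have hW : W ≤ Dplus (f m) := inf_le_left.trans inf_le_left
  have hW₀ : W ≤ Dplus (f₀ m₀) := inf_le_left.trans inf_le_right
  have hWj : W ≤ chart k 1 j := inf_le_right
  -- Dehomogenized form of the identity `i₀^* (Λ g) = g`. It is linear in `g`, so it suffices to
  -- check it on the basis `f₀`, where it is the definition of a rational normal curve.
  have h1 (g : forms k 1 N) : pull i₀.left (hW₀.trans e₀.ge) (dehom k N m₀ (Λ g).1) *
      res hWj (dehom k 1 j (f₀ m₀).1) = res hWj (dehom k 1 j g.1) := by
    have hg : g ∈ Submodule.span k (Set.range f₀) := by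
      rw [f₀.span_eq]
      trivial
    induction hg using Submodule.span_induction with
    | zero => simp only [map_zero, Submodule.coe_zero, zero_mul]
    | mem _ hl =>
      obtain ⟨l, rfl⟩ := hl
      rw [hΛ, dehom_coord, ← res_pull _ e₀.ge hW₀]
      change res hW₀ (i₀.left.appLE _ _ _ _) * _ = _
      rw [he₀]
      exact res_frac_eq_dehom _ _ _ _ _
    | add g g' _ _ hg hg' =>
      simp only [map_add, Submodule.coe_add, add_mul, hg, hg']
    | smul c g _ hg =>
      rw [map_smul, Submodule.coe_smul, Submodule.coe_smul, MvPolynomial.smul_eq_C_mul,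
        MvPolynomial.smul_eq_C_mul]
      have h2 (n : ℕ) (m : Fin (n + 1)) : dehom k n m (.C c) = scal _ _ c := by
        simp [dehom]
      rw [map_mul, map_mul, map_mul, map_mul, h2, h2, pull_scal, res_scal, mul_assoc, hg]
  have hθm := hθ m
  obtain ⟨e', he'⟩ := hθm
  have hWΛ : W ≤ i₀.left ⁻¹ᵁ Dplus (Λ (f m)) := by
    have h2 := basicOpen_frac (Λ (f m)) (coord k N m₀)
    have h3 : frac (Λ (f m)) (coord k N m₀) = dehom k N m₀ (Λ (f m)).1 := by
      have := res_frac_eq_dehom m₀ (Λ (f m)) (coord k N m₀) le_rfl le_rfl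
      rwa [dehom_coord, aff_self, map_one, mul_one, res_self, res_self] at this
    rw [h3] at h2
    have h4 := i₀.left.preimage_basicOpen (dehom k N m₀ (Λ (f m)).1)
    rw [h2] at h4
    have h5 := Scheme.basicOpen_of_isUnit _ (isUnit_of_mul_isUnit_left
      ((h1 (f m)).symm ▸ isUnit_res_dehom (f m) hW hWj))
    rw [Scheme.basicOpen_appLE] at h5
    rw [h2] at h5
    exact h5.ge.trans (inf_le_right.trans (i₀.left.preimage_mono inf_le_right))
  refine ⟨W, m, hWΛ.trans (i₀.left.preimage_mono e'), hW.trans e.ge, ⟨⟨hm, hm₀⟩, hj⟩, fun l ↦ ?_⟩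
  refine (isUnit_res_dehom (f m) hW hWj).mul_left_injective ?_
  change _ * _ = _ * _
  have h6 : pull i.left (hW.trans e.ge) (aff k N m l) * res hWj (dehom k 1 j (f m).1) =
      res hWj (dehom k 1 j (f l).1) := by
    rw [← res_pull _ e.ge hW]
    change res hW (i.left.appLE _ _ _ _) * _ = _
    rw [he]
    exact res_frac_eq_dehom _ _ _ _ _
  rw [h6]
  have h7 := pull_pull i₀.left θ.hom.left e' hWΛ (aff k N m l)
  rw [he'] at h7
  refine (congrArg (· * _) h7.symm).trans ?_
  rw [← h1 (f m), ← h1 (f l)]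
  have h8 : W ≤ i₀.left ⁻¹ᵁ (Dplus (Λ (f m)) ⊓ chart k N m₀) := le_inf hWΛ (hW₀.trans e₀.ge)
  have h9 := congrArg (pull i₀.left h8) (res_frac_eq_dehom m₀ (Λ (f l)) (Λ (f m)) inf_le_left
    inf_le_right)
  rw [map_mul, pull_res, pull_res, pull_res] at h9
  rw [← mul_assoc, h9]

end

/-! ### The monomial rational normal curve -/

noncomputable section

variable {k : Type u} [Field k]

lemma res_injective {X : Scheme.{u}} [IsIntegral X] {U V : X.Opens} (h : V ≤ U)
    (hV : (V : Set X).Nonempty) : Function.Injective (res h) := by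
  obtain ⟨x, hx⟩ := hV
  have h1 := germ_injective_of_isIntegral X x (h hx)
  have h2 : X.presheaf.germ U x (h hx) = X.presheaf.map (homOfLE h).op ≫
    X.presheaf.germ V x hx := (X.presheaf.germ_res (homOfLE h) x hx).symm
  rw [h2] at h1
  exact Function.Injective.of_comp (f := X.presheaf.germ V x hx) h1

lemma opens_eq_of_inf_eq {X : Scheme.{u}} {A B U V : X.Opens} (hAB : A ⊔ B = ⊤)
    (hA : A ⊓ U = A ⊓ V) (hB : B ⊓ U = B ⊓ V) : U = V := by
  rw [← top_inf_eq U, ← top_inf_eq V, ← hAB, inf_sup_right, inf_sup_right, hA, hB]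

lemma basicOpen_dehom {n d : ℕ} (m : Fin (n + 1)) (p : forms k n d) :
    (projSpace k n).left.basicOpen (dehom k n m p.1) = chart k n m ⊓ Dplus p := by
  refine le_antisymm ?_ fun x hx ↦ ?_
  · have h : (MvPolynomial.X m ^ d : MvPolynomial (Fin (n + 1)) k) ∈ forms k n d :=
      (MvPolynomial.mem_homogeneousSubmodule _ _).mpr (MvPolynomial.isHomogeneous_X_pow m d)
    have hle : chart k n m ≤ Dplus (⟨_, h⟩ : forms k n d) := fun x hx hx' ↦
      hx ((show ProjectiveSpectrum (forms k n) from x).isPrime.mem_of_pow_mem d hx')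
    have h1 := res_frac_eq_dehom m p ⟨_, h⟩ hle le_rfl
    have h2 : dehom k n m (MvPolynomial.X m ^ d) = 1 := by
      rw [map_pow]
      have := dehom_coord (k := k) m m
      rw [aff_self] at this
      rw [show dehom k n m (MvPolynomial.X m) = 1 from this, one_pow]
    rw [h2, map_one, mul_one, res_self] at h1
    rw [← h1, Scheme.basicOpen_res, basicOpen_frac]
    exact inf_le_inf_left _ inf_le_right
  · have h1 := (projSpace k n).left.basicOpen_res (dehom k n m p.1)
      (homOfLE (inf_le_left : chart k n m ⊓ Dplus p ≤ chart k n m)).op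
    have h2 := ((projSpace k n).left.basicOpen_of_isUnit
      (isUnit_res_dehom p inf_le_right inf_le_left)).symm.trans h1
    exact (h2.le hx).2

/-- The monomial `X₀ ^ (N - m) X₁ ^ m`. -/
def mono (k : Type u) [Field k] (N : ℕ) (m : Fin (N + 1)) : forms k 1 N :=
  ⟨MvPolynomial.X 0 ^ (N - m : ℕ) * MvPolynomial.X 1 ^ (m : ℕ), by
    have h := ((MvPolynomial.isHomogeneous_X_pow (R := k) (0 : Fin 2) (N - m))).mul
      (MvPolynomial.isHomogeneous_X_pow (R := k) (1 : Fin 2) m)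
    rwa [Nat.sub_add_cancel (Nat.lt_succ_iff.mp m.2)] at h⟩

lemma exists_basis_mono (N : ℕ) :
    ∃ f : Module.Basis (Fin (N + 1)) k (forms k 1 N), ∀ m, f m = mono k N m := by
  let e : Fin (N + 1) → (Fin 2 →₀ ℕ) := fun m ↦ .single 0 (N - m : ℕ) + .single 1 (m : ℕ)
  have he (m) : (mono k N m).1 = MvPolynomial.monomial (e m) 1 := by
    rw [← one_mul (1 : k), ← MvPolynomial.monomial_mul, ← MvPolynomial.X_pow_eq_monomial,
      ← MvPolynomial.X_pow_eq_monomial]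
    rfl
  have hinj : Function.Injective e := fun m m' h ↦ by
    have := DFunLike.congr_fun h 1
    simpa [e, Fin.ext_iff] using this
  have hli : LinearIndependent k (mono k N) := by
    refine LinearIndependent.of_comp (forms k 1 N).subtype ?_
    have h1 := (MvPolynomial.basisMonomials (Fin 2) k).linearIndependent.comp e hinj
    have h2 : ⇑(forms k 1 N).subtype ∘ mono k N = MvPolynomial.basisMonomials (Fin 2) k ∘ e :=
      funext fun m ↦ by simp [he]
    rw [h2]
    exact h1
  refine ⟨Module.Basis.mk hli fun p _ ↦ ?_, fun m ↦ by simp⟩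
  have h1 : p.1 ∈ (Submodule.span k (Set.range (mono k N))).map (forms k 1 N).subtype := by
    rw [p.1.as_sum]
    refine Submodule.sum_mem _ fun d hd ↦ ?_
    have h2 := p.2 (MvPolynomial.mem_support_iff.mp hd)
    rw [Finsupp.weight_apply, Finsupp.sum_fintype _ _ (by simp), Fin.sum_univ_two] at h2
    simp only [Pi.one_apply, smul_eq_mul, mul_one] at h2
    have h3 : d = e ⟨d 1, by omega⟩ := by
      ext i
      fin_cases i
      · simp [e]; omega
      · simp [e]
    rw [← mul_one (MvPolynomial.coeff d p.1), ← smul_eq_mul, ← MvPolynomial.smul_monomial]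
    refine Submodule.smul_mem _ _ ⟨mono k N ⟨d 1, by omega⟩, Submodule.subset_span ⟨_, rfl⟩, ?_⟩
    rw [Submodule.subtype_apply, he, ← h3]
  obtain ⟨q, hq, hqp⟩ := h1
  rwa [Subtype.ext (a1 := q) (a2 := p) hqp] at hq

lemma dehom_zero_mono (N : ℕ) (m : Fin (N + 1)) :
    dehom k 1 0 (mono k N m).1 = aff k 1 0 1 ^ (m : ℕ) := by
  have h0 : dehom k 1 0 (MvPolynomial.X 0) = 1 := (dehom_coord 0 0).trans (aff_self 0)
  have h1 : dehom k 1 0 (MvPolynomial.X 1) = aff k 1 0 1 := dehom_coord 0 1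
  change dehom k 1 0 (_ * _) = _
  rw [map_mul, map_pow, map_pow, h0, h1, one_pow, one_mul]

lemma dehom_one_mono (N : ℕ) (m : Fin (N + 1)) :
    dehom k 1 1 (mono k N m).1 = aff k 1 1 0 ^ (N - m : ℕ) := by
  have h0 : dehom k 1 1 (MvPolynomial.X 1) = 1 := (dehom_coord 1 1).trans (aff_self 1)
  have h1 : dehom k 1 1 (MvPolynomial.X 0) = aff k 1 1 0 := dehom_coord 1 0
  change dehom k 1 1 (_ * _) = _
  rw [map_mul, map_pow, map_pow, h0, h1, one_pow, mul_one]

lemma res_aff_mul_res_aff_one : res (inf_le_left : overlap k ≤ _) (aff k 1 0 1) *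
    res inf_le_right (aff k 1 1 0) = 1 :=
  (transition k).val_inv

/-- The monomial rational normal curve `[X₀ ^ N : X₀ ^ (N - 1) X₁ : ⋯ : X₁ ^ N]`. -/
lemma exists_monomialCurve {N : ℕ} (hN : 1 ≤ N) :
    ∃ i : projSpace k 1 ⟶ projSpace k N, IsRationalNormalCurve i ∧
      ∃ (h₀ : i.left ⁻¹ᵁ chart k N 0 = chart k 1 0)
        (h₁ : i.left ⁻¹ᵁ chart k N (Fin.last N) = chart k 1 1),
      (∀ l, pull i.left h₀.ge (aff k N 0 l) = aff k 1 0 1 ^ (l : ℕ)) ∧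
        ∀ l, pull i.left h₁.ge (aff k N (Fin.last N) l) = aff k 1 1 0 ^ (N - l : ℕ) := by
  obtain ⟨i, hA, hB, h0, h1⟩ := exists_hom_projSpace (X := projSpace k 1) chart_zero_sup_chart_one
    (p := (0 : Fin (N + 1))) (q := Fin.last N) (fun l ↦ aff k 1 0 1 ^ (l : ℕ))
    (fun l ↦ aff k 1 1 0 ^ (N - l : ℕ)) (by simp) (by simp) fun l ↦ by
      have hl : (Fin.last N : ℕ) = l + (N - l) := by
        have := l.2
        simp; omega
      rw [map_pow, map_pow, map_pow, hl, pow_add, mul_assoc, ← mul_pow, res_aff_mul_res_aff_one,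
        one_pow, mul_one]
  have hpre (m) : i.left ⁻¹ᵁ chart k N m = Dplus (mono k N m) := by
    refine opens_eq_of_inf_eq chart_zero_sup_chart_one ?_ ?_
    · rw [← preimage_chart_inf _ hA, h0, ← dehom_zero_mono, basicOpen_dehom]
    · rw [← preimage_chart_inf _ hB, h1, ← dehom_one_mono, basicOpen_dehom]
  have hm0 : Dplus (mono k N 0) = chart k 1 0 := by
    refine le_antisymm (fun x hx hx' ↦ hx ?_) ((hpre 0) ▸ hA)
    change MvPolynomial.X 0 ^ (N - 0) * MvPolynomial.X 1 ^ 0 ∈ _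
    refine Ideal.mul_mem_right _ _ (Ideal.pow_mem_of_mem _ hx' _ (by omega))
  have hm1 : Dplus (mono k N (Fin.last N)) = chart k 1 1 := by
    refine le_antisymm (fun x hx hx' ↦ hx ?_) ((hpre _) ▸ hB)
    change MvPolynomial.X 0 ^ (N - (Fin.last N : ℕ)) * MvPolynomial.X 1 ^ (Fin.last N : ℕ) ∈ _
    refine Ideal.mul_mem_left _ _ (Ideal.pow_mem_of_mem _ hx' _ (by simp; omega))
  refine ⟨i, ?_, (hpre 0).trans hm0, (hpre _).trans hm1, h0, h1⟩
  obtain ⟨f, hf⟩ := exists_basis_mono (k := k) N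
  have H (g : Fin (N + 1) → forms k 1 N) (hg : g = mono k N) (m : Fin (N + 1)) :
      ∃ h : i.left ⁻¹ᵁ Dplus (coord k N m) = Dplus (g m), ∀ l : Fin (N + 1),
        i.left.appLE (Dplus (coord k N m)) (Dplus (g m)) h.ge (frac (coord k N l) (coord k N m)) =
          frac (g l) (g m) := by
    subst hg
    refine ⟨hpre m, fun l ↦ ?_⟩
    have hle : overlap k ≤ Dplus (mono k N m) := by
      intro x hx
      have h2 : x ∈ (projSpace k 1).left.basicOpen (dehom k 1 0 (mono k N m).1) := by
        rw [dehom_zero_mono]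
        rcases Nat.eq_zero_or_pos m with h | h
        · rw [h, pow_zero, Scheme.basicOpen_of_isUnit _ isUnit_one]
          exact hx.1
        · rw [Scheme.basicOpen_pow _ _ h, chart_inf_chart]
          exact hx
      rw [basicOpen_dehom] at h2
      exact h2.2
    refine res_injective hle overlap_nonempty ?_
    refine (res_pull i.left (hpre m).ge hle (aff k N m l)).trans ?_
    have hu : IsUnit (res (inf_le_left : overlap k ≤ _) (dehom k 1 0 (mono k N m).1)) :=
      isUnit_res_dehom _ hle inf_le_left
    refine hu.mul_left_injective ?_
    change _ * _ = _ * _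
    rw [res_frac_eq_dehom, dehom_zero_mono, dehom_zero_mono, ← h0, ← h0, res_pull, res_pull, mul_comm]
    exact pull_aff_mul_pull_aff i.left _ _ l
  exact ⟨f, H f (funext hf)⟩

end

/-! ### Čech cocycles on an affine scheme -/

section Cech

/-- Vanishing of `H¹` on an affine scheme, with all sections viewed inside `K^σ` and `P i` the
sections over the `i`-th basic open set; `hn` clears denominators. If `∑ c_l h_l^N = 1`, then `e'_i
= ∑ c_l h_l^N e_il` works, since `e_il - e_jl = e_ij` for every `l`. -/
lemma exists_eq_sub_of_cocycle {A K σ ι : Type*} [CommRing A] [CommRing K] [Fintype ι]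
    (φ : A →+* K) {h : ι → A} (hspan : Ideal.span (Set.range h) = ⊤) (P : ι → AddSubgroup (σ → K))
    (hP : ∀ i a m, m ∈ P i → φ a • m ∈ P i) (e : ι → ι → σ → K)
    (he : ∀ i j l, e i j + e j l = e i l) (hn : ∀ i j, ∃ n, φ (h j ^ n) • e i j ∈ P i) :
    ∃ e' : ι → σ → K, (∀ i, e' i ∈ P i) ∧ ∀ i j, e i j = e' i - e' j := by
  choose n hn using hn
  let N := Finset.univ.sup fun p : ι × ι ↦ n p.1 p.2
  have hN i j : φ (h j ^ N) • e i j ∈ P i := by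
    have hle : n i j ≤ N := Finset.le_sup (f := fun p : ι × ι ↦ n p.1 p.2) (Finset.mem_univ (i, j))
    rw [← Nat.sub_add_cancel hle, pow_add, map_mul, mul_smul]
    exact hP _ _ _ (hn i j)
  have h1 := Ideal.span_pow_eq_top _ hspan N
  rw [← Set.range_comp, Ideal.eq_top_iff_one, Ideal.mem_span_range_iff_exists_fun] at h1
  obtain ⟨c, hc⟩ := h1
  refine ⟨fun i ↦ ∑ l, φ (c l) • φ (h l ^ N) • e i l,
    fun i ↦ AddSubgroup.sum_mem _ fun l _ ↦ hP _ _ _ (hN i l), fun i j ↦ ?_⟩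
  have h2 : ∀ l, e i l - e j l = e i j := fun l ↦ sub_eq_of_eq_add (he i j l).symm
  simp only [← Finset.sum_sub_distrib, ← smul_sub, h2, smul_smul, ← Finset.sum_smul, ← map_mul,
    ← map_sum]
  rw [show ∑ l, c l * h l ^ N = 1 from hc, map_one, one_smul]

end Cech

/-! ### Square zero thickenings with a free ideal: lifting functions, affineness -/

section Frames

/-- Trivializations, compatible with restriction, of the ideal sheaf of `Y` in `X` over the open
subsets of `V`. -/
structure Frame {Y X : Scheme.{u}} (j : Y ⟶ X) (V : X.Opens) (σ : Type) where
  /-- The section of the ideal sheaf with given coordinates. -/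
  ι (W : X.Opens) (hW : W ≤ V) : (σ → Γ(Y, j ⁻¹ᵁ W)) →+ Γ(X, W)
  injective (W : X.Opens) (hW : W ≤ V) : Function.Injective (ι W hW)
  app_eq_zero_iff (W : X.Opens) (hW : W ≤ V) (s : Γ(X, W)) : j.app W s = 0 ↔ ∃ v, ι W hW v = s
  mul_ι (W : X.Opens) (hW : W ≤ V) (s : Γ(X, W)) (v : σ → Γ(Y, j ⁻¹ᵁ W)) :
    s * ι W hW v = ι W hW fun i ↦ j.app W s * v i
  res_ι {W W' : X.Opens} (hW : W ≤ V) (h : W' ≤ W) (v : σ → Γ(Y, j ⁻¹ᵁ W)) :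
    res h (ι W hW v) = ι W' (h.trans hW) fun i ↦ res (j.preimage_mono h) (v i)

variable {Y X : Scheme.{u}} {j : Y ⟶ X} {V : X.Opens} {σ : Type}

lemma preimage_injective (hs : Function.Surjective j) {U V : X.Opens} (h : j ⁻¹ᵁ U = j ⁻¹ᵁ V) :
    U = V := by
  ext x
  obtain ⟨y, rfl⟩ := hs x
  exact ⟨fun hy ↦ h.le (show y ∈ j ⁻¹ᵁ U from hy), fun hy ↦ h.ge (show y ∈ j ⁻¹ᵁ V from hy)⟩

lemma app_res (j : Y ⟶ X) {U W : X.Opens} (h : W ≤ U) (s : Γ(X, U)) :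
    j.app W (res h s) = res (j.preimage_mono h) (j.app U s) := by
  rw [app_eq_pull, pull_res, app_eq_pull, res_pull]

lemma Frame.app_ι (F : Frame j V σ) {W : X.Opens} (hW : W ≤ V) (v : σ → Γ(Y, j ⁻¹ᵁ W)) :
    j.app W (F.ι W hW v) = 0 :=
  (F.app_eq_zero_iff W hW _).mpr ⟨v, rfl⟩

lemma Frame.ι_mul_ι (F : Frame j V σ) {W : X.Opens} (hW : W ≤ V) (v w : σ → Γ(Y, j ⁻¹ᵁ W)) :
    F.ι W hW v * F.ι W hW w = 0 := by
  rw [F.mul_ι, F.app_ι]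
  simp only [zero_mul]
  exact map_zero (F.ι W hW)

/-- `h` is not yet known to lift to `V`. It does lift over a smaller affine open set, and the basic
open set of such a lift has the same trace on `Y`, provided the basic open set of `h` was chosen
inside the trace of the smaller set. -/
lemma exists_affine_preimage_eq_basicOpen [IsClosedImmersion j] (hs : Function.Surjective j)
    (hV : IsAffineOpen (j ⁻¹ᵁ V)) {x : X} (hx : x ∈ V) :
    ∃ (W : X.Opens) (h : Γ(Y, j ⁻¹ᵁ V)), IsAffineOpen W ∧ W ≤ V ∧ j ⁻¹ᵁ W = Y.basicOpen h ∧
      x ∈ W := by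
  obtain ⟨W, hW, hxW, hWV⟩ := exists_isAffineOpen_mem_and_subset hx
  obtain ⟨y, rfl⟩ := hs x
  obtain ⟨h, hle, hy⟩ := hV.exists_basicOpen_le (V := j ⁻¹ᵁ W) ⟨y, hxW⟩ hx
  have hWV' : j ⁻¹ᵁ W ≤ j ⁻¹ᵁ V := j.preimage_mono hWV
  obtain ⟨t, ht⟩ := j.app_surjective W hW (res hWV' h)
  have h1 : j ⁻¹ᵁ X.basicOpen t = Y.basicOpen h := by
    rw [Scheme.preimage_basicOpen, ht, Scheme.basicOpen_res]
    exact inf_eq_right.mpr hle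
  exact ⟨_, h, hW.basicOpen t, (X.basicOpen_le t).trans hWV, h1, h1.ge hy⟩

/-- A finite cover of `V` by affine open sets whose traces on `Y` are basic open sets. -/
lemma exists_finite_cover [IsIntegral Y] [IsClosedImmersion j] (hs : Function.Surjective j)
    (hV : IsAffineOpen (j ⁻¹ᵁ V)) :
    ∃ (t : Finset Γ(Y, j ⁻¹ᵁ V)) (W : t → X.Opens), Ideal.span (t : Set Γ(Y, j ⁻¹ᵁ V)) = ⊤ ∧
      ∀ h : t, IsAffineOpen (W h) ∧ W h ≤ V ∧ j ⁻¹ᵁ W h = Y.basicOpen h.1 ∧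
        genericPoint Y ∈ j ⁻¹ᵁ W h := by
  let S : Set Γ(Y, j ⁻¹ᵁ V) := {h | ∃ W : X.Opens, IsAffineOpen W ∧ W ≤ V ∧
    j ⁻¹ᵁ W = Y.basicOpen h ∧ genericPoint Y ∈ j ⁻¹ᵁ W}
  have hS : Ideal.span S = ⊤ := by
    rw [← hV.iSup_basicOpen_eq_self_iff]
    refine le_antisymm (iSup_le fun f ↦ Y.basicOpen_le _) fun y hy ↦ ?_
    obtain ⟨W, h, h1, h2, h3, h4⟩ := exists_affine_preimage_eq_basicOpen hs hV (x := j y) hy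
    have h5 : genericPoint Y ∈ j ⁻¹ᵁ W :=
      ((genericPoint_spec Y).mem_open_set_iff (j ⁻¹ᵁ W).isOpen).mpr ⟨y, trivial, h4⟩
    exact Opens.mem_iSup.mpr ⟨⟨h, W, h1, h2, h3, h5⟩, h3.le h4⟩
  obtain ⟨t, htS, ht⟩ := (Ideal.span_eq_top_iff_finite _).mp hS
  choose W hW using fun h : t ↦ htS h.2
  exact ⟨t, W, ht, hW⟩

lemma germ_res' {X : Scheme.{u}} {U V : X.Opens} (h : V ≤ U) {x : X} (hx : x ∈ V) (s : Γ(X, U)) :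
    X.presheaf.germ V x hx (res h s) = X.presheaf.germ U x (h hx) s :=
  X.presheaf.germ_res_apply (homOfLE h) x hx s

lemma exists_pow_mul_eq_res {U : Y.Opens} (hU : IsAffineOpen U) (h : Γ(Y, U)) {W : Y.Opens}
    (hW : W = Y.basicOpen h) (hWU : W ≤ U) (s : Γ(Y, W)) :
    ∃ (n : ℕ) (a : Γ(Y, U)), res hWU h ^ n * s = res hWU a := by
  have h1 := hU.isLocalization_of_eq_basicOpen h (homOfLE hWU) hW
  algebraize [res hWU]
  have h2 : IsLocalization.Away h Γ(Y, W) := h1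
  obtain ⟨n, a, ha⟩ := IsLocalization.Away.surj h s
  exact ⟨n, a, (mul_comm _ _).trans ha⟩

/-- Functions on `Y` extend to the square zero thickening over an affine open set, as the
obstruction is a Čech cocycle. -/
lemma Frame.app_surjective [IsIntegral Y] [IsClosedImmersion j] [Finite σ] (F : Frame j V σ)
    (hs : Function.Surjective j) (hV : IsAffineOpen (j ⁻¹ᵁ V)) (hη : genericPoint Y ∈ j ⁻¹ᵁ V) :
    Function.Surjective (j.app V) := by
  intro f
  have := Fintype.ofFinite σ
  obtain ⟨t, W, ht, hW⟩ := exists_finite_cover hs hV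
  have hWV h := (hW h).2.1
  have hWη h := (hW h).2.2.2
  let K := Y.presheaf.stalk (genericPoint Y)
  let γ (U : Y.Opens) (hU : genericPoint Y ∈ U) : Γ(Y, U) →+* K :=
    (Y.presheaf.germ U (genericPoint Y) hU).hom
  have hγ (U : Y.Opens) (hU) : Function.Injective (γ U hU) := germ_injective_of_isIntegral _ _ _
  have hγr {U U' : Y.Opens} (h : U' ≤ U) (hU') (s : Γ(Y, U)) :
    γ U' hU' (res h s) = γ U (h hU') s := germ_res' h hU' s
  have hlift h : ∃ g : Γ(X, W h), j.app (W h) g = res (j.preimage_mono (hWV h)) f :=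
    j.app_surjective _ (hW h).1 _
  choose g hg using hlift
  have hWW (h h' : t) : W h ⊓ W h' ≤ V := inf_le_left.trans (hWV h)
  have hcoc (h h' : t) : ∃ v, F.ι (W h ⊓ W h') (hWW h h') v =
      res inf_le_left (g h) - res inf_le_right (g h') := by
    rw [← F.app_eq_zero_iff, map_sub, app_res, app_res, hg, hg, res_res, res_res, sub_self]
  choose v hv using hcoc
  have hηη (h h' : t) : genericPoint Y ∈ j ⁻¹ᵁ (W h ⊓ W h') := ⟨hWη h, hWη h'⟩
  let e (h h' : t) : σ → K := fun i ↦ γ _ (hηη h h') (v h h' i)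
  -- The local lifts `g h` differ on overlaps by sections of the ideal, whose coordinates form a
  -- cocycle once read at the generic point of `Y`. Splitting it gives corrections over the single
  -- sets `W h`, after which the lifts agree.
  obtain ⟨e', he', hee'⟩ := exists_eq_sub_of_cocycle (γ _ hη) (h := fun h : t ↦ h.1)
    (by rwa [Subtype.range_coe_subtype])
    (fun h ↦ { carrier := {m | ∃ w : σ → Γ(Y, j ⁻¹ᵁ W h), m = fun i ↦ γ _ (hWη h) (w i)}
               zero_mem' := ⟨0, by ext; simp⟩
               add_mem' := by
                 rintro _ _ ⟨w, rfl⟩ ⟨w', rfl⟩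
                 exact ⟨w + w', by ext; simp⟩
               neg_mem' := by
                 rintro _ ⟨w, rfl⟩
                 exact ⟨-w, by ext; simp⟩ })
    (by
      rintro h a _ ⟨w, rfl⟩
      refine ⟨fun i ↦ res (j.preimage_mono (hWV h)) a * w i, ?_⟩
      ext i
      change γ _ hη a * γ _ (hWη h) (w i) = γ _ (hWη h) (_ * _)
      rw [map_mul, hγr])
    e
    (by
      intro h h' h''
      let W₃ := W h ⊓ W h' ⊓ W h''
      have a1 : W₃ ≤ W h ⊓ W h' := inf_le_left
      have a2 : W₃ ≤ W h' ⊓ W h'' := inf_le_inf_right _ inf_le_right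
      have a3 : W₃ ≤ W h ⊓ W h'' := inf_le_inf_right _ inf_le_left
      have h1 : (fun i ↦ res (j.preimage_mono a1) (v h h' i)) +
          (fun i ↦ res (j.preimage_mono a2) (v h' h'' i)) =
          fun i ↦ res (j.preimage_mono a3) (v h h'' i) := by
        refine F.injective W₃ (a1.trans (hWW h h')) ?_
        rw [map_add, ← F.res_ι (hWW h h') a1, ← F.res_ι (hWW h' h'') a2, ← F.res_ι (hWW h h'') a3,
          hv, hv, hv]
        simp only [map_sub, res_res]
        abel
      have h3 : genericPoint Y ∈ j ⁻¹ᵁ W₃ := ⟨hηη h h', hWη h''⟩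
      ext i
      have h2 := congrArg (γ _ h3) (congrFun h1 i)
      simp only [Pi.add_apply, map_add, hγr] at h2
      exact h2)
    (by
      intro h h'
      have hle : j ⁻¹ᵁ (W h ⊓ W h') ≤ j ⁻¹ᵁ W h := j.preimage_mono inf_le_left
      have haff : IsAffineOpen (j ⁻¹ᵁ W h) := by
        rw [(hW h).2.2.1]
        exact hV.basicOpen _
      have heq : j ⁻¹ᵁ (W h ⊓ W h') = Y.basicOpen (res (j.preimage_mono (hWV h)) h'.1) := by
        rw [Scheme.basicOpen_res, ← (hW h').2.2.1, Scheme.Hom.preimage_inf]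
      choose n a ha using fun i ↦ exists_pow_mul_eq_res haff _ heq hle (v h h' i)
      -- The trace of `W h ⊓ W h'` is the basic open set of `h'` in the affine trace of `W h`. A
      -- power of `h'` thus extends each component, and `N` serves all of the finitely many
      -- components at once.
      let N := Finset.univ.sup n
      refine ⟨N, fun i ↦ res (j.preimage_mono (hWV h)) h'.1 ^ (N - n i) * a i, ?_⟩
      ext i
      have h1 := congrArg (γ _ (hηη h h')) (ha i)
      rw [map_mul, map_pow, hγr, hγr, hγr] at h1
      change _ * γ _ (hηη h h') (v h h' i) = _
      rw [map_mul (γ _ (hWη h)), map_pow (γ _ (hWη h)), hγr, ← h1, ← mul_assoc, ← pow_add,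
        Nat.sub_add_cancel (Finset.le_sup (f := n) (Finset.mem_univ i)), map_pow])
  choose w hw using he'
  have hglue (h h' : t) : res (inf_le_left : W h ⊓ W h' ≤ W h) (g h - F.ι (W h) (hWV h) (w h)) =
      res inf_le_right (g h' - F.ι (W h') (hWV h') (w h')) := by
    have h1 : v h h' = (fun i ↦ res (j.preimage_mono inf_le_left) (w h i)) -
        fun i ↦ res (j.preimage_mono inf_le_right) (w h' i) := by
      ext i
      refine hγ _ (hηη h h') ?_
      have h2 := congrFun (hee' h h') i
      rw [hw h, hw h'] at h2
      refine h2.trans ?_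
      simp only [Pi.sub_apply, map_sub, hγr]
    have h3 := hv h h'
    rw [h1, map_sub, ← F.res_ι (hWV h) inf_le_left, ← F.res_ι (hWV h') inf_le_right] at h3
    rw [map_sub, map_sub]
    linear_combination -h3
  have hcov : V ≤ iSup W := by
    intro x hx
    obtain ⟨y, rfl⟩ := hs x
    have h1 := (hV.iSup_basicOpen_eq_self_iff.mpr ht).ge (show y ∈ j ⁻¹ᵁ V from hx)
    obtain ⟨h, hh⟩ := Opens.mem_iSup.mp h1
    exact Opens.mem_iSup.mpr ⟨h, (hW h).2.2.1.ge hh⟩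
  obtain ⟨s, hs', -⟩ := res_existsUnique W V hWV hcov _ hglue
  obtain ⟨h, -⟩ := Opens.mem_iSup.mp (hcov hη)
  have h1 : res (j.preimage_mono (hWV h)) (j.app V s) = res (j.preimage_mono (hWV h)) f := by
    rw [← app_res j (hWV h), hs', map_sub, F.app_ι (hWV h), hg, sub_zero]
  exact ⟨s, hγ _ hη ((hγr _ (hWη h) _).symm.trans ((congrArg _ h1).trans (hγr _ (hWη h) _)))⟩

/-- The members of the cover have as traces basic open sets of functions on the trace of `V`. These
functions lift to `V`, and open sets of `X` are determined by their traces, so the members are the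
basic open sets of the lifts. The lifts generate the unit ideal because they do so modulo a square
zero ideal. -/
lemma Frame.isAffineOpen [IsIntegral Y] [IsClosedImmersion j] [Finite σ] (F : Frame j V σ)
    (hs : Function.Surjective j) (hV : IsAffineOpen (j ⁻¹ᵁ V)) (hη : genericPoint Y ∈ j ⁻¹ᵁ V) :
    IsAffineOpen V := by
  obtain ⟨t, W, ht, hW⟩ := exists_finite_cover hs hV
  have hsurj := F.app_surjective hs hV hη
  refine isAffineOpen_of_isAffineOpen_basicOpen V ((j.app V).hom ⁻¹' t) ?_ fun s hst ↦ ?_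
  · have h1 : (Ideal.span ((j.app V).hom ⁻¹' t)).map (j.app V).hom = ⊤ := by
      rw [Ideal.map_span, Set.image_preimage_eq _ hsurj, ht]
    obtain ⟨z, hz, hz1⟩ := (Ideal.mem_map_iff_of_surjective _ hsurj).mp
      (h1 ▸ Submodule.mem_top : (1 : Γ(Y, j ⁻¹ᵁ V)) ∈ _)
    obtain ⟨v, hv⟩ := (F.app_eq_zero_iff V le_rfl (1 - z)).mp (by
      rw [map_sub, map_one]
      exact sub_eq_zero_of_eq hz1.symm)
    have h2 := F.ι_mul_ι le_rfl v v
    rw [hv] at h2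
    rw [Ideal.eq_top_iff_one]
    -- `z` is congruent to `1` modulo the ideal, so `(1 - z)² = 0` and `2 - z` is its inverse.
    have h3 : (1 : Γ(X, V)) = (2 - z) * z := by linear_combination h2
    rw [h3]
    exact Ideal.mul_mem_left _ _ hz
  · have h1 : X.basicOpen s = W ⟨_, hst⟩ := by
      refine preimage_injective hs ?_
      rw [(hW ⟨_, hst⟩).2.2.1, Scheme.preimage_basicOpen]
    rw [h1]
    exact (hW _).1

end Frames

/-! ### Coefficients of Laurent polynomials -/

noncomputable section Laurent

open LaurentPolynomial Polynomial

variable {k : Type*} [Field k]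

lemma coeff_T_mul (m n : ℤ) (f : LaurentPolynomial k) : (T m * f).coeff n = f.coeff (n - m) := by
  induction f using LaurentPolynomial.induction_on' with
  | add p q hp hq =>
    rw [mul_add, AddMonoidAlgebra.coeff_add, AddMonoidAlgebra.coeff_add, Finsupp.add_apply,
      Finsupp.add_apply, hp, hq]
  | C_mul_T e a =>
    rw [mul_left_comm, ← T_add, ← single_eq_C_mul_T, ← single_eq_C_mul_T,
      AddMonoidAlgebra.coeff_single, AddMonoidAlgebra.coeff_single, Finsupp.single_apply,
      Finsupp.single_apply]
    exact if_congr (by omega) rfl rfl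

lemma coeff_toLaurent_natCast (p : k[X]) (n : ℕ) : (toLaurent p).coeff (n : ℤ) = p.coeff n := by
  induction p using Polynomial.induction_on' with
  | add p q hp hq =>
    rw [map_add, AddMonoidAlgebra.coeff_add, Finsupp.add_apply, hp, hq, Polynomial.coeff_add]
  | monomial e a =>
    rw [← C_mul_X_pow_eq_monomial, toLaurent_C_mul_X_pow, ← single_eq_C_mul_T,
      AddMonoidAlgebra.coeff_single, Finsupp.single_apply, coeff_C_mul_X_pow]
    exact if_congr (by omega) rfl rfl

lemma coeff_toLaurent_of_neg (p : k[X]) {n : ℤ} (hn : n < 0) : (toLaurent p).coeff n = 0 := by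
  induction p using Polynomial.induction_on' with
  | add p q hp hq => rw [map_add, AddMonoidAlgebra.coeff_add, Finsupp.add_apply, hp, hq, add_zero]
  | monomial e a =>
    rw [← C_mul_X_pow_eq_monomial, toLaurent_C_mul_X_pow, ← single_eq_C_mul_T,
      AddMonoidAlgebra.coeff_single, Finsupp.single_apply, if_neg (by omega)]

lemma coeff_trunc (f : LaurentPolynomial k) (n : ℕ) : (trunc f).coeff n = f.coeff n := by
  induction f using LaurentPolynomial.induction_on' with
  | add p q hp hq => simp [hp, hq]
  | C_mul_T e a =>
    rw [trunc_C_mul_T, ← single_eq_C_mul_T, AddMonoidAlgebra.coeff_single, Finsupp.single_apply]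
    split_ifs with h1 h2 h2
    · rw [coeff_monomial, if_pos (by omega)]
    · rw [coeff_monomial, if_neg (by omega)]
    · omega
    · simp

lemma toLaurent_trunc {f : LaurentPolynomial k} (h : ∀ n < 0, f.coeff n = 0) :
    toLaurent (trunc f) = f := by
  refine LaurentPolynomial.ext fun n ↦ ?_
  rcases lt_or_ge n 0 with hn | hn
  · rw [h n hn, coeff_toLaurent_of_neg _ hn]
  · obtain ⟨m, rfl⟩ := Int.eq_ofNat_of_zero_le hn
    rw [coeff_toLaurent_natCast, coeff_trunc]

/-- The elements `T^m q(T⁻¹)` are the sections of `𝒪(m)` over the second chart, written in the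
trivialization over the first. -/
lemma exists_T_mul_invert {f : LaurentPolynomial k} (m : ℤ) (h : ∀ n > m, f.coeff n = 0) :
    ∃ q : k[X], T m * invert (toLaurent q) = f := by
  refine ⟨trunc (invert (T (-m) * f)), ?_⟩
  rw [toLaurent_trunc]
  · rw [show invert (invert (T (-m) * f)) = T (-m) * f from involutive_invert _, ← mul_assoc,
      ← T_add, add_neg_cancel, T_zero, one_mul]
  · intro n hn
    rw [invert_apply, coeff_T_mul]
    exact h _ (by omega)

lemma coeff_T_mul_invert_of_gt (q : k[X]) {m n : ℤ} (h : m < n) :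
    (T m * invert (toLaurent q)).coeff n = 0 := by
  rw [coeff_T_mul, invert_apply]
  exact coeff_toLaurent_of_neg _ (by omega)

end Laurent

/-! ### Algebra of one chart of a rope -/

noncomputable section ThickLine

open Polynomial

/-- A square zero extension of the coordinate ring of the affine line by a free module with basis
`σ`. -/
structure ThickLine (k : Type*) [Field k] (σ : Type*) (R : Type*) [CommRing R] where
  /-- The constants. -/
  c : k →+* R
  /-- Restriction to the affine line. -/
  π : R →+* k[X]
  /-- The inclusion of the ideal of the affine line. -/
  ι : (σ → k[X]) →+ R
  π_c (a : k) : π (c a) = C a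
  π_surjective : Function.Surjective π
  ι_injective : Function.Injective ι
  π_eq_zero_iff (r : R) : π r = 0 ↔ ∃ v, ι v = r
  mul_ι (r : R) (v : σ → k[X]) : r * ι v = ι (π r • v)

namespace ThickLine

variable {k : Type*} [Field k] {σ R : Type*} [CommRing R] (A : ThickLine k σ R)

lemma π_ι (v : σ → k[X]) : A.π (A.ι v) = 0 := (A.π_eq_zero_iff _).mpr ⟨v, rfl⟩

lemma ι_mul_ι (v w : σ → k[X]) : A.ι v * A.ι w = 0 := by
  rw [A.mul_ι, A.π_ι, zero_smul, map_zero]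

lemma π_eval₂ {x : R} (hx : A.π x = X) (p : k[X]) : A.π (p.eval₂ A.c x) = p := by
  rw [hom_eval₂, hx, show A.π.comp A.c = C from RingHom.ext A.π_c, eval₂_C_X]

lemma exists_eq_eval₂_add {x : R} (hx : A.π x = X) (r : R) :
    ∃ v, r = (A.π r).eval₂ A.c x + A.ι v := by
  obtain ⟨v, hv⟩ := (A.π_eq_zero_iff (r - (A.π r).eval₂ A.c x)).mp (by
    rw [map_sub, A.π_eval₂ hx, sub_self])
  exact ⟨v, by rw [hv]; ring⟩

variable [Fintype σ]

/-- The value of a linear functional with constant coefficients. -/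
abbrev _root_.RopesOnP1.func (ψ : σ → k) (v : σ → k[X]) : k[X] := ∑ s, C (ψ s) * v s

/-- The subring generated by the constants, a lift `x` of the coordinate, and the part of the ideal
where the functional `ψ` vanishes. -/
def sub (ψ : σ → k) {x : R} (hx : A.π x = X) : Subring R where
  carrier := {r | ∃ (p : k[X]) (v : σ → k[X]), func ψ v = 0 ∧ r = p.eval₂ A.c x + A.ι v}
  one_mem' := ⟨1, 0, by simp [func], by simp⟩
  zero_mem' := ⟨0, 0, by simp [func], by simp⟩
  add_mem' := by
    rintro _ _ ⟨p, v, hv, rfl⟩ ⟨q, w, hw, rfl⟩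
    refine ⟨p + q, v + w, ?_, by rw [eval₂_add, map_add]; ring⟩
    simp only [func, Pi.add_apply, mul_add, Finset.sum_add_distrib] at *
    rw [hv, hw, add_zero]
  neg_mem' := by
    rintro _ ⟨p, v, hv, rfl⟩
    refine ⟨-p, -v, ?_, by rw [eval₂_neg, map_neg]; ring⟩
    simp only [func, Pi.neg_apply, mul_neg, Finset.sum_neg_distrib] at *
    rw [hv, neg_zero]
  mul_mem' := by
    rintro _ _ ⟨p, v, hv, rfl⟩ ⟨q, w, hw, rfl⟩
    refine ⟨p * q, p • w + q • v, ?_, ?_⟩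
    · simp only [func, Pi.add_apply, Pi.smul_apply, smul_eq_mul, mul_add, mul_left_comm (C _),
        Finset.sum_add_distrib, ← Finset.mul_sum] at *
      rw [hv, hw, mul_zero, mul_zero, add_zero]
    · rw [eval₂_mul, map_add, ← A.π_eval₂ hx p, ← A.π_eval₂ hx q, ← A.mul_ι, ← A.mul_ι,
        A.π_eval₂ hx p, A.π_eval₂ hx q]
      linear_combination A.ι_mul_ι v w

/-- The decomposition of an element into a polynomial in `x` and a section of the ideal is unique:
applying `π` recovers the polynomial. -/
lemma ι_mem_sub {ψ : σ → k} {x : R} {hx : A.π x = X} {v : σ → k[X]} :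
    A.ι v ∈ A.sub ψ hx ↔ func ψ v = 0 := by
  refine ⟨?_, fun h ↦ ⟨0, v, h, by simp⟩⟩
  rintro ⟨p, w, hw, h⟩
  have h1 := congrArg A.π h
  rw [map_add, A.π_ι, A.π_ι, A.π_eval₂ hx, add_zero] at h1
  rw [← h1, eval₂_zero, zero_add] at h
  rwa [A.ι_injective h]

lemma self_mem_sub {ψ : σ → k} {x : R} {hx : A.π x = X} : x ∈ A.sub ψ hx :=
  ⟨X, 0, by simp [func], by simp⟩

lemma c_mem_sub {ψ : σ → k} {x : R} {hx : A.π x = X} (a : k) : A.c a ∈ A.sub ψ hx :=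
  ⟨C a, 0, by simp [func], by simp⟩

end ThickLine

/-- The coordinate functions in a chart of an extension of a rational normal curve. -/
def ThickLine.seq {k : Type*} [Field k] {σ R : Type*} [CommRing R] (A : ThickLine k σ R) (x : R)
    (w : ℕ → σ → k[X]) : ℕ → R
  | 0 => 1
  | l + 1 => x * A.seq x w l - A.ι (w l)

namespace ThickLine

variable {k : Type*} [Field k] {σ R : Type*} [CommRing R] (A : ThickLine k σ R)

lemma π_seq {x : R} (hx : A.π x = X) (w : ℕ → σ → k[X]) (l : ℕ) : A.π (A.seq x w l) = X ^ l := by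
  induction l with
  | zero => simp [seq]
  | succ l ih => rw [seq, map_sub, map_mul, ih, hx, A.π_ι, sub_zero, pow_succ']

/-- `x F_l` and `F_{l+1}` both lift `X^(l+1)`, so their difference is a section `w_l` of the ideal.
Any lifts of the powers of the coordinate arise in this way. -/
lemma exists_seq {x : R} (hx : A.π x = X) {N : ℕ} {F : ℕ → R} (hF : ∀ l ≤ N, A.π (F l) = X ^ l)
    (hF0 : F 0 = 1) : ∃ w, ∀ l ≤ N, F l = A.seq x w l := by
  have h (l : ℕ) : ∃ w, l + 1 ≤ N → A.ι w = x * F l - F (l + 1) := by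
    by_cases hl : l + 1 ≤ N
    · obtain ⟨w, hw⟩ := (A.π_eq_zero_iff (x * F l - F (l + 1))).mp (by
        rw [map_sub, map_mul, hF l (by omega), hF _ hl, hx]
        ring)
      exact ⟨w, fun _ ↦ hw⟩
    · exact ⟨0, fun h ↦ absurd h hl⟩
  choose w hw using h
  refine ⟨w, fun l hl ↦ ?_⟩
  induction l with
  | zero => rw [hF0, ThickLine.seq]
  | succ l ih => rw [ThickLine.seq, ← ih (by omega), hw l hl]; ring

lemma seq_mem_sub [Fintype σ] {ψ : σ → k} {x : R} {hx : A.π x = X} {w : ℕ → σ → k[X]} {l : ℕ}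
    (hw : ∀ m < l, func ψ (w m) = 0) : A.seq x w l ∈ A.sub ψ hx := by
  induction l with
  | zero => exact one_mem _
  | succ l ih =>
    exact sub_mem (mul_mem A.self_mem_sub (ih fun m hm ↦ hw m (by omega)))
      (A.ι_mem_sub.mpr (hw l (by omega)))

/-- A subring which contains the coordinate functions contains the part of the ideal generated by
the vectors `X w_l - w_{l+1}`. -/
lemma ι_mem_of_seq_mem {x : R} (hx : A.π x = X) {w : ℕ → σ → k[X]} {N : ℕ} (S : Subring R)
    (hc : ∀ a, A.c a ∈ S) (hS : ∀ l ≤ N, A.seq x w l ∈ S) {l : ℕ} (hl : l + 2 ≤ N) (q : k[X]) :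
    A.ι (q • ((X : k[X]) • w l - w (l + 1))) ∈ S := by
  have h1 : A.seq x w 1 = x - A.ι (w 0) := by simp [seq]
  have hS1 := hS 1 (by omega)
  have hx1 : A.π (A.seq x w 1) = X := by rw [A.π_seq hx, pow_one]
  -- The lift `x` need not lie in `S`, only `F₁ = x - w₀` does. The elements of the ideal at hand
  -- are the differences `F₁ F_m - F_{m+1}`.
  have hm (m : ℕ) (hm : m + 1 ≤ N) : A.ι (w m - (X ^ m : k[X]) • w 0) ∈ S := by
    have h2 : A.ι (w m - (X ^ m : k[X]) • w 0) = A.seq x w 1 * A.seq x w m - A.seq x w (m + 1) := by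
      rw [map_sub, ← A.π_seq hx w m, ← A.mul_ι, h1, seq]
      ring
    rw [h2]
    exact sub_mem (mul_mem hS1 (hS m (by omega))) (hS _ hm)
  have hq (q : k[X]) : q.eval₂ A.c (A.seq x w 1) ∈ S := by
    rw [eval₂_eq_sum, Polynomial.sum]
    exact sum_mem fun i _ ↦ mul_mem (hc _) (pow_mem hS1 i)
  -- The multiples of `w₀` cancel in this combination of two consecutive elements.
  have h3 : q • ((X : k[X]) • w l - w (l + 1)) = (q * X) • (w l - (X ^ l : k[X]) • w 0) -
      q • (w (l + 1) - (X ^ (l + 1) : k[X]) • w 0) := by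
    ext1 s
    simp only [Pi.smul_apply, Pi.sub_apply, smul_eq_mul]
    ring
  rw [h3, map_sub]
  have h4 (p : k[X]) (v : σ → k[X]) : A.ι (p • v) = p.eval₂ A.c (A.seq x w 1) * A.ι v := by
    rw [A.mul_ι, A.π_eval₂ hx1]
  rw [h4, h4]
  exact sub_mem (mul_mem (hq _) (hm l (by omega))) (mul_mem (hq _) (hm (l + 1) (by omega)))

lemma eval₂_mem_of_seq_mem {x : R} {w : ℕ → σ → k[X]} {N : ℕ} (S : Subring R)
    (hc : ∀ a, A.c a ∈ S) (hS : ∀ l ≤ N, A.seq x w l ∈ S) (hN : 1 ≤ N) (h0 : A.ι (w 0) ∈ S)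
    (p : k[X]) : p.eval₂ A.c x ∈ S := by
  have h1 : x = A.seq x w 1 + A.ι (w 0) := by simp [seq]
  rw [eval₂_eq_sum, Polynomial.sum]
  refine sum_mem fun i _ ↦ mul_mem (hc _) (pow_mem ?_ i)
  rw [h1]
  exact add_mem (hS 1 hN) h0

end ThickLine

end ThickLine

/-! ### The obstruction class and the gluing of coordinate functions -/

noncomputable section GluedRings

open LaurentPolynomial Polynomial

/-- Two square zero extensions of the affine line, glued along the punctured line: the ideal is the
direct sum of line bundles of degrees `d s`. -/
structure GluedRings (k : Type*) [Field k] {σ : Type*} (d : σ → ℤ) (R₀ R₁ R : Type*) [CommRing R₀]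
    [CommRing R₁] [CommRing R] where
  /-- The first chart. -/
  A₀ : ThickLine k σ R₀
  /-- The second chart. -/
  A₁ : ThickLine k σ R₁
  /-- Restriction from the first chart to the overlap. -/
  ρ₀ : R₀ →+* R
  /-- Restriction from the second chart to the overlap. -/
  ρ₁ : R₁ →+* R
  /-- Restriction from the overlap to the punctured line. -/
  π : R →+* LaurentPolynomial k
  /-- The inclusion of the ideal of the punctured line. -/
  ι : (σ → LaurentPolynomial k) →+ R
  π_ρ₀ (r : R₀) : π (ρ₀ r) = toLaurent (A₀.π r)
  π_ρ₁ (r : R₁) : π (ρ₁ r) = invert (toLaurent (A₁.π r))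
  ι_injective : Function.Injective ι
  π_eq_zero_iff (r : R) : π r = 0 ↔ ∃ v, ι v = r
  mul_ι (r : R) (v : σ → LaurentPolynomial k) : r * ι v = ι (π r • v)
  ρ₀_ι (v : σ → k[X]) : ρ₀ (A₀.ι v) = ι fun s ↦ toLaurent (v s)
  ρ₁_ι (v : σ → k[X]) : ρ₁ (A₁.ι v) = ι fun s ↦ T (d s) * invert (toLaurent (v s))

namespace GluedRings

variable {k : Type*} [Field k] {σ : Type*} {d : σ → ℤ} {R₀ R₁ R : Type*} [CommRing R₀]
    [CommRing R₁] [CommRing R] (A : GluedRings k d R₀ R₁ R) {x : R₀} (hx : A.A₀.π x = X)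
    {y : R₁} (hy : A.A₁.π y = X)

lemma π_ι (v : σ → LaurentPolynomial k) : A.π (A.ι v) = 0 := (A.π_eq_zero_iff _).mpr ⟨v, rfl⟩

include hx in
lemma π_ρ₀_lift : A.π (A.ρ₀ x) = T 1 := by rw [A.π_ρ₀, hx, toLaurent_X]

include hy in
lemma π_ρ₁_lift : A.π (A.ρ₁ y) = T (-1) := by rw [A.π_ρ₁, hy, toLaurent_X, invert_T]

-- `x` and `y` restrict to `T` and `T⁻¹`, so `x y - 1` lies in the ideal. Modulo the changes in
-- `eps_change`, its coordinates represent the class of the rope.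
include hx hy in
lemma exists_eps : ∃ ε, A.ρ₀ x * A.ρ₁ y = 1 + A.ι ε := by
  obtain ⟨ε, hε⟩ := (A.π_eq_zero_iff (A.ρ₀ x * A.ρ₁ y - 1)).mp (by
    rw [map_sub, map_mul, A.π_ρ₀_lift hx, A.π_ρ₁_lift hy, ← T_add, map_one]
    simp)
  exact ⟨ε, by rw [hε]; ring⟩

/-- Replacing the lifts of the coordinates changes the obstruction. -/
lemma eps_change {ε : σ → LaurentPolynomial k} (hε : A.ρ₀ x * A.ρ₁ y = 1 + A.ι ε)
    (hx : A.A₀.π x = X) (hy : A.A₁.π y = X) (u v : σ → k[X]) :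
    A.ρ₀ (x + A.A₀.ι u) * A.ρ₁ (y + A.A₁.ι v) = 1 + A.ι fun s ↦
      ε s + T (-1) * toLaurent (u s) + T (1 + d s) * invert (toLaurent (v s)) := by
  have h1 : (fun s ↦ ε s + T (-1) * toLaurent (u s) + T (1 + d s) * invert (toLaurent (v s))) =
      ε + (T (-1) : LaurentPolynomial k) • (fun s ↦ toLaurent (u s)) +
        (T 1 : LaurentPolynomial k) • fun s ↦ T (d s) * invert (toLaurent (v s)) := by
    ext1 s
    simp only [Pi.add_apply, Pi.smul_apply, smul_eq_mul, T_add, mul_assoc]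
  rw [h1, map_add A.ι, map_add A.ι, ← A.π_ρ₀_lift hx, ← A.π_ρ₁_lift hy, ← A.mul_ι, ← A.mul_ι,
    map_add, map_add, A.ρ₀_ι, A.ρ₁_ι]
  have h2 := A.mul_ι (A.ι fun s ↦ toLaurent (u s)) fun s ↦ T (d s) * invert (toLaurent (v s))
  rw [A.π_ι, zero_smul, map_zero] at h2
  linear_combination hε + h2

/-- The compatibility on the overlap of sections of the ideal on the two charts which defines an
extension of the rational normal curve of degree `N`. -/
def Rel (_ : GluedRings k d R₀ R₁ R) (N : ℕ) (ε : σ → LaurentPolynomial k)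
    (w₀ w₁ : ℕ → σ → k[X]) : Prop :=
  ∀ l < N, ∀ s, toLaurent (w₀ l s) + T (N + 1 + d s) * invert (toLaurent (w₁ (N - 1 - l) s)) =
    T (l + 1) * ε s

/-- Multiply `x F - w₀ = F_N G` by `y` and use `x y = 1 + ε`. This gives `F_N G' = F + T^l ε - T⁻¹
w₀ - T^(N+d) w₁(T⁻¹)`, and the condition is the vanishing of the last three terms, multiplied by
`T`. It is the step of a descending induction on `l` starting from `F_N = F_N · 1`. -/
lemma rel_step_iff {ε : σ → LaurentPolynomial k} (hε : A.ρ₀ x * A.ρ₁ y = 1 + A.ι ε)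
    (hy : A.A₁.π y = X) {N l : ℕ} {F F' FN : R₀} {G G' : R₁} (hF : A.A₀.π F = X ^ l)
    (hFN : A.A₀.π FN = X ^ N) (w₀ w₁ : σ → k[X]) (hF' : F' = x * F - A.A₀.ι w₀)
    (hG' : G' = y * G - A.A₁.ι w₁) (h : A.ρ₀ F' = A.ρ₀ FN * A.ρ₁ G) :
    A.ρ₀ F = A.ρ₀ FN * A.ρ₁ G' ↔
      ∀ s, toLaurent (w₀ s) + T (N + 1 + d s) * invert (toLaurent (w₁ s)) = T (l + 1) * ε s := by
  have h1 : A.ρ₀ FN * A.ρ₁ G' = A.ρ₀ F + A.ι ((T l : LaurentPolynomial k) • ε -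
      (T (-1) : LaurentPolynomial k) • (fun s ↦ toLaurent (w₀ s)) -
      (T N : LaurentPolynomial k) • fun s ↦ T (d s) * invert (toLaurent (w₁ s))) := by
    have hl : (T l : LaurentPolynomial k) = A.π (A.ρ₀ F) := by
      rw [A.π_ρ₀, hF, toLaurent_X_pow]
    have hN : (T N : LaurentPolynomial k) = A.π (A.ρ₀ FN) := by
      rw [A.π_ρ₀, hFN, toLaurent_X_pow]
    rw [map_sub, map_sub, hl, hN, ← A.π_ρ₁_lift hy, ← A.mul_ι, ← A.mul_ι, ← A.mul_ι, ← A.ρ₀_ι,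
      ← A.ρ₁_ι, hG', map_sub, map_mul]
    rw [hF', map_sub, map_mul] at h
    linear_combination A.ρ₀ F * hε - A.ρ₁ y * h
  rw [h1, left_eq_add, ← map_zero A.ι, A.ι_injective.eq_iff, funext_iff]
  refine forall_congr' fun s ↦ ?_
  simp only [Pi.sub_apply, Pi.smul_apply, smul_eq_mul, Pi.zero_apply]
  have hT : (T 1 : LaurentPolynomial k) * T (-1) = 1 := by rw [← T_add]; simp
  have e1 : (T (N + 1 + d s) : LaurentPolynomial k) = T 1 * (T N * T (d s)) := by
    rw [← T_add, ← T_add]; congr 1; ring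
  have e2 : (T (l + 1) : LaurentPolynomial k) = T 1 * T l := by
    rw [← T_add]; congr 1; ring
  rw [e1, e2]
  constructor
  · intro h
    linear_combination -T 1 * h - toLaurent (w₀ s) * hT
  · intro h
    linear_combination -T (-1) * h + (T l * ε s - T N * (T (d s) * invert (toLaurent (w₁ s)))) *
      (-hT)

lemma Rel.ρ₀_seq {N : ℕ} {ε : σ → LaurentPolynomial k} {w₀ w₁ : ℕ → σ → k[X]}
    (h : A.Rel N ε w₀ w₁) (hε : A.ρ₀ x * A.ρ₁ y = 1 + A.ι ε) (hx : A.A₀.π x = X)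
    (hy : A.A₁.π y = X) {l : ℕ} (hl : l ≤ N) :
    A.ρ₀ (A.A₀.seq x w₀ l) = A.ρ₀ (A.A₀.seq x w₀ N) * A.ρ₁ (A.A₁.seq y w₁ (N - l)) := by
  obtain ⟨m, hm⟩ : ∃ m, m = N - l := ⟨_, rfl⟩
  rw [← hm]
  induction m generalizing l with
  | zero =>
    obtain rfl : l = N := by omega
    simp [ThickLine.seq]
  | succ m ih =>
    have h1 := h l (by omega)
    rw [show N - 1 - l = m by omega] at h1
    exact (A.rel_step_iff hε hy (A.A₀.π_seq hx w₀ l) (A.A₀.π_seq hx w₀ N) (w₀ l) (w₁ m) rfl rfl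
      (ih (l := l + 1) (by omega) (by omega))).mpr h1

/-- The coordinate functions of an extension of the rational normal curve satisfy the recursion. -/
lemma exists_rel {ε : σ → LaurentPolynomial k} (hε : A.ρ₀ x * A.ρ₁ y = 1 + A.ι ε)
    (hx : A.A₀.π x = X) (hy : A.A₁.π y = X) {N : ℕ} {F : ℕ → R₀} {G : ℕ → R₁}
    (hF : ∀ l ≤ N, A.A₀.π (F l) = X ^ l) (hG : ∀ l ≤ N, A.A₁.π (G l) = X ^ l) (hF0 : F 0 = 1)
    (hG0 : G 0 = 1) (hFG : ∀ l ≤ N, A.ρ₀ (F l) = A.ρ₀ (F N) * A.ρ₁ (G (N - l))) :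
    ∃ w₀ w₁, A.Rel N ε w₀ w₁ ∧ (∀ l ≤ N, F l = A.A₀.seq x w₀ l) ∧
      ∀ l ≤ N, G l = A.A₁.seq y w₁ l := by
  obtain ⟨w₀, h₀⟩ := A.A₀.exists_seq hx hF hF0
  obtain ⟨w₁, h₁⟩ := A.A₁.exists_seq hy hG hG0
  refine ⟨w₀, w₁, fun l hl ↦ ?_, h₀, h₁⟩
  have h := (A.rel_step_iff hε hy (A.A₀.π_seq hx w₀ l) (A.A₀.π_seq hx w₀ N) (w₀ l)
    (w₁ (N - 1 - l)) (F' := A.A₀.seq x w₀ (l + 1)) (G := A.A₁.seq y w₁ (N - 1 - l)) rfl rfl ?_).mp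
  · refine h ?_
    have h2 := hFG l (by omega)
    rw [h₀ l (by omega), h₀ N le_rfl, h₁ _ (by omega), show N - l = N - 1 - l + 1 by omega] at h2
    exact h2
  · have h2 := hFG (l + 1) (by omega)
    rwa [h₀ _ (by omega), h₀ N le_rfl, h₁ _ (by omega), show N - (l + 1) = N - 1 - l by omega] at h2

end GluedRings

end GluedRings

/-! ### Cohomology of line bundles on the projective line in coordinates -/

noncomputable section Decomposition

open LaurentPolynomial hiding C
open Polynomial

variable {k : Type*} [Field k]

/-- The computation of `H¹(𝒪(2-a))`: exponents at least `-1` are removed by `u`, those at most `1 -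
a` by `v`, and only the exponents strictly between can obstruct. -/
lemma exists_decomposition {e : LaurentPolynomial k} {a : ℤ}
    (h : ∀ n, 1 - a < n → n < -1 → e.coeff n = 0) :
    ∃ u v : k[X], e + T (-1) * toLaurent u + T (1 - a) * invert (toLaurent v) = 0 := by
  let u : k[X] := -trunc (T 1 * e)
  obtain ⟨v, hv⟩ := exists_T_mul_invert (f := e + T (-1) * toLaurent u) (1 - a) fun n hn ↦ by
    rw [AddMonoidAlgebra.coeff_add, Finsupp.add_apply, coeff_T_mul]
    rcases lt_or_ge n (-1) with h1 | h1
    · rw [h n hn h1, coeff_toLaurent_of_neg _ (by omega), add_zero]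
    · obtain ⟨m, hm⟩ := Int.eq_ofNat_of_zero_le (show 0 ≤ n - -1 by omega)
      rw [hm, coeff_toLaurent_natCast]
      simp only [u, Polynomial.coeff_neg, coeff_trunc, coeff_T_mul]
      rw [show (m : ℤ) - 1 = n by omega, add_neg_cancel]
  refine ⟨u, -v, ?_⟩
  rw [map_neg toLaurent v, map_neg invert, mul_neg, hv, add_neg_cancel]

/-- A line bundle of negative degree has no global sections: the first term has only nonnegative
exponents, the second only negative ones. -/
lemma eq_zero_of_add_eq_zero {p q : k[X]} {n : ℤ} (hn : n ≤ -1)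
    (h : toLaurent p + T n * invert (toLaurent q) = 0) : p = 0 ∧ q = 0 := by
  have hp : p = 0 := by
    ext m
    have h1 := congrArg (fun f : LaurentPolynomial k ↦ f.coeff m) h
    simp only [AddMonoidAlgebra.coeff_add, Finsupp.add_apply, coeff_toLaurent_natCast,
      coeff_T_mul_invert_of_gt q (show n < m by omega), add_zero] at h1
    exact h1
  refine ⟨hp, ?_⟩
  rw [hp, map_zero, zero_add, (isUnit_T n).mul_right_eq_zero, map_eq_zero_iff _ invert.injective] at h
  exact toLaurent_injective (h.trans (map_zero _).symm)

/-- Passing to the other chart of `𝒪(D)` reverses the coefficients. -/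
lemma eq_of_toLaurent_eq {p q : k[X]} {D : ℕ} {κ c : k}
    (h : toLaurent p = T D * invert (toLaurent q)) (hp : p = C κ + C c * X ^ D) :
    q = C c + C κ * X ^ D := by
  have h1 : toLaurent q = T D * invert (toLaurent p) := by
    rw [h, map_mul, invert_T, show invert (invert (toLaurent q)) = toLaurent q from
      involutive_invert _, ← mul_assoc, ← T_add, add_neg_cancel, T_zero, one_mul]
  refine toLaurent_injective ?_
  rw [h1, hp]
  simp only [map_add, map_mul, toLaurent_C, toLaurent_X_pow, invert_C, invert_T, mul_add]
  rw [mul_left_comm, ← T_add, add_neg_cancel, T_zero, mul_one]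
  ring

/-- The two polynomials are independent combinations of `1` and `X^D`, so by Cramer's rule `1` is a
combination of them with constant coefficients. The condition is stable under reversing
coefficients, hence usable on both charts. -/
lemma isCoprime_of_ne {κ c t e : k} (D : ℕ) (h : t * c - e * κ ≠ 0) :
    IsCoprime (C κ + C c * X ^ D) (C t + C e * X ^ D) := by
  refine ⟨C (-e / (t * c - e * κ)), C (c / (t * c - e * κ)), ?_⟩
  have : (-e / (t * c - e * κ)) * κ + (c / (t * c - e * κ)) * t = 1 := by
    field_simp
    ring
  have h2 : (-e / (t * c - e * κ)) * c + (c / (t * c - e * κ)) * e = 0 := by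
    field_simp
    ring
  linear_combination (norm := skip) congrArg C this + X ^ D * congrArg C h2
  simp only [map_add, map_mul, map_one, map_zero]
  ring

/-- Truncation fails to commute with multiplication by the variable only in one place: the
coefficient of `T⁻¹`, which is cut off on the left but becomes the constant term on the right. -/
lemma trunc_T_mul (e : LaurentPolynomial k) (l : ℕ) :
    X * trunc (T (l + 1) * e) - trunc (T ((l + 1 : ℕ) + 1) * e) = C (-e.coeff (-(l + 2))) := by
  ext m
  rw [coeff_sub, coeff_trunc, coeff_T_mul, coeff_C]
  rcases m with _ | m
  · rw [coeff_X_mul_zero, if_pos rfl, zero_sub]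
    congr 2
  · rw [coeff_X_mul, coeff_trunc, coeff_T_mul, if_neg (by omega), sub_eq_zero]
    congr 1
    push_cast
    ring

end Decomposition

/-! ### Choosing sections of the ideal with coprime minors -/

noncomputable section Minors

open Polynomial

variable {k : Type*} [Field k]

/-- The second components of the sections of the ideal can be adjusted so that the minors have no
common zero. -/
lemma exists_coprime_minors (c γ : ℕ → k) {N D : ℕ} (hN : 4 ≤ N)
    (h : 1 ≤ D → ∃ s, s + 2 ≤ N ∧ c s ≠ 0)
    (h' : D = 0 → ∃ l m, l + 2 ≤ N ∧ m + 2 ≤ N ∧ c l * γ m - c m * γ l ≠ 0) :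
    ∃ v : ℕ → k[X], (∀ l m, D ≤ m → (v l).coeff m = 0) ∧
      ∃ (g : ℕ → k[X]) (l m l' m' : ℕ) (κ r t e : k), (∀ i, g i = C (γ i) + X * v i - v (i + 1)) ∧
        l + 2 ≤ N ∧ m + 2 ≤ N ∧ l' + 2 ≤ N ∧ m' + 2 ≤ N ∧
        C (c l) * g m - C (c m) * g l = C κ + C r * X ^ D ∧
        C (c l') * g m' - C (c m') * g l' = C t + C e * X ^ D ∧ t * r - e * κ ≠ 0 := by
  rcases Nat.eq_zero_or_pos D with rfl | hD
  · obtain ⟨l, m, hl, hm, hlm⟩ := h' rfl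
    -- For `D = 0` there is no freedom in `v`, and one nonzero constant minor suffices. It is used
    -- twice, split as `0 + r` and as `1 + (r - 1)`, so that the determinant required is `r`.
    refine ⟨0, fun _ _ _ ↦ rfl, fun i ↦ C (γ i), l, m, l, m, 0, c l * γ m - c m * γ l, 1,
      c l * γ m - c m * γ l - 1, by simp, hl, hm, hl, hm, ?_, ?_, by simpa using hlm⟩ <;>
    · simp
  -- From here the old `D` is `D + 1`, and `X ^ D` is the highest power allowed in `v`.
  obtain ⟨D, rfl⟩ : ∃ D', D = D' + 1 := ⟨D - 1, by omega⟩
  have hmon (a : k) (m : ℕ) (hm : D + 1 ≤ m) : (C a * X ^ D).coeff m = 0 := by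
    rw [coeff_C_mul_X_pow, if_neg (by omega)]
  have hconst (a : k) (m : ℕ) (hm : D + 1 ≤ m) : (C a).coeff m = 0 := by
    rw [coeff_C, if_neg (by omega)]
  -- Among the admissible indices, `v 0` enters only `g 0` and `v (N - 1)` only `g (N - 2)`. With an
  -- interior index `s`, the choice `v 0 = X ^ D` gives the minor of `s` and `0` the leading term `c
  -- s * X ^ (D + 1)`, and a constant `v (N - 1)` makes the minor of `s` and `N - 2` equal to `1`.
  by_cases hs : ∃ s, 1 ≤ s ∧ s + 3 ≤ N ∧ c s ≠ 0
  · obtain ⟨s, h1, h2, h3⟩ := hs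
    obtain ⟨β, hβ⟩ : ∃ β, c s * (γ (N - 2) - β) - c (N - 2) * γ s = 1 :=
      ⟨γ (N - 2) - (1 + c (N - 2) * γ s) / c s, by field_simp; ring⟩
    let v : ℕ → k[X] := fun l ↦ if l = 0 then C 1 * X ^ D else if l = N - 1 then C β else 0
    refine ⟨v, fun l m hm ↦ ?_, _, s, 0, s, N - 2, c s * γ 0 - c 0 * γ s, c s, 1, 0, fun i ↦ rfl,
      by omega, by omega, by omega, by omega, ?_, ?_, by simpa using h3⟩
    · simp only [v]
      split_ifs
      exacts [hmon _ _ hm, hconst _ _ hm, rfl]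
    · simp only [v, if_true, if_neg (show ¬ s = 0 by omega), if_neg (show ¬ s = N - 1 by omega),
        if_neg (show ¬ s + 1 = 0 by omega), if_neg (show ¬ s + 1 = N - 1 by omega),
        if_neg (show ¬ 0 + 1 = 0 by omega), if_neg (show ¬ 0 + 1 = N - 1 by omega), map_sub, map_mul,
        map_one]
      ring
    · simp only [v, if_neg (show ¬ s = 0 by omega), if_neg (show ¬ s = N - 1 by omega),
        if_neg (show ¬ s + 1 = 0 by omega), if_neg (show ¬ s + 1 = N - 1 by omega),
        if_neg (show ¬ N - 2 = 0 by omega), if_neg (show ¬ N - 2 = N - 1 by omega),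
        if_neg (show ¬ N - 2 + 1 = 0 by omega), if_pos (show N - 2 + 1 = N - 1 by omega)]
      rw [← hβ]
      simp only [map_sub, map_mul, map_zero]
      ring
  have hint (s : ℕ) (h1 : 1 ≤ s) (h2 : s + 3 ≤ N) : c s = 0 := by
    by_contra h3
    exact hs ⟨s, h1, h2, h3⟩
  -- Now `c` can be nonzero only at the ends `0` and `N - 2`. If it vanishes at `0`, then `v 0`
  -- again provides the leading term, now `c (N - 2) * X ^ (D + 1)`, and `v (N - 2)` makes `g (N -
  -- 3) = 1`. As `c (N - 3) = 0`, the minor of `N - 2` and `N - 3` is `c (N - 2)`.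
  by_cases h0 : c 0 = 0
  · have hc : c (N - 2) ≠ 0 := by
      obtain ⟨s, h1, h2⟩ := h (by omega)
      rcases Nat.eq_zero_or_pos s with rfl | h3
      · exact absurd h0 h2
      · by_cases h4 : s + 3 ≤ N
        · exact absurd (hint s h3 h4) h2
        · rwa [show N - 2 = s by omega]
    let v : ℕ → k[X] := fun l ↦ if l = 0 then C 1 * X ^ D else
      if l = N - 2 then C (γ (N - 3) - 1) else 0
    refine ⟨v, fun l m hm ↦ ?_, _, N - 2, 0, N - 2, N - 3, c (N - 2) * γ 0, c (N - 2), c (N - 2), 0,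
      fun i ↦ rfl, by omega, by omega, by omega, by omega, ?_, ?_, by simpa using hc⟩
    · simp only [v]
      split_ifs
      exacts [hmon _ _ hm, hconst _ _ hm, rfl]
    · simp only [v, h0, if_true, if_neg (show ¬ 0 + 1 = 0 by omega),
        if_neg (show ¬ 0 + 1 = N - 2 by omega), map_mul, map_one, map_zero]
      ring
    · simp only [v, hint (N - 3) (by omega) (by omega), if_neg (show ¬ N - 3 = 0 by omega),
        if_neg (show ¬ N - 3 = N - 2 by omega), if_neg (show ¬ N - 3 + 1 = 0 by omega),
        if_pos (show N - 3 + 1 = N - 2 by omega), map_sub, map_zero, map_one]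
      ring
  -- Since `c 1 = 0`, the choice `v 1 = X ^ D` gives the minor of `0` and `1` the leading term `c 0
  -- * X ^ (D + 1)`. It also changes `g 0` by `-X ^ D`. The second term of `v (N - 1)` cancels this
  -- in the minor of `0` and `N - 2`, and `β` makes that minor equal to `c 0`.
  · let β := γ (N - 2) - (c (N - 2) * γ 0 + c 0) / c 0
    let v : ℕ → k[X] := fun l ↦ if l = 1 then C 1 * X ^ D else
      if l = N - 1 then C β + C (c (N - 2) / c 0) * X ^ D else 0
    refine ⟨v, fun l m hm ↦ ?_, _, 0, 1, 0, N - 2, c 0 * γ 1, c 0, c 0, 0,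
      fun i ↦ rfl, by omega, by omega, by omega, by omega, ?_, ?_, by simpa using h0⟩
    · simp only [v]
      split_ifs
      · exact hmon _ _ hm
      · rw [coeff_add, hmon _ _ hm, hconst _ _ hm, add_zero]
      · rfl
    · simp only [v, hint 1 le_rfl (by omega), if_true, if_neg (show ¬ 1 + 1 = 1 by omega),
        if_neg (show ¬ 1 + 1 = N - 1 by omega), map_mul, map_one, map_zero]
      ring
    · simp only [v, if_neg (show ¬ N - 2 = 1 by omega), if_neg (show ¬ N - 2 = N - 1 by omega),
        if_neg (show ¬ N - 2 + 1 = 1 by omega), if_pos (show N - 2 + 1 = N - 1 by omega),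
        if_neg (show ¬ 0 = 1 by omega), if_neg (show ¬ 0 = N - 1 by omega),
        if_pos (show 0 + 1 = 1 by omega)]
      have h1 : c 0 * β = c 0 * γ (N - 2) - c (N - 2) * γ 0 - c 0 := by
        simp only [β]
        field_simp
        ring
      have h2 : c 0 * (c (N - 2) / c 0) = c (N - 2) := by field_simp
      linear_combination (norm := skip) -congrArg C h1 - X ^ D * congrArg C h2
      simp only [map_sub, map_mul, map_one, map_zero]
      ring

end Minors

/-! ### Consequences of the compatibility relation -/

noncomputable section

open LaurentPolynomial hiding C
open Polynomial

/-- The value of a linear functional with constant coefficients on Laurent polynomials. -/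
abbrev lfunc {k : Type*} [Field k] {σ : Type*} [Fintype σ] (ψ : σ → k)
    (v : σ → LaurentPolynomial k) : LaurentPolynomial k := ∑ s, LaurentPolynomial.C (ψ s) * v s

lemma toLaurent_func {k : Type*} [Field k] {σ : Type*} [Fintype σ] (ψ : σ → k) (v : σ → k[X]) :
    toLaurent (func ψ v) = lfunc ψ fun s ↦ toLaurent (v s) := by
  simp only [func, lfunc, map_sum, map_mul, toLaurent_C]

namespace GluedRings

variable {k : Type*} [Field k] {σ : Type*} {d : σ → ℤ} {R₀ R₁ R : Type*} [CommRing R₀]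
    [CommRing R₁] [CommRing R] (A : GluedRings k d R₀ R₁ R) {x : R₀} {y : R₁}
    {N : ℕ} {ε : σ → LaurentPolynomial k} {w₀ w₁ : ℕ → σ → k[X]}

section Functional

variable [Fintype σ] {ψ : σ → k} {a : ℤ}

/-- `ψ` involves only summands of the same degree `-a`, so applying it to the relation gives a
relation in the single line bundle `𝒪(N+1-a)`. -/
lemma Rel.lfunc_eq (h : A.Rel N ε w₀ w₁) (hψ : ∀ s, ψ s ≠ 0 → d s = -a) {l : ℕ} (hl : l < N) :
    toLaurent (func ψ (w₀ l)) + T (N + 1 - a) * invert (toLaurent (func ψ (w₁ (N - 1 - l)))) =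
      T (l + 1) * lfunc ψ ε := by
  rw [toLaurent_func, toLaurent_func, lfunc, lfunc, lfunc, map_sum, Finset.mul_sum, Finset.mul_sum,
    ← Finset.sum_add_distrib]
  refine Finset.sum_congr rfl fun s _ ↦ ?_
  by_cases hs : ψ s = 0
  · simp [hs]
  · have h1 := h l hl s
    rw [hψ s hs, ← sub_eq_add_neg] at h1
    rw [map_mul, invert_C]
    linear_combination LaurentPolynomial.C (ψ s) * h1

/-- Once `ψ(ε) = 0`, the values of `ψ` on the corrections define global sections of `𝒪(N+1-a)`,
whose degree is at most `-1`. -/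
lemma Rel.func_eq_zero (h : A.Rel N ε w₀ w₁) (hψ : ∀ s, ψ s ≠ 0 → d s = -a) (hN : (N : ℤ) ≤ a - 2)
    (hε : lfunc ψ ε = 0) {l : ℕ} (hl : l < N) : func ψ (w₀ l) = 0 ∧ func ψ (w₁ l) = 0 := by
  have h1 {l : ℕ} (hl : l < N) := h.lfunc_eq A hψ hl
  simp only [hε, mul_zero] at h1
  refine ⟨(eq_zero_of_add_eq_zero (by omega) (h1 hl)).1, ?_⟩
  have h2 := (eq_zero_of_add_eq_zero (by omega) (h1 (show N - 1 - l < N by omega))).2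
  rwa [show N - 1 - (N - 1 - l) = l by omega] at h2

/-- By the relation, `T^(l+1) ψ(ε)` has no exponents strictly between `N + 1 - a` and `0`. This
window is nonempty because `N ≤ a - 3`, and its shifts for `l = 0, …, N - 1` cover all exponents
which contribute to `H¹(𝒪(2-a))`. -/
lemma Rel.coeff_eq_zero (h : A.Rel N ε w₀ w₁) (hψ : ∀ s, ψ s ≠ 0 → d s = -a) (hN : (N : ℤ) ≤ a - 3)
    (hN1 : 1 ≤ N) {n : ℤ} (hn : 1 - a < n) (hn' : n < -1) : (lfunc ψ ε).coeff n = 0 := by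
  -- Shift `n` to the exponent `-1` if `l` can be that large, and otherwise take the largest `l`.
  obtain ⟨l, hl, h1, h2⟩ : ∃ l : ℕ, l < N ∧ (N : ℤ) + 1 - a < n + (l + 1) ∧ n + (l + 1) < 0 := by
    by_cases h1 : -n - 2 < N
    · exact ⟨(-n - 2).toNat, by omega, by omega, by omega⟩
    · exact ⟨N - 1, by omega, by omega, by omega⟩
  have h3 := congrArg (fun f : LaurentPolynomial k ↦ f.coeff (n + (l + 1))) (h.lfunc_eq A hψ hl)
  simp only [AddMonoidAlgebra.coeff_add, Finsupp.add_apply, coeff_toLaurent_of_neg _ h2,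
    coeff_T_mul_invert_of_gt _ h1, coeff_T_mul, add_zero, add_sub_cancel_right] at h3
  exact h3.symm

/-- The lifts of the coordinates can be chosen so that the obstruction lies in the kernel of `ψ`, if
its components along `ψ` split. -/
lemma exists_lifts (hx : A.A₀.π x = X) (hy : A.A₁.π y = X)
    (hε : A.ρ₀ x * A.ρ₁ y = 1 + A.ι ε) (hψ : ∀ s, ψ s ≠ 0 → d s = -a) (hψ0 : ψ ≠ 0)
    (h : ∀ n, 1 - a < n → n < -1 → (lfunc ψ ε).coeff n = 0) :
    ∃ x' y' ε', A.A₀.π x' = X ∧ A.A₁.π y' = X ∧ A.ρ₀ x' * A.ρ₁ y' = 1 + A.ι ε' ∧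
      lfunc ψ ε' = 0 := by
  classical
  obtain ⟨u, v, huv⟩ := exists_decomposition h
  obtain ⟨s, hs⟩ := Function.ne_iff.mp hψ0
  have hs : ψ s ≠ 0 := hs
  -- The corrections along `ψ` are placed in one component where `ψ` is nonzero, scaled by its
  -- inverse there.
  refine ⟨_, _, _, ?_, ?_, A.eps_change hε hx hy (Pi.single s (C (ψ s)⁻¹ * u))
    (Pi.single s (C (ψ s)⁻¹ * v)), ?_⟩
  · rw [map_add, ThickLine.π_ι, hx, add_zero]
  · rw [map_add, ThickLine.π_ι, hy, add_zero]
  · have hC : LaurentPolynomial.C (ψ s) * LaurentPolynomial.C (ψ s)⁻¹ = 1 := by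
      rw [← map_mul, mul_inv_cancel₀ hs, map_one]
    have h1 (p : k[X]) : ∑ i, LaurentPolynomial.C (ψ i) * (T (-1) *
        toLaurent ((Pi.single s p : σ → k[X]) i)) =
        LaurentPolynomial.C (ψ s) * (T (-1) * toLaurent p) := by
      rw [Finset.sum_eq_single s, Pi.single_eq_same]
      · intro i _ hi
        rw [Pi.single_eq_of_ne hi, map_zero, mul_zero, mul_zero]
      · simp
    have h2 (p : k[X]) : ∑ i, LaurentPolynomial.C (ψ i) * (T (1 + d i) *
        invert (toLaurent ((Pi.single s p : σ → k[X]) i))) =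
        LaurentPolynomial.C (ψ s) * (T (1 - a) * invert (toLaurent p)) := by
      rw [Finset.sum_eq_single s, Pi.single_eq_same, hψ s hs, ← sub_eq_add_neg]
      · intro i _ hi
        rw [Pi.single_eq_of_ne hi, map_zero, map_zero, mul_zero, mul_zero]
      · simp
    simp only [lfunc, mul_add, Finset.sum_add_distrib]
    rw [h1, h2, map_mul, map_mul, map_mul, toLaurent_C, invert_C]
    simp only [lfunc] at huv
    linear_combination huv + (T (-1) * toLaurent u + T (1 - a) * invert (toLaurent v)) * hC

end Functional

/-- The general solution of the compatibility relation. -/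
lemma exists_rel_of_coeff (hN : ∀ s, -1 ≤ N + 1 + d s) (ε : σ → LaurentPolynomial k)
    {v : ℕ → σ → k[X]} (hv : ∀ l s (m : ℕ), N + 1 + d s < m → (v l s).coeff m = 0) :
    ∃ w₁, A.Rel N ε (fun l s ↦ trunc (T (l + 1) * ε s) + v l s) w₁ := by
  -- `H¹` of a line bundle of degree at least `-1` vanishes. The truncation removes the nonnegative
  -- exponents, and the negative ones are at most `N + 1 + d s`. Adding `v` creates only exponents
  -- that the second chart can absorb.
  have h (l : ℕ) (s : σ) : ∃ q : k[X], T (N + 1 + d s) * invert (toLaurent q) = T (l + 1) * ε s -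
      toLaurent (trunc (T (l + 1) * ε s) + v l s) := by
    refine exists_T_mul_invert _ fun n hn ↦ ?_
    rw [AddMonoidAlgebra.coeff_sub, Finsupp.sub_apply, map_add, AddMonoidAlgebra.coeff_add,
      Finsupp.add_apply]
    rcases lt_or_ge n 0 with h1 | h1
    · have := hN s
      omega
    · obtain ⟨m, rfl⟩ := Int.eq_ofNat_of_zero_le h1
      rw [coeff_toLaurent_natCast, coeff_toLaurent_natCast, coeff_trunc, hv l s m hn, add_zero,
        sub_self]
  choose q hq using h
  refine ⟨fun m ↦ q (N - 1 - m), fun l hl s ↦ ?_⟩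
  simp only
  rw [show N - 1 - (N - 1 - l) = l by omega, hq]
  ring

/-- Eliminating `ε` from two consecutive relations shows that `X w_l - w_{l+1}` extends to a global
section of the line bundle of degree `N + 2 + d s`. On the second chart it has the same shape with
the order of the indices reversed. -/
lemma Rel.diff_eq (h : A.Rel N ε w₀ w₁) {l : ℕ} (hl : l + 2 ≤ N) (s : σ) :
    toLaurent (X * w₀ l s - w₀ (l + 1) s) = T (N + 2 + d s) *
      invert (toLaurent (X * w₁ (N - 2 - l) s - w₁ (N - 2 - l + 1) s)) := by
  have h1 := h l (by omega) s
  have h2 := h (l + 1) (by omega) s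
  rw [show N - 1 - l = N - 2 - l + 1 by omega] at h1
  rw [show N - 1 - (l + 1) = N - 2 - l by omega] at h2
  push_cast at h2
  rw [map_sub, map_mul, map_sub, map_mul, map_sub, map_mul, toLaurent_X, invert_T]
  have e1 : (T (N + 2 + d s) : LaurentPolynomial k) = T 1 * T (N + 1 + d s) := by
    rw [← T_add]; congr 1; ring
  have e2 : (T (l + 1 + 1) : LaurentPolynomial k) = T 1 * T (l + 1) := by
    rw [← T_add]; congr 1; ring
  have hT : (T 1 : LaurentPolynomial k) * T (-1) = 1 := by rw [← T_add]; simp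
  rw [e2] at h2
  rw [e1]
  linear_combination T 1 * h1 - h2 -
    T (N + 1 + d s) * invert (toLaurent (w₁ (N - 2 - l) s)) * hT

end GluedRings

/-- A subring containing the coordinate functions is the whole ring, if the sections of the ideal
have coprime minors. -/
lemma ThickLine.eq_top_of_isCoprime {k : Type*} [Field k] {R : Type*} [CommRing R]
    (A : ThickLine k (Fin 2) R) {x : R} (hx : A.π x = X) {w : ℕ → Fin 2 → k[X]} {N : ℕ}
    (S : Subring R) (hc : ∀ a, A.c a ∈ S) (hS : ∀ l ≤ N, A.seq x w l ∈ S) (hN : 1 ≤ N)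
    {n : ℕ → Fin 2 → k[X]} (hn : ∀ l s, n l s = X * w l s - w (l + 1) s)
    {l m l' m' : ℕ} (hl : l + 2 ≤ N) (hm : m + 2 ≤ N) (hl' : l' + 2 ≤ N) (hm' : m' + 2 ≤ N)
    (h : IsCoprime (n l 0 * n m 1 - n m 0 * n l 1) (n l' 0 * n m' 1 - n m' 0 * n l' 1)) :
    S = ⊤ := by
  have h1 (q : k[X]) {l : ℕ} (hl : l + 2 ≤ N) : A.ι (q • n l) ∈ S := by
    have := A.ι_mem_of_seq_mem hx S hc hS hl q
    rwa [show n l = (X : k[X]) • w l - w (l + 1) from funext fun s ↦ hn l s]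
  have h2 {l m : ℕ} (hl : l + 2 ≤ N) (hm : m + 2 ≤ N) (v : Fin 2 → k[X]) :
      A.ι ((n l 0 * n m 1 - n m 0 * n l 1) • v) ∈ S := by
    -- Cramer's rule: the minor times any vector is a combination of the two columns.
    have h3 : (n l 0 * n m 1 - n m 0 * n l 1) • v =
        (n m 1 * v 0 - n m 0 * v 1) • n l + (n l 0 * v 1 - n l 1 * v 0) • n m := by
      ext1 s
      fin_cases s <;> simp <;> ring
    rw [h3, map_add]
    exact add_mem (h1 _ hl) (h1 _ hm)
  obtain ⟨p, q, hpq⟩ := h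
  have h4 (v : Fin 2 → k[X]) : A.ι v ∈ S := by
    have h5 : v = (n l 0 * n m 1 - n m 0 * n l 1) • (p • v) +
        (n l' 0 * n m' 1 - n m' 0 * n l' 1) • (q • v) := by
      rw [smul_smul, smul_smul, ← add_smul, mul_comm _ p, mul_comm _ q, hpq, one_smul]
    rw [h5, map_add]
    exact add_mem (h2 hl hm _) (h2 hl' hm' _)
  refine top_unique fun r _ ↦ ?_
  obtain ⟨v, hv⟩ := A.exists_eq_eval₂_add hx r
  rw [hv]
  exact add_mem (A.eval₂_mem_of_seq_mem S hc hS hN (h4 _) _) (h4 _)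

end

/-! ### Extensions whose coordinates generate the ring, or the subring of a functional -/

noncomputable section

open LaurentPolynomial hiding C
open Polynomial

variable {k : Type*} [Field k]

/-- The degrees of the two summands of the conormal bundle. -/
abbrev degs (a b : ℤ) : Fin 2 → ℤ := ![-a, -b]

lemma coeff_C_mul_laurent (c : k) (f : LaurentPolynomial k) (n : ℤ) :
    (LaurentPolynomial.C c * f).coeff n = c * f.coeff n := by
  rw [← LaurentPolynomial.smul_eq_C_mul]
  simp

lemma coeff_lfunc {σ : Type*} [Fintype σ] (ψ : σ → k) (v : σ → LaurentPolynomial k) (n : ℤ) :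
    (lfunc ψ v).coeff n = ∑ s, ψ s * (v s).coeff n := by
  simp only [lfunc, AddMonoidAlgebra.coeff_sum, Finsupp.finsetSum_apply, coeff_C_mul_laurent]

lemma func_trunc_eq_zero {σ : Type*} [Fintype σ] {ψ : σ → k} {ε : σ → LaurentPolynomial k}
    (h : lfunc ψ ε = 0) (n : ℤ) : func ψ (fun s ↦ trunc (T n * ε s)) = 0 := by
  ext m
  simp only [func, finsetSum_coeff, coeff_C_mul, coeff_trunc, coeff_T_mul, coeff_zero]
  rw [← coeff_lfunc, h]
  rfl

/-- A kernel vector of a functional on `k²`, in the position which avoids the pivot. -/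
lemma exists_kernel_vector {a b : ℤ} {ψ : Fin 2 → k} (hψ0 : ψ ≠ 0)
    (hψ : ∀ s, ψ s ≠ 0 → degs a b s = -a) :
    ∃ (s₀ : Fin 2) (φ : Fin 2 → k), φ s₀ = 1 ∧ ∑ s, ψ s * φ s = 0 ∧ degs a b s₀ = -b ∧
      (∀ s, φ s ≠ 0 → degs a b s = -b) ∧ ∃ s₁, s₁ ≠ s₀ ∧ ψ s₁ ≠ 0 := by
  by_cases h0 : ψ 0 = 0
  · have h1 : ψ 1 ≠ 0 := fun h1 ↦ hψ0 (by ext s; fin_cases s <;> assumption)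
    have h2 : b = a := by simpa using hψ 1 h1
    subst h2
    refine ⟨0, ![1, 0], rfl, by simp [h0], rfl, fun s _ ↦ by fin_cases s <;> rfl, 1, by simp, h1⟩
  · refine ⟨1, ![-ψ 1 / ψ 0, 1], rfl, ?_, rfl, fun s hs ↦ ?_, 0, by simp, h0⟩
    · simp only [Fin.sum_univ_two, Matrix.cons_val_zero, Matrix.cons_val_one]
      field_simp
      ring
    · fin_cases s
      · have h1 : ψ 1 ≠ 0 := by
          intro h1
          simp [h1] at hs
        have h2 : b = a := by simpa using hψ 1 h1
        simp [h2]
      · rfl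

/-- On the kernel of `ψ` the component `s₀` determines the other one, because `ψ s₁` is a nonzero
constant. -/
lemma eq_zero_of_func_eq_zero {ψ : Fin 2 → k} {s₀ s₁ : Fin 2} (h : s₁ ≠ s₀) (h₁ : ψ s₁ ≠ 0)
    {v : Fin 2 → k[X]} (hv : func ψ v = 0) (hs : v s₀ = 0) : v = 0 := by
  have key : C (ψ s₁) * v s₁ = 0 := by
    rw [func, Finset.sum_eq_single s₁] at hv
    · exact hv
    · intro s _ h2
      obtain rfl : s = s₀ := by omega
      rw [hs, mul_zero]
    · simp
  have h3 : v s₁ = 0 := by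
    rcases mul_eq_zero.mp key with h4 | h4
    · exact absurd (C_eq_zero.mp h4) h₁
    · exact h4
  ext1 s
  by_cases h2 : s = s₀
  · rw [h2, hs]; rfl
  · obtain rfl : s = s₁ := by omega
    rw [h3]; rfl

/-- A subring containing the coordinate functions contains the part of the ideal where `ψ` vanishes,
if two of the sections of the ideal are coprime. -/
lemma ThickLine.sub_le_of_isCoprime {R : Type*} [CommRing R]
    (A : ThickLine k (Fin 2) R) {x : R} (hx : A.π x = X) {w : ℕ → Fin 2 → k[X]} {M : ℕ}
    (S : Subring R) (hc : ∀ a, A.c a ∈ S) (hS : ∀ l ≤ M, A.seq x w l ∈ S)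
    {ψ : Fin 2 → k} (hw : ∀ l < M, func ψ (w l) = 0) {s₀ s₁ : Fin 2} (h : s₁ ≠ s₀) (h₁ : ψ s₁ ≠ 0)
    {l m : ℕ} (hl : l + 2 ≤ M) (hm : m + 2 ≤ M)
    (hlm : IsCoprime (X * w l s₀ - w (l + 1) s₀) (X * w m s₀ - w (m + 1) s₀)) :
    A.sub ψ hx ≤ S := by
  have hsmul (q : k[X]) {v : Fin 2 → k[X]} (hv : func ψ v = 0) : func ψ (q • v) = 0 := by
    have : func ψ (q • v) = q * func ψ v := by
      simp only [func, Finset.mul_sum, Pi.smul_apply, smul_eq_mul, mul_left_comm]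
    rw [this, hv, mul_zero]
  have hadd {v v' : Fin 2 → k[X]} (hv : func ψ v = 0) (hv' : func ψ v' = 0) :
      func ψ (v + v') = 0 := by
    have : func ψ (v + v') = func ψ v + func ψ v' := by
      simp only [func, Pi.add_apply, mul_add, Finset.sum_add_distrib]
    rw [this, hv, hv', add_zero]
  have hn {l : ℕ} (hl : l + 2 ≤ M) : func ψ ((X : k[X]) • w l - w (l + 1)) = 0 := by
    rw [sub_eq_add_neg, ← neg_one_smul k[X] (w (l + 1))]
    exact hadd (hsmul _ (hw _ (by omega))) (hsmul _ (hw _ (by omega)))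
  obtain ⟨p, q, hpq⟩ := hlm
  have hι {v : Fin 2 → k[X]} (hv : func ψ v = 0) : A.ι v ∈ S := by
    have h2 : v = (v s₀ * p) • ((X : k[X]) • w l - w (l + 1)) +
        (v s₀ * q) • ((X : k[X]) • w m - w (m + 1)) := by
      rw [← sub_eq_zero]
      refine eq_zero_of_func_eq_zero h h₁ ?_ ?_
      · rw [sub_eq_add_neg, ← neg_one_smul k[X] (_ + _)]
        exact hadd hv (hsmul _ (hadd (hsmul _ (hn hl)) (hsmul _ (hn hm))))
      · simp only [Pi.sub_apply, Pi.add_apply, Pi.smul_apply, smul_eq_mul]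
        linear_combination -v s₀ * hpq
    rw [h2, map_add]
    exact add_mem (A.ι_mem_of_seq_mem hx S hc hS hl _) (A.ι_mem_of_seq_mem hx S hc hS hm _)
  rintro _ ⟨p, v, hv, rfl⟩
  exact add_mem (A.eval₂_mem_of_seq_mem S hc hS (by omega) (hι (hw 0 (by omega))) _) (hι hv)

namespace GluedRings

variable {a b : ℤ} {R₀ R₁ R : Type*} [CommRing R₀] [CommRing R₁] [CommRing R]
  (A : GluedRings k (degs a b) R₀ R₁ R) {x : R₀} {y : R₁} {N : ℕ} {ε : Fin 2 → LaurentPolynomial k}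

/-- If the obstruction does not vanish along any functional, some extension of the rational normal
curve of degree `a - 2` generates the rings of functions. -/
lemma exists_rel_generating (hx : A.A₀.π x = X) (hy : A.A₁.π y = X) (hab : b ≤ a)
    (hN : (N : ℤ) = a - 2) (hN4 : 4 ≤ N)
    (H : ∀ ψ : Fin 2 → k, ψ ≠ 0 → (∀ s, ψ s ≠ 0 → degs a b s = -a) →
      ∃ n, 1 - a < n ∧ n < -1 ∧ (lfunc ψ ε).coeff n ≠ 0) :
    ∃ w₀ w₁, A.Rel N ε w₀ w₁ ∧
      (∀ S : Subring R₀, (∀ c, A.A₀.c c ∈ S) → (∀ l ≤ N, A.A₀.seq x w₀ l ∈ S) → S = ⊤) ∧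
      ∀ S : Subring R₁, (∀ c, A.A₁.c c ∈ S) → (∀ l ≤ N, A.A₁.seq y w₁ l ∈ S) → S = ⊤ := by
  obtain ⟨D, hD⟩ := Int.eq_ofNat_of_zero_le (sub_nonneg.mpr hab)
  -- By `trunc_T_mul` these are the values of `X w_l - w_{l+1}` for the solution given by
  -- truncation. For `l + 2 ≤ N = a - 2` the exponents are exactly those contributing to
  -- `H¹(𝒪(2-a))`.
  let c (l : ℕ) : k := -(ε 0).coeff (-(l + 2))
  let γ (l : ℕ) : k := -(ε 1).coeff (-(l + 2))
  have hH (ψ : Fin 2 → k) (h1 : ψ ≠ 0) (h2 : ∀ s, ψ s ≠ 0 → degs a b s = -a) :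
      ∃ s, s + 2 ≤ N ∧ ψ 0 * c s + ψ 1 * γ s ≠ 0 := by
    obtain ⟨n, hn, hn', h3⟩ := H ψ h1 h2
    refine ⟨(-n - 2).toNat, by omega, fun h4 ↦ h3 ?_⟩
    simp only [c, γ] at h4
    rw [show (-(((-n - 2).toNat : ℤ) + 2)) = n by omega] at h4
    rw [coeff_lfunc, Fin.sum_univ_two]
    linear_combination -h4
  have hH0 : ∃ s, s + 2 ≤ N ∧ c s ≠ 0 := by
    obtain ⟨s, h1, h2⟩ := hH ![1, 0] (fun h ↦ one_ne_zero (congrFun h 0)) (fun s hs ↦ by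
      fin_cases s
      · rfl
      · simp at hs)
    exact ⟨s, h1, by simpa using h2⟩
  obtain ⟨v, hv, g, l, m, l', m', κ, r, t, e, hg, hl, hm, hl', hm', e1, e2, hne⟩ :=
    exists_coprime_minors c γ (D := D) hN4 (fun _ ↦ hH0) (fun h0 ↦ by
      obtain ⟨s, h1, h2⟩ := hH0
      -- If `a = b`, every nonzero functional is admissible. For this one, nonvanishing at `s'` says
      -- that the minor of `s'` and `s` is nonzero.
      obtain ⟨s', h3, h4⟩ := hH ![γ s, -c s] (fun h ↦ h2 (by simpa using congrFun h 1))
        (fun s _ ↦ by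
          have : b = a := by omega
          subst this
          fin_cases s <;> rfl)
      refine ⟨s', s, h3, h1, fun h5 ↦ h4 ?_⟩
      simp only [Matrix.cons_val_zero, Matrix.cons_val_one]
      linear_combination h5)
  -- Only the second component can be modified: `𝒪(N+1-a) = 𝒪(-1)` has no sections, while `𝒪(N+1-b)
  -- = 𝒪(D-1)` has the polynomials of degree less than `D`.
  obtain ⟨w₁, hw⟩ := A.exists_rel_of_coeff (N := N)
    (fun s ↦ by fin_cases s <;> simp <;> omega) ε (v := fun l ↦ ![0, v l])
    (fun l s m hm ↦ by
      fin_cases s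
      · simp
      · change (N : ℤ) + 1 + -b < m at hm
        exact hv l m (by omega))
  let w₀ (l : ℕ) (s : Fin 2) : k[X] := trunc (T (l + 1) * ε s) + (![0, v l] : Fin 2 → k[X]) s
  have n0 (l : ℕ) : X * w₀ l 0 - w₀ (l + 1) 0 = C (c l) := by
    simp only [w₀, Matrix.cons_val_zero, add_zero, trunc_T_mul, c]
  have n1 (l : ℕ) : X * w₀ l 1 - w₀ (l + 1) 1 = g l := by
    simp only [w₀, Matrix.cons_val_one, hg, γ, ← trunc_T_mul]
    simp only [Matrix.cons_val_zero]
    ring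
  -- The two components are sections of `𝒪` and `𝒪(D)`, so the minors are sections of `𝒪(D)` and on
  -- the second chart their coefficients are reversed.
  have hdet {l m : ℕ} (hl : l + 2 ≤ N) (hm : m + 2 ≤ N) {κ r : k}
      (h : C (c l) * g m - C (c m) * g l = C κ + C r * X ^ D) :
      (X * w₁ (N - 2 - l) 0 - w₁ (N - 2 - l + 1) 0) * (X * w₁ (N - 2 - m) 1 - w₁ (N - 2 - m + 1) 1) -
      (X * w₁ (N - 2 - m) 0 - w₁ (N - 2 - m + 1) 0) * (X * w₁ (N - 2 - l) 1 - w₁ (N - 2 - l + 1) 1) =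
      C r + C κ * X ^ D := by
    refine eq_of_toLaurent_eq ?_ h
    have d1 := hw.diff_eq A hl 0
    have d2 := hw.diff_eq A hl 1
    have d3 := hw.diff_eq A hm 0
    have d4 := hw.diff_eq A hm 1
    have a0 : (N : ℤ) + 2 + degs a b 0 = 0 := by simp [hN]
    have a1 : (N : ℤ) + 2 + degs a b 1 = D := by simp; omega
    rw [a0, T_zero, one_mul] at d1 d3
    rw [a1] at d2 d4
    rw [← n0, ← n0, ← n1, ← n1, map_sub, map_mul, map_mul, d1, d2, d3, d4]
    simp only [map_sub, map_mul]
    ring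
  refine ⟨w₀, w₁, hw, fun S hc hS ↦ ?_, fun S hc hS ↦ ?_⟩
  · refine A.A₀.eq_top_of_isCoprime hx S hc hS (by omega) (fun _ _ ↦ rfl) hl hm hl' hm' ?_
    rw [n0, n0, n0, n0, n1, n1, n1, n1, e1, e2]
    exact isCoprime_of_ne D hne
  · refine A.A₁.eq_top_of_isCoprime hy S hc hS (by omega) (fun _ _ ↦ rfl) (l := N - 2 - l)
      (m := N - 2 - m) (l' := N - 2 - l') (m' := N - 2 - m') (by omega) (by omega) (by omega)
      (by omega) ?_
    rw [hdet hl hm e1, hdet hl' hm' e2]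
    refine isCoprime_of_ne D fun h ↦ hne ?_
    linear_combination -h

/-- If the obstruction vanishes along `ψ`, the subring cut out by `ψ` is generated by the coordinates
of an extension of a rational normal curve of large degree. -/
lemma exists_rel_generating_sub (hx : A.A₀.π x = X) (hy : A.A₁.π y = X)
    {ψ : Fin 2 → k} (hψ0 : ψ ≠ 0) (hψ : ∀ s, ψ s ≠ 0 → degs a b s = -a) (hε : lfunc ψ ε = 0) :
    ∃ M : ℕ, 1 ≤ M ∧ ∃ w₀ w₁, A.Rel M ε w₀ w₁ ∧ (∀ l < M, func ψ (w₀ l) = 0) ∧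
      (∀ l < M, func ψ (w₁ l) = 0) ∧
      (∀ S : Subring R₀, (∀ c, A.A₀.c c ∈ S) → (∀ l ≤ M, A.A₀.seq x w₀ l ∈ S) →
        A.A₀.sub ψ hx ≤ S) ∧
      ∀ S : Subring R₁, (∀ c, A.A₁.c c ∈ S) → (∀ l ≤ M, A.A₁.seq y w₁ l ∈ S) →
        A.A₁.sub ψ hy ≤ S := by
  obtain ⟨s₀, φ, hφ0, hφψ, hs₀, hφ, s₁, hs, hs₁⟩ := exists_kernel_vector hψ0 hψ
  obtain ⟨M, hM, hMa, hMb⟩ : ∃ M : ℕ, 3 ≤ M ∧ a ≤ M ∧ b ≤ M :=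
    ⟨3 + a.toNat + b.toNat, by omega, by omega, by omega⟩
  obtain ⟨D, hD⟩ := Int.eq_ofNat_of_zero_le (show (0 : ℤ) ≤ M + 1 - b by omega)
  let γ (l : ℕ) : k := -(ε s₀).coeff (-(l + 2))
  -- The two nonzero values make the `s₀`-components of `X w_l - w_{l+1}` equal to `γ 0 + X^(D+1)`
  -- for `l = 0` and to `1` for `l = M - 2`. These stay coprime after reversing coefficients.
  -- Multiplying `v` by the kernel vector `φ` below keeps the corrections in the kernel of `ψ`.
  let v (l : ℕ) : k[X] := if l = 0 then X ^ D else if l = M - 1 then C (γ (M - 2) - 1) else 0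
  have hv (l m : ℕ) (hm : D < m) : (v l).coeff m = 0 := by
    simp only [v]
    split_ifs
    · rw [coeff_X_pow, if_neg (by omega)]
    · rw [coeff_C, if_neg (by omega)]
    · rfl
  obtain ⟨w₁, hw⟩ := A.exists_rel_of_coeff (N := M)
    (fun s ↦ by fin_cases s <;> simp <;> omega) ε (v := fun l s ↦ C (φ s) * v l)
    (fun l s m hm ↦ by
      rw [coeff_C_mul]
      by_cases h : φ s = 0
      · rw [h, zero_mul]
      · rw [hφ s h] at hm
        rw [hv l m (by omega), mul_zero])
  let w₀ (l : ℕ) (s : Fin 2) : k[X] := trunc (T (l + 1) * ε s) + C (φ s) * v l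
  have hw₀ (l : ℕ) : func ψ (w₀ l) = 0 := by
    have h1 : func ψ (w₀ l) = func ψ (fun s ↦ trunc (T (l + 1) * ε s)) +
        C (∑ s, ψ s * φ s) * v l := by
      simp only [func, w₀, mul_add, Finset.sum_add_distrib, map_sum, map_mul, Finset.sum_mul,
        mul_assoc]
    rw [h1, func_trunc_eq_zero hε, hφψ, map_zero, zero_mul, add_zero]
  have hw₁ (l : ℕ) (hl : l < M) : func ψ (w₁ l) = 0 := by
    have h1 := hw.lfunc_eq A hψ (show M - 1 - l < M by omega)
    rw [show M - 1 - (M - 1 - l) = l by omega, hw₀, hε, mul_zero, map_zero, zero_add,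
      (isUnit_T _).mul_right_eq_zero, map_eq_zero_iff _ invert.injective] at h1
    exact toLaurent_injective (h1.trans (map_zero _).symm)
  have n0 (l : ℕ) : X * w₀ l s₀ - w₀ (l + 1) s₀ = C (γ l) + X * v l - v (l + 1) := by
    simp only [w₀, hφ0, map_one, one_mul, γ, ← trunc_T_mul]
    ring
  have e1 : X * w₀ 0 s₀ - w₀ (0 + 1) s₀ = C (γ 0) + C 1 * X ^ (D + 1) := by
    rw [n0]
    simp only [v, if_true, if_neg (show ¬ 0 + 1 = 0 by omega),
      if_neg (show ¬ 0 + 1 = M - 1 by omega), map_one]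
    ring
  have e2 : X * w₀ (M - 2) s₀ - w₀ (M - 2 + 1) s₀ = C 1 + C 0 * X ^ (D + 1) := by
    rw [n0]
    simp only [v, if_neg (show ¬ M - 2 = 0 by omega), if_neg (show ¬ M - 2 = M - 1 by omega),
      if_neg (show ¬ M - 2 + 1 = 0 by omega), if_pos (show M - 2 + 1 = M - 1 by omega), map_sub,
      map_one, map_zero]
    ring
  have hdiff {l : ℕ} (hl : l + 2 ≤ M) {κ r : k}
      (h : X * w₀ l s₀ - w₀ (l + 1) s₀ = C κ + C r * X ^ (D + 1)) :
      X * w₁ (M - 2 - l) s₀ - w₁ (M - 2 - l + 1) s₀ = C r + C κ * X ^ (D + 1) := by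
    refine eq_of_toLaurent_eq ?_ h
    have h1 := hw.diff_eq A hl s₀
    rwa [hs₀, show (M : ℤ) + 2 + -b = (D + 1 : ℕ) by push_cast; omega] at h1
  refine ⟨M, by omega, w₀, w₁, hw, fun l _ ↦ hw₀ l, hw₁, fun S hc hS ↦ ?_, fun S hc hS ↦ ?_⟩
  · refine A.A₀.sub_le_of_isCoprime hx S hc hS (fun l _ ↦ hw₀ l) hs hs₁ (l := 0) (m := M - 2)
      (by omega) (by omega) ?_
    rw [e1, e2]
    exact isCoprime_of_ne _ (by simp)
  · refine A.A₁.sub_le_of_isCoprime hy S hc hS hw₁ hs hs₁ (l := M - 2 - 0) (m := M - 2 - (M - 2))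
      (by omega) (by omega) ?_
    rw [hdiff (by omega) e1, hdiff (by omega) e2]
    exact isCoprime_of_ne _ (by simp)

end GluedRings

end

/-! ### Local trivializations of glued line bundles -/

noncomputable section GluedTrivializations

variable {X : Scheme.{u}} {A B : X.Opens} (t : Γ(X, A ⊓ B)ˣ)

lemma res_val_inv_mul {U : X.Opens} (h : U ≤ A ⊓ B) (f : Γ(X, U)) :
    res h (t⁻¹ : Γ(X, A ⊓ B)ˣ).1 * (res h t.1 * f) = f := by
  rw [← mul_assoc, ← map_mul, Units.inv_mul, map_one, one_mul]

lemma res_val_mul_inv {U : X.Opens} (h : U ≤ A ⊓ B) (f : Γ(X, U)) :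
    res h t.1 * (res h (t⁻¹ : Γ(X, A ⊓ B)ˣ).1 * f) = f := by
  rw [← mul_assoc, ← map_mul, Units.mul_inv, map_one, one_mul]

lemma gluedSections_fst_eq {U : X.Opens} (s : gluedSections t U) :
    res (inf_le_inf_left U inf_le_left : U ⊓ (A ⊓ B) ≤ U ⊓ A) s.1.1 =
    res (inf_le_right : U ⊓ (A ⊓ B) ≤ A ⊓ B) (t : Γ(X, A ⊓ B)) *
      res (inf_le_inf_left U inf_le_right : U ⊓ (A ⊓ B) ≤ U ⊓ B) s.1.2 := s.2

lemma gluedSections_res_fst {U W : X.Opens} (s : gluedSections t U) (hW : W ≤ U) (hWA : W ≤ A)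
    (hWB : W ≤ B) : res (le_inf hW hWA) s.1.1 = res (le_inf hWA hWB) t.1 *
      res (le_inf hW hWB) s.1.2 := by
  have h := congrArg (res (le_inf hW (le_inf hWA hWB))) (gluedSections_fst_eq t s)
  rw [map_mul] at h
  simpa only [res_res] using h

/-- The trivialization of a glued line bundle over the open subsets of `A`. -/
def gsec₀ {U : X.Opens} (hU : U ≤ A) : Γ(X, U) ≃+ gluedSections t U where
  toFun f := ⟨(res inf_le_left f, res (inf_le_inf_right B hU) (t⁻¹ : Γ(X, A ⊓ B)ˣ).1 *
    res inf_le_left f), by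
    change res _ (res _ _) = _ * res _ (_ * res _ _)
    rw [map_mul, res_res, res_res, res_res, res_val_mul_inv]⟩
  invFun s := res (le_inf le_rfl hU) s.1.1
  left_inv f := by
    change res _ (res _ f) = f
    rw [res_res]
    exact res_self f
  right_inv s := by
    refine Subtype.ext (Prod.ext ?_ ?_)
    · change res _ (res _ _) = _
      rw [res_res]
      exact res_self _
    · change _ * res _ (res _ _) = _
      rw [res_res]
      refine (congrArg (_ * ·) (gluedSections_res_fst t s inf_le_left (inf_le_left.trans hU)
        inf_le_right)).trans ((res_val_inv_mul t _ _).trans (res_self _))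
  map_add' f g := by
    refine Subtype.ext (Prod.ext (map_add _ _ _) ?_)
    change _ * res _ (f + g) = _ * res _ f + _ * res _ g
    rw [map_add, mul_add]

/-- The trivialization of a glued line bundle over the open subsets of `B`. -/
def gsec₁ {U : X.Opens} (hU : U ≤ B) : Γ(X, U) ≃+ gluedSections t U where
  toFun f := ⟨(res (le_inf inf_le_right (inf_le_left.trans hU)) t.1 *
    res inf_le_left f, res inf_le_left f), by
    change res _ (_ * res _ _) = _ * res _ (res _ _)
    rw [map_mul, res_res, res_res, res_res]⟩
  invFun s := res (le_inf le_rfl hU) s.1.2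
  left_inv f := by
    change res _ (res _ f) = f
    rw [res_res]
    exact res_self f
  right_inv s := by
    refine Subtype.ext (Prod.ext ?_ ?_)
    · change _ * res _ (res _ _) = _
      rw [res_res]
      exact (gluedSections_res_fst t s inf_le_left inf_le_right
        (inf_le_left.trans hU)).symm.trans (res_self _)
    · change res _ (res _ _) = _
      rw [res_res]
      exact res_self _
  map_add' f g := by
    refine Subtype.ext (Prod.ext ?_ (map_add _ _ _))
    change _ * res _ (f + g) = _ * res _ f + _ * res _ g
    rw [map_add, mul_add]

lemma gsec₀_mul {U : X.Opens} (hU : U ≤ A) (r f : Γ(X, U)) :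
    gsec₀ t hU (r * f) = r • gsec₀ t hU f := by
  refine Subtype.ext (Prod.ext (map_mul _ _ _) ?_)
  change _ * res _ (r * f) = res _ r * (_ * res _ f)
  rw [map_mul, mul_left_comm]

lemma gsec₁_mul {U : X.Opens} (hU : U ≤ B) (r f : Γ(X, U)) :
    gsec₁ t hU (r * f) = r • gsec₁ t hU f := by
  refine Subtype.ext (Prod.ext ?_ (map_mul _ _ _))
  change _ * res _ (r * f) = res _ r * (_ * res _ f)
  rw [map_mul, mul_left_comm]

lemma gluedRes_gsec₀ {U V : X.Opens} (hU : U ≤ A) (h : V ≤ U) (f : Γ(X, U)) :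
    gluedRes t h (gsec₀ t hU f) = gsec₀ t (h.trans hU) (res h f) := by
  refine Subtype.ext (Prod.ext ?_ ?_)
  · change res _ (res _ f) = res _ (res _ f)
    rw [res_res, res_res]
  · change res _ (_ * res _ f) = _ * res _ (res _ f)
    rw [map_mul, res_res, res_res, res_res]

lemma gluedRes_gsec₁ {U V : X.Opens} (hU : U ≤ B) (h : V ≤ U) (f : Γ(X, U)) :
    gluedRes t h (gsec₁ t hU f) = gsec₁ t (h.trans hU) (res h f) := by
  refine Subtype.ext (Prod.ext ?_ ?_)
  · change res _ (_ * res _ f) = _ * res _ (res _ f)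
    rw [map_mul, res_res, res_res, res_res]
  · change res _ (res _ f) = res _ (res _ f)
    rw [res_res, res_res]

lemma gsec₁_eq_gsec₀ {U : X.Opens} (h₀ : U ≤ A) (h₁ : U ≤ B) (f : Γ(X, U)) :
    gsec₁ t h₁ f = gsec₀ t h₀ (res (le_inf h₀ h₁) t.1 * f) := by
  refine Subtype.ext (Prod.ext ?_ ?_)
  · change _ * res _ f = res _ (_ * f)
    rw [map_mul, res_res]
  · change res _ f = _ * res _ (_ * f)
    rw [map_mul, res_res, res_val_inv_mul]

end GluedTrivializations

/-! ### Frames of a split conormal bundle -/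

noncomputable section SplitConormal

/-- An identification of the ideal sheaf of `Y` in `X` with a direct sum of glued line bundles. -/
structure SplitConormal {Y X : Scheme.{u}} (j : Y ⟶ X) {A B : Y.Opens} {σ : Type}
    (t : σ → Γ(Y, A ⊓ B)ˣ) where
  /-- The isomorphism on sections over `U`. -/
  equiv (U : X.Opens) : RingHom.ker (j.app U).hom ≃+ ∀ s, gluedSections (t s) (j ⁻¹ᵁ U)
  map_smul (U : X.Opens) (r : Γ(X, U)) (x : RingHom.ker (j.app U).hom) (s : σ) :
    equiv U (r • x) s = (j.app U r : Γ(Y, j ⁻¹ᵁ U)) • equiv U x s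
  map_res {U V : X.Opens} (h : V ≤ U) (x : RingHom.ker (j.app U).hom)
    (y : RingHom.ker (j.app V).hom) (hxy : y.1 = res h x.1) (s : σ) :
    equiv V y s = gluedRes (t s) (j.preimage_mono h) (equiv U x s)

namespace SplitConormal

variable {Y X : Scheme.{u}} {j : Y ⟶ X} {A B : Y.Opens} {σ : Type} {t : σ → Γ(Y, A ⊓ B)ˣ}
  (C : SplitConormal j t)

lemma symm_smul (U : X.Opens) (r : Γ(X, U)) (v : ∀ s, gluedSections (t s) (j ⁻¹ᵁ U)) :
    r * ((C.equiv U).symm v).1 =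
      ((C.equiv U).symm fun s ↦ (j.app U r : Γ(Y, j ⁻¹ᵁ U)) • v s).1 := by
  have h : r • (C.equiv U).symm v = (C.equiv U).symm
      fun s ↦ (j.app U r : Γ(Y, j ⁻¹ᵁ U)) • v s := by
    refine (C.equiv U).injective (funext fun s ↦ ?_)
    rw [C.map_smul, AddEquiv.apply_symm_apply, AddEquiv.apply_symm_apply]
  exact congrArg Subtype.val h

lemma res_mem_ker {U V : X.Opens} (h : V ≤ U) (x : RingHom.ker (j.app U).hom) :
    res h x.1 ∈ RingHom.ker (j.app V).hom := by
  rw [RingHom.mem_ker]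
  refine (app_res j h x.1).trans ?_
  rw [show j.app U x.1 = 0 from x.2, map_zero]

lemma res_symm {U V : X.Opens} (h : V ≤ U) (v : ∀ s, gluedSections (t s) (j ⁻¹ᵁ U)) :
    res h ((C.equiv U).symm v).1 =
      ((C.equiv V).symm fun s ↦ gluedRes (t s) (j.preimage_mono h) (v s)).1 := by
  have h1 : (⟨_, res_mem_ker h ((C.equiv U).symm v)⟩ : RingHom.ker (j.app V).hom) =
      (C.equiv V).symm fun s ↦ gluedRes (t s) (j.preimage_mono h) (v s) := by
    refine (C.equiv V).injective (funext fun s ↦ ?_)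
    rw [C.map_res h ((C.equiv U).symm v) _ rfl, AddEquiv.apply_symm_apply,
      AddEquiv.apply_symm_apply]
  exact congrArg Subtype.val h1

/-- The frame given by trivializations of the line bundles. -/
def frameOf (V : X.Opens)
    (g : ∀ (s : σ) (U : Y.Opens), U ≤ j ⁻¹ᵁ V → (Γ(Y, U) ≃+ gluedSections (t s) U))
    (hmul : ∀ s U hU r f, g s U hU (r * f) = r • g s U hU f)
    (hres : ∀ s U hU W (h : W ≤ U) f,
      gluedRes (t s) h (g s U hU f) = g s W (h.trans hU) (res h f)) : Frame j V σ where
  ι W hW :=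
    { toFun v := ((C.equiv W).symm fun s ↦ g s _ (j.preimage_mono hW) (v s)).1
      map_zero' := by
        have : (fun s ↦ g s _ (j.preimage_mono hW) ((0 : σ → Γ(Y, j ⁻¹ᵁ W)) s)) = 0 :=
          funext fun s ↦ map_zero _
        rw [this, map_zero]
        rfl
      map_add' v w := by
        have : (fun s ↦ g s _ (j.preimage_mono hW) ((v + w) s)) =
            (fun s ↦ g s _ (j.preimage_mono hW) (v s)) + fun s ↦ g s _ (j.preimage_mono hW) (w s) :=
          funext fun s ↦ map_add _ _ _
        rw [this, map_add]
        rfl }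
  injective W hW v w h := by
    have h1 := (C.equiv W).symm.injective (Subtype.ext h)
    exact funext fun s ↦ (g s _ _).injective (congrFun h1 s)
  app_eq_zero_iff W hW r := by
    constructor
    · intro h
      refine ⟨fun s ↦ (g s _ (j.preimage_mono hW)).symm (C.equiv W ⟨r, h⟩ s), ?_⟩
      change ((C.equiv W).symm fun s ↦ g s _ (j.preimage_mono hW) _).1 = r
      simp only [AddEquiv.apply_symm_apply]
      exact congrArg Subtype.val ((C.equiv W).symm_apply_apply ⟨r, h⟩)
    · rintro ⟨v, rfl⟩
      exact ((C.equiv W).symm _).2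
  mul_ι W hW r v := by
    change r * ((C.equiv W).symm _).1 = ((C.equiv W).symm _).1
    rw [C.symm_smul]
    simp only [hmul]
  res_ι hW h v := by
    change res h ((C.equiv _).symm _).1 = ((C.equiv _).symm _).1
    rw [C.res_symm]
    simp only [hres]

/-- The frame over open sets where the first trivializations are defined. -/
def frame₀ {V : X.Opens} (hV : j ⁻¹ᵁ V ≤ A) : Frame j V σ :=
  C.frameOf V (fun s _ hU ↦ gsec₀ (t s) (hU.trans hV)) (fun _ _ _ _ _ ↦ gsec₀_mul _ _ _ _)
    (fun _ _ _ _ _ _ ↦ gluedRes_gsec₀ _ _ _ _)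

/-- The frame over open sets where the second trivializations are defined. -/
def frame₁ {V : X.Opens} (hV : j ⁻¹ᵁ V ≤ B) : Frame j V σ :=
  C.frameOf V (fun s _ hU ↦ gsec₁ (t s) (hU.trans hV)) (fun _ _ _ _ _ ↦ gsec₁_mul _ _ _ _)
    (fun _ _ _ _ _ _ ↦ gluedRes_gsec₁ _ _ _ _)

lemma frame₁_ι {V₀ V₁ : X.Opens} (h₀ : j ⁻¹ᵁ V₀ ≤ A) (h₁ : j ⁻¹ᵁ V₁ ≤ B) {W : X.Opens}
    (hW₀ : W ≤ V₀) (hW₁ : W ≤ V₁) (v : σ → Γ(Y, j ⁻¹ᵁ W)) :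
    (C.frame₁ h₁).ι W hW₁ v = (C.frame₀ h₀).ι W hW₀ fun s ↦
      res (le_inf ((j.preimage_mono hW₀).trans h₀) ((j.preimage_mono hW₁).trans h₁)) (t s).1 *
        v s := by
  change ((C.equiv W).symm fun s ↦ gsec₁ _ _ _).1 = ((C.equiv W).symm fun s ↦ gsec₀ _ _ _).1
  simp only [gsec₁_eq_gsec₀ _ ((j.preimage_mono hW₀).trans h₀)]

end SplitConormal

/-- A conormal bundle which is a direct sum of two glued line bundles. -/
def ConormalIso.splitBiprod {Y X : Scheme.{u}} {j : Y ⟶ X} {A B : Y.Opens}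
    {t₁ t₂ : Γ(Y, A ⊓ B)ˣ} (C : ConormalIso j (glued t₁ ⊞ glued t₂)) :
    SplitConormal j ![t₁, t₂] where
  equiv U := (C.equiv U).trans
    { toFun x s := match s with
        | 0 => (biprod.fst : glued t₁ ⊞ glued t₂ ⟶ _).app (j ⁻¹ᵁ U) x
        | 1 => (biprod.snd : glued t₁ ⊞ glued t₂ ⟶ _).app (j ⁻¹ᵁ U) x
      invFun v := (biprod.inl : _ ⟶ glued t₁ ⊞ glued t₂).app (j ⁻¹ᵁ U) (v 0) +
        (biprod.inr : _ ⟶ glued t₁ ⊞ glued t₂).app (j ⁻¹ᵁ U) (v 1)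
      left_inv x := by
        have := congrArg (fun f : glued t₁ ⊞ glued t₂ ⟶ glued t₁ ⊞ glued t₂ ↦ f.app (j ⁻¹ᵁ U) x)
          (biprod.total (X := glued t₁) (Y := glued t₂))
        exact this
      right_inv v := by
        have a1 := congrArg (fun f ↦ f.app (j ⁻¹ᵁ U) (v 0))
          (biprod.inl_fst (X := glued t₁) (Y := glued t₂))
        have a2 := congrArg (fun f ↦ f.app (j ⁻¹ᵁ U) (v 1))
          (biprod.inr_fst (X := glued t₁) (Y := glued t₂))
        have a3 := congrArg (fun f ↦ f.app (j ⁻¹ᵁ U) (v 0))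
          (biprod.inl_snd (X := glued t₁) (Y := glued t₂))
        have a4 := congrArg (fun f ↦ f.app (j ⁻¹ᵁ U) (v 1))
          (biprod.inr_snd (X := glued t₁) (Y := glued t₂))
        ext1 s
        match s with
        | 0 =>
          refine (map_add _ _ _).trans ((congrArg₂ (· + ·) a1 a2).trans (add_zero _))
        | 1 =>
          refine (map_add _ _ _).trans ((congrArg₂ (· + ·) a3 a4).trans (zero_add _))
      map_add' x y := by
        ext1 s
        match s with
        | 0 => exact map_add _ _ _
        | 1 => exact map_add _ _ _ }
  map_smul U r x s := by
    match s with
    | 0 => exact (congrArg _ (C.map_smul U r x)).trans (Scheme.Modules.Hom.app_smul _ _ _)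
    | 1 => exact (congrArg _ (C.map_smul U r x)).trans (Scheme.Modules.Hom.app_smul _ _ _)
  map_res h x y hxy s := by
    match s with
    | 0 =>
      exact (congrArg _ (C.map_res h x y hxy)).trans
        (DFunLike.congr_fun (congrArg AddCommGrpCat.Hom.hom
          ((biprod.fst : glued t₁ ⊞ glued t₂ ⟶ _).mapPresheaf.naturality
          (homOfLE (j.preimage_mono h)).op)) _)
    | 1 =>
      exact (congrArg _ (C.map_res h x y hxy)).trans
        (DFunLike.congr_fun (congrArg AddCommGrpCat.Hom.hom
          ((biprod.snd : glued t₁ ⊞ glued t₂ ⟶ _).mapPresheaf.naturality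
          (homOfLE (j.preimage_mono h)).op)) _)

/-- A conormal bundle which is a glued line bundle. -/
def ConormalIso.split {Y X : Scheme.{u}} {j : Y ⟶ X} {A B : Y.Opens}
    {t : Γ(Y, A ⊓ B)ˣ} (C : ConormalIso j (glued t)) : SplitConormal j fun _ : Unit ↦ t where
  equiv U := (C.equiv U).trans
    { toFun x _ := x
      invFun v := v ()
      left_inv _ := rfl
      right_inv _ := rfl
      map_add' _ _ := rfl }
  map_smul U r x _ := C.map_smul U r x
  map_res h x y hxy _ := C.map_res h x y hxy

end SplitConormal

/-! ### The rings of functions on a rope over the two charts -/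

noncomputable section

/-- An ideal and its square have the same support. The square is zero, so the closed image of `j` is
everything. -/
lemma surjective_of_ker_sq {Y X : Scheme.{u}} (j : Y ⟶ X) [IsClosedImmersion j]
    (h : j.ker ^ 2 = ⊥) : Function.Surjective j := by
  have h1 : (j.ker ^ 2).support = j.ker.support := Scheme.IdealSheafData.support_pow _ 2 two_ne_zero
  rw [h, Scheme.IdealSheafData.support_bot] at h1
  have h2 := j.support_ker
  rw [← h1] at h2
  have h3 : closure (Set.range j) = Set.univ := h2.symm
  rw [j.isClosedEmbedding.isClosed_range.closure_eq] at h3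
  exact Set.range_eq_univ.mp h3

lemma exists_preimage_eq {Y X : Scheme.{u}} (j : Y ⟶ X) [IsClosedImmersion j] (U : Y.Opens) :
    ∃ V : X.Opens, j ⁻¹ᵁ V = U := by
  obtain ⟨V, hV, h⟩ := j.isClosedEmbedding.isInducing.isOpen_iff.mp U.2
  exact ⟨⟨V, hV⟩, Opens.ext h⟩

lemma IsRope.nonempty_splitConormal {k : Type u} [Field k] {a b : ℤ} {Yt : Over (Spec (.of k))}
    {j : projSpace k 1 ⟶ Yt} (hj : IsRope j (twist k (-a) ⊞ twist k (-b))) :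
    Nonempty (SplitConormal j.left fun s ↦ transition k ^ degs a b s) := by
  obtain ⟨C⟩ := hj.conormal
  have h : (fun s ↦ transition k ^ degs a b s) = ![transition k ^ (-a), transition k ^ (-b)] := by
    ext1 s
    fin_cases s <;> rfl
  rw [h]
  exact ⟨ConormalIso.splitBiprod C⟩

section Generic

variable {σ : Type}

lemma pull_surjective_of_eq {Y X : Scheme.{u}} {j : Y ⟶ X} {V : X.Opens} {U : Y.Opens}
    (e : j ⁻¹ᵁ V = U) (h : Function.Surjective (j.app V)) : Function.Surjective (pull j e.ge) := by
  subst e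
  intro s
  obtain ⟨r, hr⟩ := h s
  exact ⟨r, by rw [← hr, app_eq_pull]⟩

lemma pull_eq_zero_iff_of_eq {Y X : Scheme.{u}} {j : Y ⟶ X} {V : X.Opens} {U : Y.Opens}
    (e : j ⁻¹ᵁ V = U) (r : Γ(X, V)) : pull j e.ge r = 0 ↔ j.app V r = 0 := by
  subst e
  rw [app_eq_pull]

lemma res_pull_of_eq {Y X : Scheme.{u}} {j : Y ⟶ X} {V : X.Opens} {U : Y.Opens}
    (e : j ⁻¹ᵁ V = U) (r : Γ(X, V)) : res e.le (pull j e.ge r) = j.app V r := by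
  subst e
  rw [app_eq_pull, res_self]

lemma res_injective_of_eq {Y : Scheme.{u}} {V U : Y.Opens} (e : V = U) :
    Function.Injective (res e.le) := by
  subst e
  intro x y h
  rwa [res_self, res_self] at h

lemma res_ge_res_le {Y : Scheme.{u}} {V U : Y.Opens} (e : V = U) (x : Γ(Y, V)) :
    res e.le (res e.ge x) = x := by
  rw [res_res]
  exact res_self x

/-- The inclusion of the ideal, in terms of the frame `F`. -/
def frameι {Y X : Scheme.{u}} {j : Y ⟶ X} {V W : X.Opens} {U : Y.Opens}
    (F : Frame j V σ) (hW : W ≤ V) (e : j ⁻¹ᵁ W = U) {P : Type*} [CommRing P] (f : P ≃+* Γ(Y, U)) :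
    (σ → P) →+ Γ(X, W) :=
  (F.ι W hW).comp (((res e.le).comp f.toRingHom).toAddMonoidHom.compLeft σ)

lemma frameι_apply {Y X : Scheme.{u}} {j : Y ⟶ X} {V W : X.Opens} {U : Y.Opens}
    (F : Frame j V σ) (hW : W ≤ V) (e : j ⁻¹ᵁ W = U) {P : Type*} [CommRing P] (f : P ≃+* Γ(Y, U))
    (v : σ → P) : frameι F hW e f v = F.ι W hW fun s ↦ res e.le (f (v s)) := rfl

lemma frameι_injective {Y X : Scheme.{u}} {j : Y ⟶ X} {V W : X.Opens} {U : Y.Opens}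
    (F : Frame j V σ) (hW : W ≤ V) (e : j ⁻¹ᵁ W = U) {P : Type*} [CommRing P] (f : P ≃+* Γ(Y, U)) :
    Function.Injective (frameι F hW e f) := fun v w h ↦ by
  have h1 := F.injective W hW h
  exact funext fun s ↦ f.injective (res_injective_of_eq e (congrFun h1 s))

lemma eq_zero_iff_frameι {Y X : Scheme.{u}} {j : Y ⟶ X} {V W : X.Opens} {U : Y.Opens}
    (F : Frame j V σ) (hW : W ≤ V) (e : j ⁻¹ᵁ W = U) {P : Type*} [CommRing P] (f : P ≃+* Γ(Y, U))
    (r : Γ(X, W)) : f.symm (pull j e.ge r) = 0 ↔ ∃ v : σ → P, frameι F hW e f v = r := by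
  rw [map_eq_zero_iff _ f.symm.injective, pull_eq_zero_iff_of_eq e, F.app_eq_zero_iff W hW]
  constructor
  · rintro ⟨v, rfl⟩
    refine ⟨fun s ↦ f.symm (res e.ge (v s)), ?_⟩
    refine congrArg (F.ι W hW) (funext fun s ↦ ?_)
    change res _ (f (f.symm _)) = _
    rw [RingEquiv.apply_symm_apply]
    exact res_ge_res_le e _
  · rintro ⟨v, rfl⟩
    exact ⟨_, rfl⟩

lemma mul_frameι {Y X : Scheme.{u}} {j : Y ⟶ X} {V W : X.Opens} {U : Y.Opens}
    (F : Frame j V σ) (hW : W ≤ V) (e : j ⁻¹ᵁ W = U) {P : Type*} [CommRing P] (f : P ≃+* Γ(Y, U))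
    (r : Γ(X, W)) (v : σ → P) :
    r * frameι F hW e f v = frameι F hW e f (f.symm (pull j e.ge r) • v) := by
  rw [frameι_apply, F.mul_ι, frameι_apply]
  congr 1
  ext1 s
  rw [Pi.smul_apply, smul_eq_mul, map_mul, map_mul, RingEquiv.apply_symm_apply, res_pull_of_eq e]

end Generic

variable {k : Type u} [Field k] {Yt : Over (Spec (.of k))} {j : projSpace k 1 ⟶ Yt}

section Rings

lemma genericPoint_mem {U : (projSpace k 1).left.Opens}
    (hU : (U : Set (projSpace k 1).left).Nonempty) : genericPoint (projSpace k 1).left ∈ U :=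
  ((genericPoint_spec (projSpace k 1).left).mem_open_set_iff U.2).mpr (by simpa using hU)

lemma genericPoint_mem_preimage {V₀ : Yt.left.Opens} (e₀ : j.left ⁻¹ᵁ V₀ = chart k 1 0) :
    genericPoint (projSpace k 1).left ∈ j.left ⁻¹ᵁ V₀ := by
  rw [e₀]
  exact genericPoint_mem (overlap_nonempty.mono fun _ h ↦ h.1)

lemma genericPoint_mem_preimage' {V₁ : Yt.left.Opens} (e₁ : j.left ⁻¹ᵁ V₁ = chart k 1 1) :
    genericPoint (projSpace k 1).left ∈ j.left ⁻¹ᵁ V₁ := by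
  rw [e₁]
  exact genericPoint_mem (overlap_nonempty.mono fun _ h ↦ h.2)

lemma preimage_inf_eq_overlap {V₀ V₁ : Yt.left.Opens} (e₀ : j.left ⁻¹ᵁ V₀ = chart k 1 0)
    (e₁ : j.left ⁻¹ᵁ V₁ = chart k 1 1) : j.left ⁻¹ᵁ (V₀ ⊓ V₁) = overlap k := by
  rw [Scheme.Hom.preimage_inf, e₀, e₁]

variable {σ : Type} [Finite σ] {d : σ → ℤ}
  (C : SplitConormal j.left fun s ↦ transition k ^ d s)
  [IsClosedImmersion j.left] (hs : Function.Surjective j.left)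
  {V₀ V₁ : Yt.left.Opens} (e₀ : j.left ⁻¹ᵁ V₀ = chart k 1 0) (e₁ : j.left ⁻¹ᵁ V₁ = chart k 1 1)

/-- A chart of a rope on the projective line. -/
def thickLine {V : Yt.left.Opens} (F : Frame j.left V σ) {m : Fin 2}
    (e : j.left ⁻¹ᵁ V = chart k 1 m) (f : Polynomial k ≃+* Γ((projSpace k 1).left, chart k 1 m))
    (hf : ∀ c, f (.C c) = scal _ _ c) (h : Function.Surjective (j.left.app V)) :
    ThickLine k σ Γ(Yt.left, V) where
  c := scal Yt V
  π := f.symm.toRingHom.comp (pull j.left e.ge)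
  ι := frameι F le_rfl e f
  π_c a := by
    change f.symm (pull j.left e.ge _) = _
    rw [pull_scal, RingEquiv.symm_apply_eq, hf]
  π_surjective := f.symm.surjective.comp (pull_surjective_of_eq e h)
  ι_injective := frameι_injective F _ _ _
  π_eq_zero_iff := eq_zero_iff_frameι F _ _ _
  mul_ι := mul_frameι F _ _ _

/-- The rings of functions on a rope on the projective line. -/
def ropeRings : GluedRings k d Γ(Yt.left, V₀) Γ(Yt.left, V₁) Γ(Yt.left, V₀ ⊓ V₁) where
  A₀ := thickLine (C.frame₀ e₀.le) e₀ polyEquiv₀ (fun c ↦ polyChart_C 0 1 c)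
    ((C.frame₀ e₀.le).app_surjective hs (e₀ ▸ isAffineOpen_chart 0) (genericPoint_mem_preimage e₀))
  A₁ := thickLine (C.frame₁ e₁.le) e₁ polyEquiv₁ (fun c ↦ polyChart_C 1 0 c)
    ((C.frame₁ e₁.le).app_surjective hs (e₁ ▸ isAffineOpen_chart 1) (genericPoint_mem_preimage' e₁))
  ρ₀ := res inf_le_left
  ρ₁ := res inf_le_right
  π := laurentEquiv.symm.toRingHom.comp (pull j.left (preimage_inf_eq_overlap e₀ e₁).ge)
  ι := frameι (C.frame₀ e₀.le) inf_le_left (preimage_inf_eq_overlap e₀ e₁) laurentEquiv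
  π_ρ₀ r := by
    change laurentEquiv.symm (pull j.left _ (res _ r)) =
      Polynomial.toLaurent (polyEquiv₀.symm (pull j.left _ r))
    rw [RingEquiv.symm_apply_eq, laurentEquiv_toLaurent, RingEquiv.apply_symm_apply, pull_res,
      res_pull]
  π_ρ₁ r := by
    change laurentEquiv.symm (pull j.left _ (res _ r)) = LaurentPolynomial.invert
      (Polynomial.toLaurent (polyEquiv₁.symm (pull j.left _ r)))
    rw [RingEquiv.symm_apply_eq, laurentEquiv_invert, RingEquiv.apply_symm_apply, pull_res,
      res_pull]
  ι_injective := frameι_injective _ _ _ _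
  π_eq_zero_iff := eq_zero_iff_frameι _ _ _ _
  mul_ι := mul_frameι _ _ _ _
  ρ₀_ι v := by
    refine ((C.frame₀ e₀.le).res_ι le_rfl inf_le_left fun s ↦
      res e₀.le (polyEquiv₀ (v s))).trans ?_
    rw [frameι_apply]
    simp only [laurentEquiv_toLaurent, res_res]
  ρ₁_ι v := by
    refine ((C.frame₁ e₁.le).res_ι le_rfl inf_le_right fun s ↦
      res e₁.le (polyEquiv₁ (v s))).trans ?_
    rw [C.frame₁_ι e₀.le e₁.le inf_le_left inf_le_right, frameι_apply]
    simp only [map_mul, laurentEquiv_T, laurentEquiv_invert, res_res]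

end Rings

end

/-! ### A criterion for closed immersions -/

section ClosedImmersion

/-- A morphism with closed image which is a closed immersion over the members of an affine cover of
the image is a closed immersion. -/
lemma isClosedImmersion_of_sup_eq_top {X Z : Scheme.{u}} (f : X ⟶ Z) {Z₀ Z₁ : Z.Opens}
    (h₀ : IsAffineOpen Z₀) (h₁ : IsAffineOpen Z₁) (e₀ : IsAffineOpen (f ⁻¹ᵁ Z₀))
    (e₁ : IsAffineOpen (f ⁻¹ᵁ Z₁)) (hs₀ : Function.Surjective (f.app Z₀))
    (hs₁ : Function.Surjective (f.app Z₁)) (hcov : f ⁻¹ᵁ Z₀ ⊔ f ⁻¹ᵁ Z₁ = ⊤)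
    (hcl : IsClosed (Set.range f)) : IsClosedImmersion f := by
  let S := {U : Z.affineOpens // IsAffineOpen (f ⁻¹ᵁ U.1) ∧ Function.Surjective (f.app U.1)}
  have hS : ⨆ U : S, (U.1 : Z.Opens) = ⊤ := by
    refine top_unique fun z _ ↦ Opens.mem_iSup.mpr ?_
    by_cases hz : z ∈ Set.range f
    · obtain ⟨x, rfl⟩ := hz
      have hx : x ∈ f ⁻¹ᵁ Z₀ ⊔ f ⁻¹ᵁ Z₁ := by rw [hcov]; trivial
      rcases hx with hx | hx
      · exact ⟨⟨⟨Z₀, h₀⟩, e₀, hs₀⟩, hx⟩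
      · exact ⟨⟨⟨Z₁, h₁⟩, e₁, hs₁⟩, hx⟩
    -- Away from the closed image, affine open sets with empty preimage satisfy the conditions
    -- trivially.
    · obtain ⟨W, hW, hzW, hle⟩ := exists_isAffineOpen_mem_and_subset (U := ⟨_, hcl.isOpen_compl⟩) hz
      have h : f ⁻¹ᵁ W = ⊥ := bot_unique fun x hx ↦ hle hx ⟨x, rfl⟩
      refine ⟨⟨⟨W, hW⟩, ?_, ?_⟩, hzW⟩
      · change IsAffineOpen (f ⁻¹ᵁ W)
        rw [h]
        exact isAffineOpen_bot X
      · have : Subsingleton Γ(X, f ⁻¹ᵁ W) := by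
          rw [h]
          infer_instance
        exact fun s ↦ ⟨0, Subsingleton.elim _ _⟩
  refine (IsZariskiLocalAtTarget.iff_of_iSup_eq_top (P := @IsClosedImmersion)
    (fun U : S ↦ (U.1 : Z.Opens)) hS).mpr fun U ↦ ?_
  have : IsAffine (U.1 : Z.Opens).toScheme := U.1.2
  have : IsAffine (f ⁻¹ᵁ (U.1 : Z.Opens)).toScheme := U.2.1
  refine IsClosedImmersion.of_surjective_of_isAffine _ ?_
  have h (W : Z.Opens) (hW : W = U.1) : Function.Surjective (f.app W) := by
    rw [hW]
    exact U.2.2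
  have h' := (ConcreteCategory.bijective_of_isIso (X.presheaf.map (eqToHom
    (image_morphismRestrict_preimage f U.1 ⊤)).op)).2.comp (h _ (Scheme.Opens.ι_image_top _))
  rw [morphismRestrict_appTop]
  exact h'

end ClosedImmersion

/-! ### Extensions of the monomial curve and solutions of the relation -/

noncomputable section Extensions

/-- The embedding `[1 : x : ⋯ : x ^ N]` of the projective line. -/
structure IsMonomialCurve {k : Type u} [Field k] {N : ℕ} (i : projSpace k 1 ⟶ projSpace k N) :
    Prop where
  preimage₀ : i.left ⁻¹ᵁ chart k N 0 = chart k 1 0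
  preimage₁ : i.left ⁻¹ᵁ chart k N (Fin.last N) = chart k 1 1
  pull₀ (l : Fin (N + 1)) : pull i.left preimage₀.ge (aff k N 0 l) = aff k 1 0 1 ^ (l : ℕ)
  pull₁ (l : Fin (N + 1)) :
    pull i.left preimage₁.ge (aff k N (Fin.last N) l) = aff k 1 1 0 ^ (N - l : ℕ)

variable {k : Type u} [Field k] {Yt : Over (Spec (.of k))} {j : projSpace k 1 ⟶ Yt}

lemma range_le_of_aff_mem {n : ℕ} {m : Fin (n + 1)} {R : Type*} [CommRing R]
    (φ : Γ((projSpace k n).left, chart k n m) →+* R) (S : Subring R)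
    (h : ∀ l, φ (aff k n m l) ∈ S) (h' : ∀ c, φ (scal _ _ c) ∈ S) (s) : φ s ∈ S := by
  obtain ⟨d, p, rfl⟩ := exists_dehom_eq m s
  induction p.1 using MvPolynomial.induction_on with
  | C c => simpa [dehom] using h' c
  | add p q hp hq => rw [map_add, map_add]; exact add_mem hp hq
  | mul_X p l hp =>
    rw [map_mul, map_mul]
    refine mul_mem hp ?_
    have : dehom k n m (MvPolynomial.X l) = aff k n m l := dehom_coord m l
    rw [this]
    exact h l

/-- The affine coordinate of each chart of the line is itself pulled back, from the coordinate with
index `1` or `N - 1`, so pullback of functions is surjective on both charts. -/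
lemma IsMonomialCurve.isClosedImmersion {N : ℕ} (hN : 1 ≤ N) {i : projSpace k 1 ⟶ projSpace k N}
    (hi : IsMonomialCurve i) : IsClosedImmersion i.left := by
  have key {m : Fin (N + 1)} {U : (projSpace k 1).left.Opens} (e : i.left ⁻¹ᵁ chart k N m = U)
      (f : Polynomial k ≃+* Γ((projSpace k 1).left, U))
      (hf : ∀ c, f (.C c) = scal _ _ c) (l : Fin (N + 1))
      (hl : pull i.left e.ge (aff k N m l) = f .X) : Function.Surjective (i.left.app (chart k N m)) := by
    subst e
    intro s
    obtain ⟨p, rfl⟩ := f.surjective s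
    induction p using Polynomial.induction_on' with
    | add p q hp hq =>
      obtain ⟨r, hr⟩ := hp
      obtain ⟨r', hr'⟩ := hq
      exact ⟨r + r', by rw [map_add, map_add, hr, hr']⟩
    | monomial n c =>
      refine ⟨scal _ _ c * aff k N m l ^ n, ?_⟩
      rw [← Polynomial.C_mul_X_pow_eq_monomial, map_mul, map_mul, map_pow, map_pow, app_eq_pull,
        app_eq_pull, pull_scal, hl, hf]
  refine isClosedImmersion_of_sup_eq_top i.left (isAffineOpen_chart 0)
    (isAffineOpen_chart (Fin.last N)) ?_ ?_ ?_ ?_ ?_ (isClosed_range i)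
  · rw [hi.preimage₀]
    exact isAffineOpen_chart 0
  · rw [hi.preimage₁]
    exact isAffineOpen_chart 1
  · refine key hi.preimage₀ polyEquiv₀ (fun c ↦ polyChart_C 0 1 c) ⟨1, by omega⟩ ?_
    rw [hi.pull₀]
    exact (pow_one _).trans (polyChart_X 0 1).symm
  · refine key hi.preimage₁ polyEquiv₁ (fun c ↦ polyChart_C 1 0 c)
      ⟨N - 1, by omega⟩ ?_
    rw [hi.pull₁]
    simp only [show N - (N - 1) = 1 by omega, pow_one]
    exact (polyChart_X 1 0).symm
  · rw [hi.preimage₀, hi.preimage₁]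
    exact chart_zero_sup_chart_one

variable {σ : Type} [Finite σ] {d : σ → ℤ}
  (C : SplitConormal j.left fun s ↦ transition k ^ d s)
  [IsClosedImmersion j.left] (hs : Function.Surjective j.left)
  {V₀ V₁ : Yt.left.Opens} (e₀ : j.left ⁻¹ᵁ V₀ = chart k 1 0) (e₁ : j.left ⁻¹ᵁ V₁ = chart k 1 1)

include hs e₀ e₁ in
omit [IsClosedImmersion j.left] in
lemma sup_eq_top_of_preimage : V₀ ⊔ V₁ = ⊤ := by
  refine preimage_injective hs ?_
  rw [Scheme.Hom.preimage_sup, e₀, e₁]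
  exact chart_zero_sup_chart_one

lemma pull_eq_of_π_eq {x : Γ(Yt.left, V₀)} {p : Polynomial k}
    (h : (ropeRings C hs e₀ e₁).A₀.π x = p) : pull j.left e₀.ge x = polyEquiv₀ p := by
  rw [← h]
  exact (RingEquiv.apply_symm_apply _ _).symm

lemma pull_eq_of_π_eq' {y : Γ(Yt.left, V₁)} {p : Polynomial k}
    (h : (ropeRings C hs e₀ e₁).A₁.π y = p) : pull j.left e₁.ge y = polyEquiv₁ p := by
  rw [← h]
  exact (RingEquiv.apply_symm_apply _ _).symm

lemma π_eq_of_pull_eq {x : Γ(Yt.left, V₀)} {p : Polynomial k}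
    (h : pull j.left e₀.ge x = polyEquiv₀ p) : (ropeRings C hs e₀ e₁).A₀.π x = p :=
  (congrArg _ h).trans (RingEquiv.symm_apply_apply _ _)

lemma π_eq_of_pull_eq' {y : Γ(Yt.left, V₁)} {p : Polynomial k}
    (h : pull j.left e₁.ge y = polyEquiv₁ p) : (ropeRings C hs e₀ e₁).A₁.π y = p :=
  (congrArg _ h).trans (RingEquiv.symm_apply_apply _ _)

variable {x : Γ(Yt.left, V₀)} {y : Γ(Yt.left, V₁)} {N : ℕ} {ε : σ → LaurentPolynomial k}

/-- A solution of the compatibility relation defines an extension of the monomial curve. -/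
lemma exists_extension (hx : (ropeRings C hs e₀ e₁).A₀.π x = .X)
    (hy : (ropeRings C hs e₀ e₁).A₁.π y = .X)
    (hε : (ropeRings C hs e₀ e₁).ρ₀ x * (ropeRings C hs e₀ e₁).ρ₁ y =
      1 + (ropeRings C hs e₀ e₁).ι ε) {w₀ w₁ : ℕ → σ → Polynomial k}
    (hw : (ropeRings C hs e₀ e₁).Rel N ε w₀ w₁) {i : projSpace k 1 ⟶ projSpace k N}
    (hi : IsMonomialCurve i) :
    ∃ i' : Yt ⟶ projSpace k N, j ≫ i' = i ∧ ∃ (h₀ : V₀ ≤ i'.left ⁻¹ᵁ chart k N 0)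
      (h₁ : V₁ ≤ i'.left ⁻¹ᵁ chart k N (Fin.last N)),
      (∀ l, pull i'.left h₀ (aff k N 0 l) = (ropeRings C hs e₀ e₁).A₀.seq x w₀ l) ∧
      ∀ l, pull i'.left h₁ (aff k N (Fin.last N) l) =
        (ropeRings C hs e₀ e₁).A₁.seq y w₁ (N - l) := by
  set A := ropeRings C hs e₀ e₁ with hA
  obtain ⟨i', h₀, h₁, H₀, H₁⟩ := exists_hom_projSpace (n := N) (p := 0) (q := Fin.last N)
    (sup_eq_top_of_preimage hs e₀ e₁) (fun l ↦ A.A₀.seq x w₀ l) (fun l ↦ A.A₁.seq y w₁ (N - l)) rfl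
    (by simp [ThickLine.seq]) (fun l ↦ hw.ρ₀_seq A hε hx hy (by omega))
  refine ⟨i', ?_, h₀, h₁, H₀, H₁⟩
  have g₀ : chart k 1 0 ≤ (j ≫ i').left ⁻¹ᵁ chart k N 0 := e₀.ge.trans (j.left.preimage_mono h₀)
  have g₁ : chart k 1 1 ≤ (j ≫ i').left ⁻¹ᵁ chart k N (Fin.last N) :=
    e₁.ge.trans (j.left.preimage_mono h₁)
  refine hom_projSpace_ext fun z ↦ ?_
  have hz : z ∈ chart k 1 0 ⊔ chart k 1 1 := by rw [chart_zero_sup_chart_one]; trivial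
  rcases hz with hz | hz
  · refine ⟨_, 0, g₀, hi.preimage₀.ge, hz, fun l ↦ ?_⟩
    rw [hi.pull₀]
    refine (pull_pull j.left i'.left h₀ e₀.ge _).symm.trans ?_
    rw [H₀, pull_eq_of_π_eq C hs e₀ e₁ (A.A₀.π_seq hx w₀ l), map_pow]
    exact congrArg (· ^ (l : ℕ)) (polyChart_X 0 1)
  · refine ⟨_, Fin.last N, g₁, hi.preimage₁.ge, hz, fun l ↦ ?_⟩
    rw [hi.pull₁]
    refine (pull_pull j.left i'.left h₁ e₁.ge _).symm.trans ?_
    rw [H₁, pull_eq_of_π_eq' C hs e₀ e₁ (A.A₁.π_seq hy w₁ _), map_pow]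
    exact congrArg (· ^ (N - l : ℕ)) (polyChart_X 1 0)

include hs in
omit [IsClosedImmersion j.left] in
lemma preimage_eq_of_extension {i : projSpace k 1 ⟶ projSpace k N} {i' : Yt ⟶ projSpace k N}
    (h : j ≫ i' = i) {m : Fin (N + 1)} {m' : Fin 2} {V : Yt.left.Opens}
    (e : j.left ⁻¹ᵁ V = chart k 1 m') (hi : i.left ⁻¹ᵁ chart k N m = chart k 1 m') :
    i'.left ⁻¹ᵁ chart k N m = V := by
  subst h
  exact preimage_injective hs (hi.trans e.symm)

/-- The coordinates of an extension of the monomial curve solve the compatibility relation. -/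
lemma exists_rel_of_extension (hx : (ropeRings C hs e₀ e₁).A₀.π x = .X)
    (hy : (ropeRings C hs e₀ e₁).A₁.π y = .X)
    (hε : (ropeRings C hs e₀ e₁).ρ₀ x * (ropeRings C hs e₀ e₁).ρ₁ y =
      1 + (ropeRings C hs e₀ e₁).ι ε) {i : projSpace k 1 ⟶ projSpace k N}
    (hi : IsMonomialCurve i) {i' : Yt ⟶ projSpace k N} (hii : j ≫ i' = i)
    (h₀ : V₀ ≤ i'.left ⁻¹ᵁ chart k N 0) (h₁ : V₁ ≤ i'.left ⁻¹ᵁ chart k N (Fin.last N)) :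
    ∃ w₀ w₁, (ropeRings C hs e₀ e₁).Rel N ε w₀ w₁ ∧
      (∀ l, pull i'.left h₀ (aff k N 0 l) = (ropeRings C hs e₀ e₁).A₀.seq x w₀ l) ∧
      ∀ l, pull i'.left h₁ (aff k N (Fin.last N) l) =
        (ropeRings C hs e₀ e₁).A₁.seq y w₁ (N - l) := by
  subst hii
  -- `Fin.ofNat` reduces modulo `N + 1`; only the indices up to `N` are used.
  let F (l : ℕ) := pull i'.left h₀ (aff k N 0 (Fin.ofNat (N + 1) l))
  let G (l : ℕ) := pull i'.left h₁ (aff k N (Fin.last N) (Fin.ofNat (N + 1) (N - l)))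
  have hval {l : ℕ} (hl : l ≤ N) : (Fin.ofNat (N + 1) l : ℕ) = l :=
    Nat.mod_eq_of_lt (by omega)
  obtain ⟨w₀, w₁, hw, H₀, H₁⟩ := (ropeRings C hs e₀ e₁).exists_rel hε hx hy (N := N) (F := F)
    (G := G) (fun l hl ↦ π_eq_of_pull_eq C hs e₀ e₁ (by
      refine (pull_pull j.left i'.left h₀ e₀.ge _).trans ((hi.pull₀ _).trans ?_)
      rw [hval hl, map_pow]
      exact congrArg (· ^ l) (polyChart_X 0 1).symm))
    (fun l hl ↦ π_eq_of_pull_eq' C hs e₀ e₁ (by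
      refine (pull_pull j.left i'.left h₁ e₁.ge _).trans ((hi.pull₁ _).trans ?_)
      rw [hval (by omega), map_pow, show N - (N - l) = l by omega]
      exact congrArg (· ^ l) (polyChart_X 1 0).symm))
    (by
      change pull i'.left h₀ (aff k N 0 0) = 1
      rw [aff_self, map_one])
    (by
      change pull i'.left h₁ (aff k N (Fin.last N) (Fin.ofNat (N + 1) (N - 0))) = 1
      rw [show Fin.ofNat (N + 1) (N - 0) = Fin.last N from Fin.ext (hval (by omega)), aff_self,
        map_one])
    (fun l hl ↦ by
      change res inf_le_left (pull _ _ _) = res inf_le_left (pull _ _ _) *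
        res inf_le_right (pull _ _ _)
      rw [res_pull, res_pull, res_pull, show N - (N - l) = l by omega,
        show Fin.ofNat (N + 1) N = Fin.last N from Fin.ext (hval le_rfl), pull_aff_mul_pull_aff])
  refine ⟨w₀, w₁, hw, fun l ↦ ?_, fun l ↦ ?_⟩
  · rw [← H₀ l (by omega)]
    simp only [F, show Fin.ofNat (N + 1) l = l from Fin.ext (hval (by omega))]
  · rw [← H₁ (N - l) (by omega)]
    simp only [G, show N - (N - (l : ℕ)) = l by omega,
      show Fin.ofNat (N + 1) l = l from Fin.ext (hval (by omega))]

end Extensions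

/-! ### Homomorphisms from an ideal sheaf to a glued line bundle -/

section BasicOpen

variable {X : Scheme.{u}} {U W : X.Opens}

lemma exists_pow_mul_eq_zero (hU : IsAffineOpen U) (h : Γ(X, U)) (hW : W = X.basicOpen h)
    (hWU : W ≤ U) {s : Γ(X, U)} (hs : res hWU s = 0) : ∃ n : ℕ, h ^ n * s = 0 := by
  have h1 := hU.isLocalization_of_eq_basicOpen h (homOfLE hWU) hW
  algebraize [res hWU]
  have h2 : IsLocalization.Away h Γ(X, W) := h1
  obtain ⟨⟨_, n, rfl⟩, hn⟩ := (IsLocalization.map_eq_zero_iff (Submonoid.powers h) Γ(X, W) s).mp hs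
  exact ⟨n, hn⟩

lemma isUnit_res_of_eq_basicOpen (h : Γ(X, U)) (hW : W = X.basicOpen h) (hWU : W ≤ U) :
    IsUnit (res hWU h) := by
  subst hW
  exact X.toRingedSpace.isUnit_res_basicOpen h

end BasicOpen

section Separated

variable {X : Scheme.{u}} {ι : Type u} {U : ι → X.Opens} {V : X.Opens}

lemma eq_of_res_eq (hUV : ∀ i, U i ≤ V) (hV : V ≤ iSup U) {s s' : Γ(X, V)}
    (h : ∀ i, res (hUV i) s = res (hUV i) s') : s = s' :=
  (res_existsUnique U V hUV hV (fun i ↦ res (hUV i) s) fun i i' ↦ by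
    rw [res_res, res_res]).unique (fun _ ↦ rfl) fun i ↦ (h i).symm

lemma gluedRes_gluedRes {A B : X.Opens} {t : Γ(X, A ⊓ B)ˣ} {U V W : X.Opens} (h : V ≤ U)
    (h' : W ≤ V) (s : gluedSections t U) :
    gluedRes t h' (gluedRes t h s) = gluedRes t (h'.trans h) s :=
  Subtype.ext (Prod.ext (res_res _ _ _) (res_res _ _ _))

lemma eq_of_gluedRes_eq {A B : X.Opens} {t : Γ(X, A ⊓ B)ˣ} (hUV : ∀ i, U i ≤ V)
    (hV : V ≤ iSup U) {s s' : gluedSections t V}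
    (h : ∀ i, gluedRes t (hUV i) s = gluedRes t (hUV i) s') : s = s' := by
  have key (C : X.Opens) : V ⊓ C ≤ ⨆ i, U i ⊓ C :=
    (inf_le_inf_right C hV).trans (iSup_inf_eq _ _).le
  exact Subtype.ext (Prod.ext
    (eq_of_res_eq (fun i ↦ inf_le_inf_right A (hUV i)) (key A) fun i ↦ congrArg (·.1.1) (h i))
    (eq_of_res_eq (fun i ↦ inf_le_inf_right B (hUV i)) (key B) fun i ↦ congrArg (·.1.2) (h i)))

end Separated

/-- A homomorphism from the ideal sheaf of `Y` in `X` to a glued line bundle. -/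
structure ConormalHom {Y X : Scheme.{u}} (j : Y ⟶ X) {A B : Y.Opens} (t : Γ(Y, A ⊓ B)ˣ) where
  /-- The homomorphism on sections over `U`. -/
  hom (U : X.Opens) : RingHom.ker (j.app U).hom →+ gluedSections t (j ⁻¹ᵁ U)
  map_smul (U : X.Opens) (r : Γ(X, U)) (x : RingHom.ker (j.app U).hom) :
    hom U (r • x) = (j.app U r : Γ(Y, j ⁻¹ᵁ U)) • hom U x
  map_res {U V : X.Opens} (h : V ≤ U) (x : RingHom.ker (j.app U).hom)
    (y : RingHom.ker (j.app V).hom) (hxy : y.1 = res h x.1) :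
    hom V y = gluedRes t (j.preimage_mono h) (hom U x)

namespace ConormalHom

variable {Y X : Scheme.{u}} {j : Y ⟶ X} {A B : Y.Opens} {t : Γ(Y, A ⊓ B)ˣ} (H : ConormalHom j t)

/-- Restriction of sections of the ideal sheaf. -/
abbrev resKer (j : Y ⟶ X) {U V : X.Opens} (h : V ≤ U) (x : RingHom.ker (j.app U).hom) :
    RingHom.ker (j.app V).hom := ⟨res h x.1, SplitConormal.res_mem_ker h x⟩

lemma hom_resKer {U V : X.Opens} (h : V ≤ U) (x : RingHom.ker (j.app U).hom) :
    H.hom V (resKer j h x) = gluedRes t (j.preimage_mono h) (H.hom U x) := H.map_res h x _ rfl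

/-- Bijectivity over an affine open set implies bijectivity over its basic open sets. -/
lemma bijective_basicOpen {V : X.Opens} (hV : IsAffineOpen V) (hV' : IsAffineOpen (j ⁻¹ᵁ V))
    (g : ∀ (U : Y.Opens), U ≤ j ⁻¹ᵁ V → (Γ(Y, U) ≃+ gluedSections t U))
    (hmul : ∀ U hU r f, g U hU (r * f) = r • g U hU f)
    (hres : ∀ U hU W (h : W ≤ U) f, gluedRes t h (g U hU f) = g W (h.trans hU) (res h f))
    (hb : Function.Bijective (H.hom V)) (r : Γ(X, V)) :
    Function.Bijective (H.hom (X.basicOpen r)) := by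
  obtain ⟨W, hW⟩ : ∃ W, W = X.basicOpen r := ⟨_, rfl⟩
  have hWV : W ≤ V := hW ▸ X.basicOpen_le r
  have hW' : j ⁻¹ᵁ W = Y.basicOpen (j.app V r) := by rw [hW, Scheme.preimage_basicOpen]
  have hjWV : j ⁻¹ᵁ W ≤ j ⁻¹ᵁ V := j.preimage_mono hWV
  have hu := isUnit_res_of_eq_basicOpen r hW hWV
  rw [← hW]
  constructor
  · rw [injective_iff_map_eq_zero]
    intro x hx
    -- Up to a power of `r`, the section `x` extends to `V`. The extension may leave the ideal, but
    -- its restriction to `Y` vanishes on the smaller set, so a further power of `r` brings it back.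
    obtain ⟨n, x₁, h1⟩ := exists_pow_mul_eq_res hV r hW hWV x.1
    obtain ⟨m, h2⟩ := exists_pow_mul_eq_zero hV' (j.app V r) hW' hjWV (s := j.app V x₁) (by
      rw [← app_res j hWV, ← h1, map_mul, show j.app W x.1 = 0 from x.2, mul_zero])
    let z : RingHom.ker (j.app V).hom := ⟨r ^ m * x₁, by
      rw [RingHom.mem_ker]
      refine (map_mul (j.app V).hom _ _).trans ?_
      rw [map_pow]
      exact h2⟩
    have h3 : resKer j hWV z = (res hWV r ^ (m + n)) • x := by
      refine Subtype.ext ?_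
      change res hWV (r ^ m * x₁) = res hWV r ^ (m + n) * x.1
      rw [map_mul, map_pow, ← h1, pow_add, mul_assoc]
    have h4 := H.hom_resKer hWV z
    rw [h3, H.map_smul, hx, smul_zero] at h4
    obtain ⟨f, hf⟩ := (g _ le_rfl).surjective (H.hom V z)
    rw [← hf, hres] at h4
    have h5 : res hjWV f = 0 := (g _ hjWV).injective (h4.symm.trans (map_zero _).symm)
    obtain ⟨l, h6⟩ := exists_pow_mul_eq_zero hV' (j.app V r) hW' hjWV h5
    have h7 : r ^ l • z = 0 := by
      refine hb.1 ?_
      rw [H.map_smul, ← hf, ← hmul, map_pow, h6, map_zero, map_zero]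
    have h8 := congrArg (fun s ↦ res hWV (Subtype.val s)) h7
    change res hWV (r ^ l * (r ^ m * x₁)) = res hWV 0 at h8
    rw [map_zero, map_mul, map_mul, map_pow, map_pow, ← h1, ← mul_assoc, ← mul_assoc,
      ← pow_add, ← pow_add, (hu.pow _).mul_right_eq_zero] at h8
    exact Subtype.ext h8
  · intro s
    obtain ⟨f, rfl⟩ := (g _ hjWV).surjective s
    obtain ⟨n, f₁, h1⟩ := exists_pow_mul_eq_res hV' (j.app V r) hW' hjWV f
    obtain ⟨z, hz⟩ := hb.2 (g _ le_rfl f₁)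
    obtain ⟨v, hv⟩ := (hu.pow n).exists_left_inv
    refine ⟨v • resKer j hWV z, ?_⟩
    rw [H.map_smul, hom_resKer, hz, hres, ← hmul, ← h1, ← app_res j hWV, ← mul_assoc, ← map_pow,
      ← map_mul, hv, map_one, one_mul]

/-- Injectivity is established on all open sets first; it makes the local preimages agree on
overlaps, so that they glue. -/
lemma bijective_of_isBasis
    (hB : ∀ (U : X.Opens), ∀ x ∈ U, ∃ W ≤ U, x ∈ W ∧ Function.Bijective (H.hom W)) (U : X.Opens) :
    Function.Bijective (H.hom U) := by
  have hinj (U : X.Opens) : Function.Injective (H.hom U) := by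
    rw [injective_iff_map_eq_zero]
    intro x hx
    let S := {W : X.Opens // W ≤ U ∧ Function.Bijective (H.hom W)}
    have hS : U ≤ ⨆ W : S, W.1 := fun y hy ↦ by
      obtain ⟨W, hW, hy, hb⟩ := hB U y hy
      exact Opens.mem_iSup.mpr ⟨⟨W, hW, hb⟩, hy⟩
    refine Subtype.ext (eq_of_res_eq (fun W : S ↦ W.2.1) hS fun W ↦ ?_)
    have h1 : resKer j W.2.1 x = 0 := by
      have h2 := (H.hom_resKer W.2.1 x).trans (congrArg (gluedRes t _) hx)
      exact W.2.2.1 (h2.trans ((map_zero _).trans (map_zero _).symm))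
    exact (congrArg Subtype.val h1).trans (map_zero (res W.2.1)).symm
  refine ⟨hinj U, fun s ↦ ?_⟩
  let S := {W : X.Opens // W ≤ U ∧ Function.Bijective (H.hom W)}
  have hS : U ≤ ⨆ W : S, W.1 := fun y hy ↦ by
    obtain ⟨W, hW, hy, hb⟩ := hB U y hy
    exact Opens.mem_iSup.mpr ⟨⟨W, hW, hb⟩, hy⟩
  choose z hz using fun W : S ↦ W.2.2.2 (gluedRes t (j.preimage_mono W.2.1) s)
  obtain ⟨x, hx, -⟩ := res_existsUnique (fun W : S ↦ W.1) U (fun W ↦ W.2.1) hS (fun W ↦ (z W).1)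
    fun W W' ↦ by
      have h1 : resKer j (inf_le_left : W.1 ⊓ W'.1 ≤ W.1) (z W) = resKer j inf_le_right (z W') := by
        have h2 (W : S) {W' : X.Opens} (h : W' ≤ W.1) : H.hom W' (resKer j h (z W)) =
            gluedRes t (j.preimage_mono (h.trans W.2.1)) s :=
          (H.hom_resKer h (z W)).trans ((congrArg (gluedRes t _) (hz W)).trans
            (gluedRes_gluedRes _ _ _))
        exact hinj _ ((h2 W inf_le_left).trans (h2 W' inf_le_right).symm)
      exact congrArg Subtype.val h1
  have hS' : j ⁻¹ᵁ U ≤ ⨆ W : S, j ⁻¹ᵁ W.1 := fun y hy ↦ by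
    obtain ⟨W, hW⟩ := Opens.mem_iSup.mp (hS (show j y ∈ U from hy))
    exact Opens.mem_iSup.mpr ⟨W, hW⟩
  have hxk : x ∈ RingHom.ker (j.app U).hom := by
    rw [RingHom.mem_ker]
    refine eq_of_res_eq (fun W : S ↦ j.preimage_mono W.2.1) hS' fun W ↦ ?_
    refine (app_res j W.2.1 x).symm.trans ((congrArg (j.app W.1).hom (hx W)).trans ?_)
    exact ((z W).2 : j.app W.1 (z W).1 = 0).trans (map_zero (res (j.preimage_mono W.2.1))).symm
  refine ⟨⟨x, hxk⟩, ?_⟩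
  refine eq_of_gluedRes_eq (fun W : S ↦ j.preimage_mono W.2.1) hS' fun W ↦ ?_
  have h1 : resKer j W.2.1 ⟨x, hxk⟩ = z W := Subtype.ext (hx W)
  have h2 := (H.hom_resKer W.2.1 ⟨x, hxk⟩).symm.trans ((congrArg (H.hom W.1) h1).trans (hz W))
  exact h2

/-- A homomorphism which is bijective over two affine open sets covering `X` is an isomorphism. -/
lemma bijective_of_sup_eq_top {V₀ V₁ : X.Opens} (hcov : V₀ ⊔ V₁ = ⊤) (h₀ : IsAffineOpen V₀)
    (h₁ : IsAffineOpen V₁) (h₀' : IsAffineOpen (j ⁻¹ᵁ V₀)) (h₁' : IsAffineOpen (j ⁻¹ᵁ V₁))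
    (hA : j ⁻¹ᵁ V₀ ≤ A) (hB : j ⁻¹ᵁ V₁ ≤ B) (hb₀ : Function.Bijective (H.hom V₀))
    (hb₁ : Function.Bijective (H.hom V₁)) (U : X.Opens) : Function.Bijective (H.hom U) := by
  refine H.bijective_of_isBasis (fun U x hx ↦ ?_) U
  have hx' : x ∈ V₀ ⊔ V₁ := by rw [hcov]; trivial
  rcases hx' with hx' | hx'
  · obtain ⟨r, h1, h2⟩ := h₀.exists_basicOpen_le (V := U) ⟨x, hx⟩ hx'
    exact ⟨_, h1, h2, H.bijective_basicOpen h₀ h₀' (fun _ hU ↦ gsec₀ t (hU.trans hA))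
      (fun _ _ ↦ gsec₀_mul _ _) (fun _ _ _ _ _ ↦ gluedRes_gsec₀ _ _ _ _) hb₀ r⟩
  · obtain ⟨r, h1, h2⟩ := h₁.exists_basicOpen_le (V := U) ⟨x, hx⟩ hx'
    exact ⟨_, h1, h2, H.bijective_basicOpen h₁ h₁' (fun _ hU ↦ gsec₁ t (hU.trans hB))
      (fun _ _ ↦ gsec₁_mul _ _) (fun _ _ _ _ _ ↦ gluedRes_gsec₁ _ _ _ _) hb₁ r⟩

/-- A bijective homomorphism identifies the conormal bundle. -/
noncomputable def toConormalIso (hb : ∀ U, Function.Bijective (H.hom U)) :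
    ConormalIso j (glued t) where
  equiv U := AddEquiv.ofBijective (H.hom U) (hb U)
  map_smul := H.map_smul
  map_res := H.map_res

end ConormalHom

/-! ### Glued sheaves are line bundles -/

noncomputable section LineBundle

variable {X : Scheme.{u}} {A B : X.Opens} (t : Γ(X, A ⊓ B)ˣ)

/-- A family of trivializations over the open subsets of `V` is an isomorphism with the structure
sheaf of `V`. -/
lemma nonempty_restrict_glued_iso (V : X.Opens)
    (g : ∀ (U : X.Opens), U ≤ V → (Γ(X, U) ≃+ gluedSections t U))
    (hmul : ∀ U hU r f, g U hU (r * f) = r • g U hU f)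
    (hres : ∀ U hU W (h : W ≤ U) f, gluedRes t h (g U hU f) = g W (h.trans hU) (res h f)) :
    Nonempty ((glued t).restrict V.ι ≅
      (SheafOfModules.unit V.toScheme.ringCatSheaf : V.toScheme.Modules)) := by
  have hV (W : V.toScheme.Opens) : V.ι ''ᵁ W ≤ V := V.ι_image_le W
  let φ : (SheafOfModules.unit V.toScheme.ringCatSheaf : V.toScheme.Modules) ⟶
      (glued t).restrict V.ι :=
    ⟨PresheafOfModules.homMk
      { app W := AddCommGrpCat.ofHom (g (V.ι ''ᵁ W.unop) (hV W.unop)).toAddMonoidHom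
        naturality W W' f := by
          refine AddCommGrpCat.hom_ext (AddMonoidHom.ext fun s ↦ ?_)
          exact (hres _ (hV W.unop) _ (Set.image_mono (leOfHom f.unop)) s).symm }
      (fun W r m ↦ by
        have h : (V.ι.appIso W.unop).inv r = r := by
          rw [Scheme.Opens.ι_appIso]
          rfl
        refine (hmul _ (hV W.unop) r m).trans ?_
        exact congrArg (fun r : Γ(X, V.ι ''ᵁ W.unop) ↦ r • g _ (hV W.unop) m) h.symm)⟩
  have hφ : IsIso φ := by
    refine Scheme.Modules.Hom.isIso_iff_isIso_app.mpr fun W ↦ ?_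
    exact (ConcreteCategory.isIso_iff_bijective (Scheme.Modules.Hom.app φ W)).mpr
      (g (V.ι ''ᵁ W) (hV W)).bijective
  exact ⟨(asIso φ).symm⟩

lemma isLineBundle_glued (hAB : A ⊔ B = ⊤) : IsLineBundle (glued t) := by
  intro y
  have hy : y ∈ A ⊔ B := by rw [hAB]; trivial
  rcases hy with hy | hy
  · exact ⟨A, hy, nonempty_restrict_glued_iso t A (fun _ hU ↦ gsec₀ t hU)
      (fun _ _ ↦ gsec₀_mul _ _) (fun _ _ _ _ _ ↦ gluedRes_gsec₀ _ _ _ _)⟩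
  · exact ⟨B, hy, nonempty_restrict_glued_iso t B (fun _ hU ↦ gsec₁ t hU)
      (fun _ _ ↦ gsec₁_mul _ _) (fun _ _ _ _ _ ↦ gluedRes_gsec₁ _ _ _ _)⟩

end LineBundle

/-! ### Scheme-theoretic images -/

section QuasiCompact

lemma quasiCompact_of_comp {X Y Z : Scheme.{u}} (f : X ⟶ Y) (g : Y ⟶ Z)
    (hf : Function.Surjective f) [QuasiCompact (f ≫ g)] : QuasiCompact g := by
  refine ⟨fun U hU hUc ↦ ?_⟩
  have h := (QuasiCompact.isCompact_preimage (f := f ≫ g) U hU hUc).image f.continuous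
  have h1 : f '' ((f ≫ g) ⁻¹' U) = g ⁻¹' U := by
    rw [Scheme.Hom.comp_base, TopCat.coe_comp, Set.preimage_comp, Set.image_preimage_eq _ hf]
  rwa [h1] at h

lemma toImage_app_injective {X Y : Scheme.{u}} (f : X ⟶ Y) [QuasiCompact f] (U : f.image.Opens) :
    Function.Injective (f.toImage.app U) := by
  exact TopCat.Presheaf.app_injective_of_stalkFunctor_map_injective (F := f.image.sheaf)
    f.toImage.c U fun x _ ↦ f.stalkFunctor_toImage_injective x

instance {X Y : Scheme.{u}} (f : X ⟶ Y) [QuasiCompact f] :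
    IsSchemeTheoreticallyDominant f.toImage := by
  refine ⟨?_⟩
  ext U : 2
  rw [Scheme.Hom.ker_apply, (RingHom.injective_iff_ker_eq_bot _).mp (toImage_app_injective f U)]
  rfl

end QuasiCompact

/-! ### Ribbons as quotients of a rope -/

noncomputable section Ribbon

section Hom

variable {Y X Z : Scheme.{u}} {j : Y ⟶ X} {A B : Y.Opens} {σ : Type} {t : σ → Γ(Y, A ⊓ B)ˣ}
  (C : SplitConormal j t) (p : X ⟶ Z)

lemma app_mem_ker {U : Z.Opens} (x : RingHom.ker ((j ≫ p).app U).hom) :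
    p.app U x.1 ∈ RingHom.ker (j.app (p ⁻¹ᵁ U)).hom := by
  exact (DFunLike.congr_fun (congrArg CommRingCat.Hom.hom (Scheme.Hom.comp_app j p U)) x.1).symm.trans
    (show (j ≫ p).app U x.1 = 0 from x.2)

/-- A component of the image in the ideal sheaf of a rope. -/
def SplitConormal.compHom (s : σ) : ConormalHom (j ≫ p) (t s) where
  hom U :=
    { toFun x := C.equiv (p ⁻¹ᵁ U) ⟨p.app U x.1, app_mem_ker p x⟩ s
      map_zero' := by
        have h : (⟨p.app U (0 : RingHom.ker ((j ≫ p).app U).hom).1, app_mem_ker p 0⟩ :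
          RingHom.ker (j.app (p ⁻¹ᵁ U)).hom) = 0 := Subtype.ext (map_zero (p.app U).hom)
        rw [h, map_zero]
        rfl
      map_add' x y := by
        have h : (⟨p.app U (x + y).1, app_mem_ker p (x + y)⟩ :
          RingHom.ker (j.app (p ⁻¹ᵁ U)).hom) =
          ⟨p.app U x.1, app_mem_ker p x⟩ + ⟨p.app U y.1, app_mem_ker p y⟩ :=
            Subtype.ext (map_add (p.app U).hom x.1 y.1)
        rw [h, map_add]
        rfl }
  map_smul U r x := by
    have h : (⟨p.app U (r • x).1, app_mem_ker p (r • x)⟩ :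
      RingHom.ker (j.app (p ⁻¹ᵁ U)).hom) = p.app U r • ⟨p.app U x.1, app_mem_ker p x⟩ :=
        Subtype.ext (map_mul (p.app U).hom r x.1)
    have h' := congrFun (congrArg (C.equiv (p ⁻¹ᵁ U)) h) s
    exact h'.trans (C.map_smul _ _ _ _)
  map_res {U V} h x y hxy := by
    refine C.map_res (p.preimage_mono h) _ _ ?_ s
    change p.app V y.1 = res _ (p.app U x.1)
    rw [hxy]
    exact app_res p h x.1

lemma SplitConormal.equiv_frameOf (V : X.Opens)
    (g : ∀ (s : σ) (U : Y.Opens), U ≤ j ⁻¹ᵁ V → (Γ(Y, U) ≃+ gluedSections (t s) U))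
    (hmul : ∀ s U hU r f, g s U hU (r * f) = r • g s U hU f)
    (hres : ∀ s U hU W (h : W ≤ U) f,
      gluedRes (t s) h (g s U hU f) = g s W (h.trans hU) (res h f)) {W : X.Opens} (hW : W ≤ V)
    (v : σ → Γ(Y, j ⁻¹ᵁ W)) {x : RingHom.ker (j.app W).hom}
    (hx : (C.frameOf V g hmul hres).ι W hW v = x.1) (s : σ) :
    C.equiv W x s = g s _ (j.preimage_mono hW) (v s) := by
  have h : x = (C.equiv W).symm fun s ↦ g s _ (j.preimage_mono hW) (v s) := Subtype.ext hx.symm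
  rw [h, AddEquiv.apply_symm_apply]

end Hom

variable {k : Type u} [Field k] {Yt Yh : Over (Spec (.of k))} {j : projSpace k 1 ⟶ Yt}
  {p : Yt ⟶ Yh} {d : Fin 2 → ℤ} (C : SplitConormal j.left fun s ↦ transition k ^ d s)

/-- On this chart the ideal of the line in `Yh` is identified with the kernel of `ψ` in the ideal of
the rope. That kernel is free of rank one with generator `φ`, and `φ s₀ = 1`, so the component `s₀`
is an isomorphism. -/
lemma bijective_compHom {Z : Yh.left.Opens} {m : Fin 2}
    (e : j.left ⁻¹ᵁ (p.left ⁻¹ᵁ Z) = chart k 1 m)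
    (g : ∀ (s : Fin 2) (U : (projSpace k 1).left.Opens), U ≤ j.left ⁻¹ᵁ (p.left ⁻¹ᵁ Z) →
      (Γ((projSpace k 1).left, U) ≃+ gluedSections (transition k ^ d s) U))
    (hmul : ∀ s U hU r f, g s U hU (r * f) = r • g s U hU f)
    (hres : ∀ s U hU W (h : W ≤ U) f,
      gluedRes (transition k ^ d s) h (g s U hU f) = g s W (h.trans hU) (res h f))
    (f : Polynomial k ≃+* Γ((projSpace k 1).left, chart k 1 m))
    (hf : ∀ c, f (.C c) = scal _ _ c) (h : Function.Surjective (j.left.app (p.left ⁻¹ᵁ Z)))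
    {x : Γ(Yt.left, p.left ⁻¹ᵁ Z)}
    (hx : (thickLine (C.frameOf _ g hmul hres) e f hf h).π x = .X) {ψ φ : Fin 2 → k}
    {s₀ s₁ : Fin 2} (hφ : φ s₀ = 1) (hφψ : ∑ s, ψ s * φ s = 0) (hs₁ : s₁ ≠ s₀) (hψ : ψ s₁ ≠ 0)
    (hinj : Function.Injective (p.left.app Z))
    (hr : ∀ r, r ∈ (thickLine (C.frameOf _ g hmul hres) e f hf h).sub ψ hx ↔
      ∃ s, p.left.app Z s = r) :
    Function.Bijective ((C.compHom p.left s₀).hom Z) := by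
  set T := thickLine (C.frameOf _ g hmul hres) e f hf h with hT
  have key (v : Fin 2 → Polynomial k) (z : RingHom.ker ((j.left ≫ p.left).app Z).hom)
      (hz : T.ι v = p.left.app Z z.1) :
      (C.compHom p.left s₀).hom Z z = g s₀ _ le_rfl (res e.le (f (v s₀))) :=
    C.equiv_frameOf _ g hmul hres le_rfl (fun s ↦ res e.le (f (v s)))
      (x := ⟨p.left.app Z z.1, app_mem_ker p.left z⟩) hz s₀
  constructor
  · rw [injective_iff_map_eq_zero]
    intro z hz
    obtain ⟨v, hv⟩ := (T.π_eq_zero_iff (p.left.app Z z.1)).mp (by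
      change f.symm (pull j.left e.ge _) = 0
      rw [map_eq_zero_iff _ f.symm.injective, pull_eq_zero_iff_of_eq e]
      exact app_mem_ker p.left z)
    have h1 := (key v z hv).symm.trans hz
    have h2 : v s₀ = 0 := by
      have h3 := (g s₀ _ le_rfl).injective (h1.trans (map_zero _).symm)
      exact f.injective ((res_injective_of_eq e (h3.trans (map_zero _).symm)).trans (map_zero _).symm)
    have h4 : func ψ v = 0 := by
      refine (T.ι_mem_sub (hx := hx)).mp ?_
      rw [hv]
      exact (hr _).mpr ⟨_, rfl⟩
    have h5 := eq_zero_of_func_eq_zero hs₁ hψ h4 h2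
    rw [h5, map_zero] at hv
    exact Subtype.ext (hinj (hv.symm.trans (map_zero (p.left.app Z).hom).symm))
  · intro s
    obtain ⟨s, rfl⟩ := (g s₀ _ le_rfl).surjective s
    obtain ⟨q, hq⟩ := f.surjective (res e.ge s)
    let v (i : Fin 2) : Polynomial k := .C (φ i) * q
    have hv : func ψ v = 0 := by
      have : func ψ v = .C (∑ i, ψ i * φ i) * q := by
        simp only [func, v, map_sum, map_mul, Finset.sum_mul, mul_assoc]
      rw [this, hφψ, map_zero, zero_mul]
    obtain ⟨z, hz⟩ := (hr (T.ι v)).mp (T.ι_mem_sub.mpr hv)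
    have hzk : z ∈ RingHom.ker ((j.left ≫ p.left).app Z).hom := by
      rw [RingHom.mem_ker]
      refine (DFunLike.congr_fun (congrArg CommRingCat.Hom.hom
        (Scheme.Hom.comp_app j.left p.left Z)) z).trans ?_
      refine (congrArg (j.left.app _).hom hz).trans ?_
      exact Frame.app_ι (C.frameOf _ g hmul hres) le_rfl fun s ↦ res e.le (f (v s))
    refine ⟨⟨z, hzk⟩, ?_⟩
    rw [key v ⟨z, hzk⟩ hz.symm]
    congr 1
    simp only [v, hφ, map_one, one_mul, hq]
    exact res_ge_res_le e s

end Ribbon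

noncomputable section Ribbon

/-- Functions act on the ideal through their restrictions to `Y`, and elements of the ideal restrict
to zero. -/
lemma SplitConormal.mul_eq_zero {Y X : Scheme.{u}} {j : Y ⟶ X} {A B : Y.Opens} {σ : Type}
    {t : σ → Γ(Y, A ⊓ B)ˣ} (C : SplitConormal j t) {U : X.Opens} {x y : Γ(X, U)}
    (hx : x ∈ RingHom.ker (j.app U).hom) (hy : y ∈ RingHom.ker (j.app U).hom) : x * y = 0 := by
  have h := C.map_smul U x ⟨y, hy⟩
  have h2 : x • (⟨y, hy⟩ : RingHom.ker (j.app U).hom) = 0 := by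
    refine (C.equiv U).injective (funext fun s ↦ ?_)
    rw [h, map_zero, show j.app U x = 0 from hx, zero_smul]
    rfl
  exact congrArg Subtype.val h2

lemma SplitConormal.ker_comp_sq {Y X Z : Scheme.{u}} {j : Y ⟶ X} {A B : Y.Opens} {σ : Type}
    {t : σ → Γ(Y, A ⊓ B)ˣ} (C : SplitConormal j t) (p : X ⟶ Z) [QuasiCompact (j ≫ p)]
    (hp : ∀ U, Function.Injective (p.app U)) : (j ≫ p).ker ^ 2 = ⊥ := by
  ext U : 2
  rw [Scheme.IdealSheafData.ideal_pow, Pi.pow_apply, Scheme.Hom.ker_apply, pow_two]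
  refine eq_bot_iff.mpr (Ideal.mul_le.mpr fun x hx y hy ↦ ?_)
  have h := C.mul_eq_zero (app_mem_ker p ⟨x, hx⟩) (app_mem_ker p ⟨y, hy⟩)
  exact hp _ ((map_mul (p.app U.1).hom x y).trans (h.trans (map_zero (p.app U.1).hom).symm))

variable {k : Type u} [Field k] {Yt : Over (Spec (.of k))} {j : projSpace k 1 ⟶ Yt} {a b : ℤ}
  (C : SplitConormal j.left fun s ↦ transition k ^ degs a b s)
  [IsClosedImmersion j.left] (hs : Function.Surjective j.left)
  {V₀ V₁ : Yt.left.Opens} (e₀ : j.left ⁻¹ᵁ V₀ = chart k 1 0) (e₁ : j.left ⁻¹ᵁ V₁ = chart k 1 1)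
  {x : Γ(Yt.left, V₀)} {y : Γ(Yt.left, V₁)} {ε : Fin 2 → LaurentPolynomial k}

/-- A projection of a rope whose image contains the functions cut out by `ψ` in both charts is a
projection onto a ribbon. -/
lemma isRibbon_of_range_eq {Yh : Over (Spec (.of k))} {p : Yt ⟶ Yh}
    (hx : (ropeRings C hs e₀ e₁).A₀.π x = .X) (hy : (ropeRings C hs e₀ e₁).A₁.π y = .X)
    {ψ : Fin 2 → k} (hψ0 : ψ ≠ 0) (hψ : ∀ s, ψ s ≠ 0 → degs a b s = -a)
    [IsClosedImmersion (j ≫ p).left] (hp : ∀ U, Function.Injective (p.left.app U))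
    {Z₀ Z₁ : Yh.left.Opens} (hZ₀ : IsAffineOpen Z₀) (hZ₁ : IsAffineOpen Z₁) (hcov : Z₀ ⊔ Z₁ = ⊤)
    (z₀ : p.left ⁻¹ᵁ Z₀ = V₀) (z₁ : p.left ⁻¹ᵁ Z₁ = V₁)
    (hr₀ : ∀ r, r ∈ (ropeRings C hs e₀ e₁).A₀.sub ψ hx ↔ ∃ s, pull p.left z₀.ge s = r)
    (hr₁ : ∀ r, r ∈ (ropeRings C hs e₀ e₁).A₁.sub ψ hy ↔ ∃ s, pull p.left z₁.ge s = r) :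
    IsRibbon (j ≫ p) (twist k (-b)) := by
  obtain ⟨s₀, φ, hφ, hφψ, hs₀, -, s₁, hs₁, hψs⟩ := exists_kernel_vector hψ0 hψ
  subst z₀ z₁
  have hcl : IsClosedImmersion (j.left ≫ p.left) := ‹IsClosedImmersion (j ≫ p).left›
  have h₀ := bijective_compHom C e₀ (fun s _ hU ↦ gsec₀ _ (hU.trans e₀.le))
    (fun _ _ _ _ _ ↦ gsec₀_mul _ _ _ _) (fun _ _ _ _ _ _ ↦ gluedRes_gsec₀ _ _ _ _) polyEquiv₀
    (fun c ↦ polyChart_C 0 1 c) ((C.frame₀ e₀.le).app_surjective hs (e₀ ▸ isAffineOpen_chart 0)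
      (genericPoint_mem_preimage e₀)) hx hφ hφψ hs₁ hψs (hp _) (fun r ↦ by
        simp only [app_eq_pull]
        exact hr₀ r)
  have h₁ := bijective_compHom C e₁ (fun s _ hU ↦ gsec₁ _ (hU.trans e₁.le))
    (fun _ _ _ _ _ ↦ gsec₁_mul _ _ _ _) (fun _ _ _ _ _ _ ↦ gluedRes_gsec₁ _ _ _ _) polyEquiv₁
    (fun c ↦ polyChart_C 1 0 c) ((C.frame₁ e₁.le).app_surjective hs (e₁ ▸ isAffineOpen_chart 1)
      (genericPoint_mem_preimage' e₁)) hy hφ hφψ hs₁ hψs (hp _) (fun r ↦ by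
        simp only [app_eq_pull]
        exact hr₁ r)
  have hb := (C.compHom p.left s₀).bijective_of_sup_eq_top hcov hZ₀ hZ₁
    (show IsAffineOpen (j.left ⁻¹ᵁ (p.left ⁻¹ᵁ Z₀)) from e₀ ▸ isAffineOpen_chart 0)
    (show IsAffineOpen (j.left ⁻¹ᵁ (p.left ⁻¹ᵁ Z₁)) from e₁ ▸ isAffineOpen_chart 1)
    e₀.le e₁.le h₀ h₁
  rw [← hs₀]
  exact ⟨⟨inferInstance, C.ker_comp_sq p.left hp, ⟨(C.compHom p.left s₀).toConormalIso hb⟩⟩,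
    isLineBundle_glued _ chart_zero_sup_chart_one⟩

/-- If the obstruction vanishes along `ψ`, there is a projection onto a ribbon whose functions are
those cut out by `ψ`. -/
lemma exists_ribbon (hx : (ropeRings C hs e₀ e₁).A₀.π x = .X)
    (hy : (ropeRings C hs e₀ e₁).A₁.π y = .X)
    (hε : (ropeRings C hs e₀ e₁).ρ₀ x * (ropeRings C hs e₀ e₁).ρ₁ y =
      1 + (ropeRings C hs e₀ e₁).ι ε)
    {ψ : Fin 2 → k} (hψ0 : ψ ≠ 0) (hψ : ∀ s, ψ s ≠ 0 → degs a b s = -a)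
    (hψε : lfunc ψ ε = 0) :
    ∃ (Yh : Over (Spec (.of k))) (p : Yt ⟶ Yh) (Z₀ Z₁ : Yh.left.Opens)
      (z₀ : p.left ⁻¹ᵁ Z₀ = V₀) (z₁ : p.left ⁻¹ᵁ Z₁ = V₁),
      IsRibbon (j ≫ p) (twist k (-b)) ∧ IsSchemeTheoreticallyDominant p.left ∧
      (∀ r ∈ (ropeRings C hs e₀ e₁).A₀.sub ψ hx, ∃ s, pull p.left z₀.ge s = r) ∧
      ∀ r ∈ (ropeRings C hs e₀ e₁).A₁.sub ψ hy, ∃ s, pull p.left z₁.ge s = r := by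
  -- The ribbon is obtained as the scheme-theoretic image of a morphism `q` to a large projective
  -- space, whose coordinates generate exactly the subrings cut out by `ψ` on the two charts.
  obtain ⟨M, hM, w₀, w₁, hw, hw₀, hw₁, gen₀, gen₁⟩ :=
    (ropeRings C hs e₀ e₁).exists_rel_generating_sub hx hy hψ0 hψ hψε
  obtain ⟨i, -, i₀, i₁, hi₀, hi₁⟩ := exists_monomialCurve (k := k) hM
  have hi : IsMonomialCurve i := ⟨i₀, i₁, hi₀, hi₁⟩
  have hicl := hi.isClosedImmersion hM
  obtain ⟨q, hq, h₀, h₁, H₀, H₁⟩ := exists_extension C hs e₀ e₁ hx hy hε hw hi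
  have q₀ := preimage_eq_of_extension hs hq e₀ i₀
  have q₁ := preimage_eq_of_extension hs hq e₁ i₁
  have hqc' : QuasiCompact (j.left ≫ q.left) := by
    have : IsClosedImmersion (j ≫ q).left := hq ▸ hicl
    exact inferInstanceAs (QuasiCompact (j ≫ q).left)
  have hqc : QuasiCompact q.left := quasiCompact_of_comp j.left q.left hs
  let Yh : Over (Spec (.of k)) := Over.mk (q.left.imageι ≫ toSpec (projSpace k M))
  let p : Yt ⟶ Yh := Over.homMk q.left.toImage (by
    change q.left.toImage ≫ q.left.imageι ≫ toSpec (projSpace k M) = _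
    rw [q.left.toImage_imageι_assoc]
    exact Over.w q)
  let κ : Yh.left ⟶ (projSpace k M).left := q.left.imageι
  have hκ : IsClosedImmersion κ := inferInstanceAs (IsClosedImmersion q.left.imageι)
  have hpκ : p.left ≫ κ = q.left := q.left.toImage_imageι
  have hp : IsSchemeTheoreticallyDominant p.left :=
    inferInstanceAs (IsSchemeTheoreticallyDominant q.left.toImage)
  have hpc : QuasiCompact p.left := inferInstanceAs (QuasiCompact q.left.toImage)
  have hinj (U) : Function.Injective (p.left.app U) := toImage_app_injective q.left U
  have hcl : IsClosedImmersion (j ≫ p).left := by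
    have h : IsClosedImmersion ((j ≫ p).left ≫ κ) := by
      have : (j ≫ p).left ≫ κ = i.left := by
        rw [← hq]
        change (j.left ≫ p.left) ≫ κ = j.left ≫ q.left
        rw [Category.assoc, hpκ]
      rw [this]
      exact hicl
    exact IsClosedImmersion.of_comp_isClosedImmersion _ κ
  have hZ {m : Fin (M + 1)} : IsAffineOpen (κ ⁻¹ᵁ chart k M m) := (isAffineOpen_chart m).preimage κ
  have hpre {m : Fin (M + 1)} {V : Yt.left.Opens} (hV : q.left ⁻¹ᵁ chart k M m = V) :
      p.left ⁻¹ᵁ (κ ⁻¹ᵁ chart k M m) = V := by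
    rw [← hV, ← hpκ]
    rfl
  have hpull {m : Fin (M + 1)} {V : Yt.left.Opens} (hV : V ≤ q.left ⁻¹ᵁ chart k M m)
      (hV' : V ≤ p.left ⁻¹ᵁ (κ ⁻¹ᵁ chart k M m)) (c) :
      pull p.left hV' (κ.app (chart k M m) c) = pull q.left hV c := by
    rw [app_eq_pull, pull_pull]
    exact pull_congr hpκ _ _
  have hsurj (m : Fin (M + 1)) := κ.app_surjective _ (isAffineOpen_chart (k := k) m)
  have hr₀ : ∀ r, r ∈ (ropeRings C hs e₀ e₁).A₀.sub ψ hx ↔ ∃ s, pull p.left (hpre q₀).ge s = r := by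
    refine fun r ↦ ⟨fun hr ↦ ?_, ?_⟩
    · obtain ⟨c, hc⟩ := gen₀ (pull q.left h₀).range (fun c ↦ ⟨scal _ _ c, pull_scal q h₀ c⟩)
        (fun l hl ↦ ⟨aff k M 0 ⟨l, by omega⟩, H₀ _⟩) hr
      exact ⟨κ.app _ c, (hpull h₀ _ c).trans hc⟩
    · rintro ⟨s, rfl⟩
      obtain ⟨c, rfl⟩ := hsurj 0 s
      rw [hpull h₀]
      refine range_le_of_aff_mem (pull q.left h₀) _ (fun l ↦ ?_) (fun c ↦ ?_) c
      · rw [H₀]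
        exact ThickLine.seq_mem_sub _ fun m hm ↦ hw₀ m (by omega)
      · rw [pull_scal]
        exact ThickLine.c_mem_sub _ c
  have hr₁ : ∀ r, r ∈ (ropeRings C hs e₀ e₁).A₁.sub ψ hy ↔ ∃ s, pull p.left (hpre q₁).ge s = r := by
    refine fun r ↦ ⟨fun hr ↦ ?_, ?_⟩
    · obtain ⟨c, hc⟩ := gen₁ (pull q.left h₁).range (fun c ↦ ⟨scal _ _ c, pull_scal q h₁ c⟩)
        (fun l hl ↦ ⟨aff k M (Fin.last M) ⟨M - l, by omega⟩, (H₁ _).trans (by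
          rw [show M - (M - l) = l by omega])⟩) hr
      exact ⟨κ.app _ c, (hpull h₁ _ c).trans hc⟩
    · rintro ⟨s, rfl⟩
      obtain ⟨c, rfl⟩ := hsurj (Fin.last M) s
      rw [hpull h₁]
      refine range_le_of_aff_mem (pull q.left h₁) _ (fun l ↦ ?_) (fun c ↦ ?_) c
      · rw [H₁]
        exact ThickLine.seq_mem_sub _ fun m hm ↦ hw₁ m (by omega)
      · rw [pull_scal]
        exact ThickLine.c_mem_sub _ c
  have hcov : κ ⁻¹ᵁ chart k M 0 ⊔ κ ⁻¹ᵁ chart k M (Fin.last M) = ⊤ := by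
    have h := sup_eq_top_of_preimage hs e₀ e₁
    rw [← hpre q₀, ← hpre q₁, ← Scheme.Hom.preimage_sup] at h
    have hrange : ∀ z : Yh.left, z ∈ κ ⁻¹ᵁ chart k M 0 ⊔ κ ⁻¹ᵁ chart k M (Fin.last M) := by
      -- The line maps to the image with dense and closed range, so the covering of the image can be
      -- checked on the line.
      have hps : Function.Surjective (j ≫ p).left := by
        have hpd : DenseRange (p.left) := (inferInstance : IsDominant p.left).denseRange
        have hjd : DenseRange (j ≫ p).left :=
          (hpd.comp hs.denseRange p.left.continuous)
        have := hjd.closure_range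
        rw [(j ≫ p).left.isClosedEmbedding.isClosed_range.closure_eq] at this
        exact Set.range_eq_univ.mp this
      intro z
      obtain ⟨y, rfl⟩ := hps z
      have hy : j.left y ∈ p.left ⁻¹ᵁ (κ ⁻¹ᵁ chart k M 0 ⊔ κ ⁻¹ᵁ chart k M (Fin.last M)) := by
        rw [h]
        trivial
      exact hy
    exact top_unique fun z _ ↦ hrange z
  exact ⟨Yh, p, _, _, hpre q₀, hpre q₁, isRibbon_of_range_eq C hs e₀ e₁ hx hy hψ0 hψ hinj hZ hZ
    hcov (hpre q₀) (hpre q₁) hr₀ hr₁, hp, fun r ↦ (hr₀ r).mp, fun r ↦ (hr₁ r).mp⟩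

end Ribbon

/-! ### Factoring morphisms through a quotient -/

section Factor

variable {k : Type u} [Field k] {Yt Yh : Over (Spec (.of k))}

/-- A morphism to projective space whose coordinates come from a scheme-theoretic quotient factors
through it. -/
lemma exists_factor (p : Yt ⟶ Yh) [IsSchemeTheoreticallyDominant p.left] [QuasiCompact p.left]
    {Z₀ Z₁ : Yh.left.Opens} (hcov : Z₀ ⊔ Z₁ = ⊤) {V₀ V₁ : Yt.left.Opens}
    (z₀ : p.left ⁻¹ᵁ Z₀ = V₀) (z₁ : p.left ⁻¹ᵁ Z₁ = V₁) {N : ℕ} {i : Yt ⟶ projSpace k N}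
    {m m' : Fin (N + 1)} (h₀ : V₀ ≤ i.left ⁻¹ᵁ chart k N m) (h₁ : V₁ ≤ i.left ⁻¹ᵁ chart k N m')
    (hr₀ : ∀ l, ∃ s, pull p.left z₀.ge s = pull i.left h₀ (aff k N m l))
    (hr₁ : ∀ l, ∃ s, pull p.left z₁.ge s = pull i.left h₁ (aff k N m' l)) :
    ∃ g : Yh ⟶ projSpace k N, p ≫ g = i := by
  subst z₀ z₁
  have hinj (U) : Function.Injective (p.left.app U) := p.left.app_injective U
  choose F hF using hr₀
  choose G hG using hr₁
  obtain ⟨g, g₀, g₁, H₀, H₁⟩ := exists_hom_projSpace (X := Yh) (p := m) (q := m') hcov F G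
    (hinj Z₀ (by rw [app_eq_pull, hF, aff_self, map_one, map_one]))
    (hinj Z₁ (by rw [app_eq_pull, hG, aff_self, map_one, map_one]))
    (fun l ↦ hinj _ (by
      rw [map_mul, app_res, app_res, app_res, app_eq_pull, app_eq_pull, app_eq_pull, hF, hF, hG,
        res_pull, res_pull, res_pull]
      exact (pull_aff_mul_pull_aff i.left _ _ l).symm))
  refine ⟨g, hom_projSpace_ext fun x ↦ ?_⟩
  have hx : p.left x ∈ Z₀ ⊔ Z₁ := by rw [hcov]; trivial
  rcases hx with hx | hx
  · refine ⟨p.left ⁻¹ᵁ Z₀, m, p.left.preimage_mono g₀, h₀, hx, fun l ↦ ?_⟩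
    rw [← hF, ← H₀]
    exact (pull_pull p.left g.left g₀ le_rfl _).symm
  · refine ⟨p.left ⁻¹ᵁ Z₁, m', p.left.preimage_mono g₁, h₁, hx, fun l ↦ ?_⟩
    rw [← hG, ← H₁]
    exact (pull_pull p.left g.left g₁ le_rfl _).symm

end Factor

/-! ### From a projection onto a ribbon to a functional -/

noncomputable section Functional

open LaurentPolynomial hiding C
open Polynomial

variable {k : Type*} [Field k]

/-- Monomials with nonnegative exponent lift from the first chart, the others from the second. -/
lemma GluedRings.π_surjective {σ : Type*} {d : σ → ℤ} {R₀ R₁ R : Type*} [CommRing R₀]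
    [CommRing R₁] [CommRing R] (A : GluedRings k d R₀ R₁ R) : Function.Surjective A.π := by
  intro q
  induction q using LaurentPolynomial.induction_on' with
  | add p q hp hq =>
    obtain ⟨r, rfl⟩ := hp
    obtain ⟨s, rfl⟩ := hq
    exact ⟨r + s, map_add _ _ _⟩
  | C_mul_T n c =>
    obtain ⟨m, rfl | rfl⟩ := n.eq_nat_or_neg
    · obtain ⟨r, hr⟩ := A.A₀.π_surjective (C c * X ^ m)
      exact ⟨A.ρ₀ r, by rw [A.π_ρ₀, hr, toLaurent_C_mul_X_pow]⟩
    · obtain ⟨r, hr⟩ := A.A₁.π_surjective (C c * X ^ m)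
      exact ⟨A.ρ₁ r, by rw [A.π_ρ₁, hr, toLaurent_C_mul_X_pow, map_mul, invert_C, invert_T]⟩

/-- A homomorphism of square zero extensions of the affine line contains in its image the subring
cut out by a functional which vanishes on the image of the ideal. -/
lemma ThickLine.exists_of_mem_sub {R S : Type*} [CommRing R] [CommRing S]
    (A : ThickLine k (Fin 2) R) (B : ThickLine k Unit S) (f : S →+* R)
    (hc : ∀ c, f (B.c c) = A.c c) {c : Fin 2 → k} (hc0 : c ≠ 0)
    (hf : f (B.ι 1) = A.ι fun s ↦ C (c s)) {x' : S} {x : R} (hxx : f x' = x) (hx : A.π x = X)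
    {r : R} (hr : r ∈ A.sub ![c 1, -c 0] hx) : ∃ s, f s = r := by
  obtain ⟨p, v, hv, rfl⟩ := hr
  have heval (q : k[X]) : f (q.eval₂ B.c x') = q.eval₂ A.c x := by
    rw [hom_eval₂, hxx, show f.comp B.c = A.c from RingHom.ext hc]
  -- The kernel of the functional `(c 1, -c 0)` is generated by the constant vector `c`, which is
  -- the image of the generator of the ideal of `B`.
  obtain ⟨q, hq⟩ : ∃ q : k[X], v = q • fun s ↦ C (c s) := by
    simp only [func, Fin.sum_univ_two, Matrix.cons_val_zero, Matrix.cons_val_one, map_neg] at hv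
    have hC {e : k} (he : e ≠ 0) : (C e⁻¹ : k[X]) * C e = 1 := by
      rw [← map_mul, inv_mul_cancel₀ he, map_one]
    by_cases h0 : c 0 = 0
    · have h1 : c 1 ≠ 0 := fun h1 ↦ hc0 (by ext s; fin_cases s <;> assumption)
      refine ⟨C (c 1)⁻¹ * v 1, ?_⟩
      ext1 s
      fin_cases s
      · change v 0 = _ * v 1 * C (c 0)
        linear_combination C (c 1)⁻¹ * hv - v 0 * hC h1
      · change v 1 = _ * v 1 * C (c 1)
        linear_combination - v 1 * hC h1
    · refine ⟨C (c 0)⁻¹ * v 0, ?_⟩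
      ext1 s
      fin_cases s
      · change v 0 = _ * v 0 * C (c 0)
        linear_combination - v 0 * hC h0
      · change v 1 = _ * v 0 * C (c 1)
        linear_combination -C (c 0)⁻¹ * hv - v 1 * hC h0
  refine ⟨p.eval₂ B.c x' + q.eval₂ B.c x' * B.ι 1, ?_⟩
  rw [map_add, map_mul, heval, heval, hf, A.mul_ι, A.π_eval₂ hx, hq]

/-- Global sections of `𝒪(e)` with `e ≤ 0` are constants, and nonzero ones exist only for `e = 0`.
-/
lemma eq_C_of_toLaurent_eq {p q : k[X]} {e : ℤ} (he : e ≤ 0)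
    (h : toLaurent p = T e * invert (toLaurent q)) :
    p = C (p.coeff 0) ∧ q = C (p.coeff 0) ∧ (p.coeff 0 ≠ 0 → e = 0) := by
  have h1 : p = C (p.coeff 0) := by
    ext n
    rcases n.eq_zero_or_pos with rfl | hn
    · simp
    · rw [coeff_C, if_neg hn.ne', ← coeff_toLaurent_natCast, h, coeff_T_mul_invert_of_gt _ (by omega)]
  have h0 : p.coeff 0 ≠ 0 → e = 0 := by
    intro h2
    by_contra h3
    refine h2 ?_
    rw [← coeff_toLaurent_natCast, h, coeff_T_mul_invert_of_gt _ (by omega)]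
  refine ⟨h1, ?_, h0⟩
  have h4 : toLaurent q = toLaurent (C (p.coeff 0)) := by
    have h5 : invert (toLaurent q) = T (-e) * toLaurent p := by
      rw [h, ← mul_assoc, ← T_add]
      simp
    rw [← (involutive_invert (R := k)) (toLaurent q), h5, h1]
    by_cases h6 : p.coeff 0 = 0
    · simp [h6]
    · rw [h0 h6]
      simp
  exact toLaurent_injective h4

/-- A projection onto a ribbon defines a functional along which the obstruction vanishes. -/
lemma GluedRings.exists_functional {a b : ℤ} (hab : b ≤ a) {R₀ R₁ R S₀ S₁ S : Type*} [CommRing R₀]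
    [CommRing R₁] [CommRing R] [CommRing S₀] [CommRing S₁] [CommRing S]
    (A : GluedRings k (degs a b) R₀ R₁ R) (B : GluedRings k (fun _ : Unit ↦ -b) S₀ S₁ S)
    {f₀ : S₀ →+* R₀} {f₁ : S₁ →+* R₁} {f : S →+* R} (hρ₀ : ∀ s, A.ρ₀ (f₀ s) = f (B.ρ₀ s))
    (hρ₁ : ∀ s, A.ρ₁ (f₁ s) = f (B.ρ₁ s)) (hπ₀ : ∀ s, A.A₀.π (f₀ s) = B.A₀.π s)
    (hπ₁ : ∀ s, A.A₁.π (f₁ s) = B.A₁.π s) (hπ : ∀ s, A.π (f s) = B.π s)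
    (hc₀ : ∀ c, f₀ (B.A₀.c c) = A.A₀.c c) (hc₁ : ∀ c, f₁ (B.A₁.c c) = A.A₁.c c)
    (hinj : Function.Injective f₀) :
    ∃ (x : R₀) (y : R₁) (ε : Fin 2 → LaurentPolynomial k) (ψ : Fin 2 → k) (hx : A.A₀.π x = X)
      (hy : A.A₁.π y = X), A.ρ₀ x * A.ρ₁ y = 1 + A.ι ε ∧ ψ ≠ 0 ∧
      (∀ s, ψ s ≠ 0 → degs a b s = -a) ∧ lfunc ψ ε = 0 ∧
      (∀ r ∈ A.A₀.sub ψ hx, ∃ s, f₀ s = r) ∧ ∀ r ∈ A.A₁.sub ψ hy, ∃ s, f₁ s = r := by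
  obtain ⟨x', hx'⟩ := B.A₀.π_surjective X
  obtain ⟨y', hy'⟩ := B.A₁.π_surjective X
  obtain ⟨ε', hε'⟩ := B.exists_eps hx' hy'
  obtain ⟨φ₀, hφ₀⟩ := (A.A₀.π_eq_zero_iff (f₀ (B.A₀.ι 1))).mp (by rw [hπ₀, B.A₀.π_ι])
  obtain ⟨φ₁, hφ₁⟩ := (A.A₁.π_eq_zero_iff (f₁ (B.A₁.ι 1))).mp (by rw [hπ₁, B.A₁.π_ι])
  have hfι (v : Unit → LaurentPolynomial k) :
      f (B.ι v) = A.ι (v () • fun s ↦ toLaurent (φ₀ s)) := by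
    obtain ⟨r, hr⟩ := B.π_surjective (v ())
    have h1 : B.ρ₀ (B.A₀.ι 1) = B.ι 1 := by
      rw [B.ρ₀_ι]
      congr 1
      ext1 s
      simp
    have h2 : B.ι v = r * B.ι 1 := by
      rw [B.mul_ι, hr]
      congr 1
      ext1 s
      simp
    rw [h2, map_mul, ← h1, ← hρ₀, ← hφ₀, A.ρ₀_ι, A.mul_ι, hπ, hr]
  -- `φ₀` and `φ₁` are the images of the generators of the ideal of the ribbon on the two charts.
  -- Comparing them on the overlap, each component is a section of a line bundle of degree `b - a`
  -- or `0`, hence constant.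
  have hφ (s) : toLaurent (φ₀ s) = T (degs a b s + b) * invert (toLaurent (φ₁ s)) := by
    have h1 := hρ₁ (B.A₁.ι 1)
    rw [B.ρ₁_ι, hfι, ← hφ₁, A.ρ₁_ι] at h1
    have h2 := congrFun (A.ι_injective h1) s
    simp only [Pi.one_apply, map_one, mul_one, Pi.smul_apply, smul_eq_mul] at h2
    rw [add_comm, T_add, mul_assoc, h2, ← mul_assoc, ← T_add]
    simp
  have hle (s) : degs a b s + b ≤ 0 := by
    fin_cases s <;> simp
    omega
  let c (s : Fin 2) : k := (φ₀ s).coeff 0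
  have e₀ : φ₀ = fun s ↦ C (c s) := funext fun s ↦ (eq_C_of_toLaurent_eq (hle s) (hφ s)).1
  have e₁ : φ₁ = fun s ↦ C (c s) := funext fun s ↦ (eq_C_of_toLaurent_eq (hle s) (hφ s)).2.1
  have hc (s) (h : c s ≠ 0) : degs a b s + b = 0 := (eq_C_of_toLaurent_eq (hle s) (hφ s)).2.2 h
  have hc0 : c ≠ 0 := by
    intro h
    rw [e₀, h, show (fun s ↦ C ((0 : Fin 2 → k) s)) = 0 from funext fun s ↦ C_0, map_zero] at hφ₀
    have h1 := B.A₀.ι_injective ((hinj (hφ₀.symm.trans (map_zero f₀).symm)).trans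
      (map_zero B.A₀.ι).symm)
    exact one_ne_zero (congrFun h1 ())
  have hx : A.A₀.π (f₀ x') = X := by rw [hπ₀, hx']
  have hy : A.A₁.π (f₁ y') = X := by rw [hπ₁, hy']
  -- With lifts coming from the ribbon, the obstruction is a multiple of the vector `c`, so the
  -- functional annihilating `c` kills it. Its second entry is nonzero only if `c 0 ≠ 0`, and then
  -- `a = b`.
  refine ⟨f₀ x', f₁ y', ε' () • fun s ↦ toLaurent (φ₀ s), ![c 1, -c 0], hx, hy, ?_, ?_, ?_, ?_, ?_, ?_⟩
  · rw [hρ₀, hρ₁, ← map_mul, hε', map_add, map_one, hfι]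
  · intro h
    refine hc0 (funext fun s ↦ ?_)
    fin_cases s
    · simpa using congrFun h 1
    · simpa using congrFun h 0
  · intro s hs
    fin_cases s
    · rfl
    · have h1 := hc 0 (by simpa using hs)
      simp at h1 ⊢
      omega
  · simp only [lfunc, Fin.sum_univ_two, e₀, Pi.smul_apply, smul_eq_mul, Matrix.cons_val_zero,
      Matrix.cons_val_one, toLaurent_C, map_neg]
    ring
  · exact fun r hr ↦ A.A₀.exists_of_mem_sub B.A₀ f₀ hc₀ hc0 (e₀ ▸ hφ₀.symm) rfl hx hr
  · exact fun r hr ↦ A.A₁.exists_of_mem_sub B.A₁ f₁ hc₁ hc0 (e₁ ▸ hφ₁.symm) rfl hy hr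

end Functional

/-! ### Projections versus extensions of the monomial curve -/

noncomputable section

variable {k : Type u} [Field k] {Yt Yh : Over (Spec (.of k))} {j : projSpace k 1 ⟶ Yt} {a b : ℤ}

lemma sup_eq_top_of_projection {p : Yt ⟶ Yh} (hs : Function.Surjective (j ≫ p).left)
    {V₀ V₁ : Yt.left.Opens} (e₀ : j.left ⁻¹ᵁ V₀ = chart k 1 0) (e₁ : j.left ⁻¹ᵁ V₁ = chart k 1 1)
    {Z₀ Z₁ : Yh.left.Opens} (z₀ : p.left ⁻¹ᵁ Z₀ = V₀) (z₁ : p.left ⁻¹ᵁ Z₁ = V₁) : Z₀ ⊔ Z₁ = ⊤ := by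
  subst z₀ z₁
  exact sup_eq_top_of_preimage (j := j ≫ p) hs e₀ e₁

lemma IsRope.surjective {L : (projSpace k 1).left.Modules} (h : IsRope j L) :
    Function.Surjective j.left :=
  have := h.isClosedImmersion
  surjective_of_ker_sq _ h.ker_sq

lemma quasiCompact_of_isRope {p : Yt ⟶ Yh} {L : (projSpace k 1).left.Modules}
    (hs : Function.Surjective j.left) (h : IsRope (j ≫ p) L) : QuasiCompact p.left := by
  have : IsClosedImmersion (j.left ≫ p.left) := h.isClosedImmersion
  exact quasiCompact_of_comp j.left p.left hs

/-- A projection onto a ribbon contains the functions cut out by a functional along which the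
obstruction vanishes. -/
lemma exists_functional_of_projection (C : SplitConormal j.left fun s ↦ transition k ^ degs a b s)
    [IsClosedImmersion j.left] (hs : Function.Surjective j.left) (hab : b ≤ a) {p : Yt ⟶ Yh}
    [IsSchemeTheoreticallyDominant p.left] (h : IsRibbon (j ≫ p) (twist k (-b))) :
    ∃ (Z₀ Z₁ : Yh.left.Opens) (e₀ : j.left ⁻¹ᵁ (p.left ⁻¹ᵁ Z₀) = chart k 1 0)
      (e₁ : j.left ⁻¹ᵁ (p.left ⁻¹ᵁ Z₁) = chart k 1 1) (x : Γ(Yt.left, p.left ⁻¹ᵁ Z₀))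
      (y : Γ(Yt.left, p.left ⁻¹ᵁ Z₁)) (ε : Fin 2 → LaurentPolynomial k) (ψ : Fin 2 → k)
      (hx : (ropeRings C hs e₀ e₁).A₀.π x = .X) (hy : (ropeRings C hs e₀ e₁).A₁.π y = .X),
      (ropeRings C hs e₀ e₁).ρ₀ x * (ropeRings C hs e₀ e₁).ρ₁ y =
        1 + (ropeRings C hs e₀ e₁).ι ε ∧ ψ ≠ 0 ∧ (∀ s, ψ s ≠ 0 → degs a b s = -a) ∧
      lfunc ψ ε = 0 ∧
      (∀ r ∈ (ropeRings C hs e₀ e₁).A₀.sub ψ hx, ∃ s, pull p.left le_rfl s = r) ∧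
      ∀ r ∈ (ropeRings C hs e₀ e₁).A₁.sub ψ hy, ∃ s, pull p.left le_rfl s = r := by
  have := h.isClosedImmersion
  have := quasiCompact_of_isRope hs h.toIsRope
  have hs' := h.toIsRope.surjective
  obtain ⟨C'⟩ := h.conormal
  obtain ⟨Z₀, e₀⟩ := exists_preimage_eq (j ≫ p).left (chart k 1 0)
  obtain ⟨Z₁, e₁⟩ := exists_preimage_eq (j ≫ p).left (chart k 1 1)
  have e₀' : j.left ⁻¹ᵁ (p.left ⁻¹ᵁ Z₀) = chart k 1 0 := e₀
  have e₁' : j.left ⁻¹ᵁ (p.left ⁻¹ᵁ Z₁) = chart k 1 1 := e₁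
  have D : SplitConormal (j ≫ p).left fun _ : Unit ↦ transition k ^ (-b) := ConormalIso.split C'
  refine ⟨Z₀, Z₁, e₀', e₁', ?_⟩
  refine (ropeRings C hs e₀' e₁').exists_functional hab (ropeRings (d := fun _ ↦ -b) D hs' e₀ e₁)
    (f₀ := pull p.left le_rfl) (f₁ := pull p.left le_rfl) (f := pull p.left le_rfl) (fun s ↦ ?_)
    (fun s ↦ ?_) (fun s ↦ ?_) (fun s ↦ ?_) (fun s ↦ ?_) (fun c ↦ ?_) (fun c ↦ ?_) fun s t hst ↦ ?_
  · exact (res_pull _ _ _ _).trans (pull_res _ _ _ _).symm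
  · exact (res_pull _ _ _ _).trans (pull_res _ _ _ _).symm
  · exact congrArg polyEquiv₀.symm (pull_pull j.left p.left _ _ _)
  · exact congrArg polyEquiv₁.symm (pull_pull j.left p.left _ _ _)
  · exact congrArg laurentEquiv.symm (pull_pull j.left p.left _ _ _)
  · exact pull_scal p le_rfl c
  · exact pull_scal p le_rfl c
  · refine p.left.app_injective Z₀ ?_
    rw [app_eq_pull, app_eq_pull, hst]

variable (C : SplitConormal j.left fun s ↦ transition k ^ degs a b s)
  [IsClosedImmersion j.left] (hs : Function.Surjective j.left)
  {V₀ V₁ : Yt.left.Opens} (e₀ : j.left ⁻¹ᵁ V₀ = chart k 1 0) (e₁ : j.left ⁻¹ᵁ V₁ = chart k 1 1)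
  {x : Γ(Yt.left, V₀)} {y : Γ(Yt.left, V₁)} {ε : Fin 2 → LaurentPolynomial k} {N : ℕ}
  {i : projSpace k 1 ⟶ projSpace k N} {ψ : Fin 2 → k}

include hs e₀ e₁ in
omit [IsClosedImmersion j.left] in
lemma le_preimage_of_extension (hi : IsMonomialCurve i) {i' : Yt ⟶ projSpace k N}
    (hii : j ≫ i' = i) : V₀ ≤ i'.left ⁻¹ᵁ chart k N 0 ∧ V₁ ≤ i'.left ⁻¹ᵁ chart k N (Fin.last N) :=
  ⟨(preimage_eq_of_extension hs hii e₀ hi.preimage₀).ge,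
    (preimage_eq_of_extension hs hii e₁ hi.preimage₁).ge⟩

/-- The coordinates of extensions of the monomial curve of degree at most `a - 2` are cut out by any
functional along which the obstruction vanishes. -/
lemma aff_mem_sub_of_extension (hx : (ropeRings C hs e₀ e₁).A₀.π x = .X)
    (hy : (ropeRings C hs e₀ e₁).A₁.π y = .X)
    (hε : (ropeRings C hs e₀ e₁).ρ₀ x * (ropeRings C hs e₀ e₁).ρ₁ y =
      1 + (ropeRings C hs e₀ e₁).ι ε) (hψ : ∀ s, ψ s ≠ 0 → degs a b s = -a) (hψε : lfunc ψ ε = 0)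
    (hN : (N : ℤ) ≤ a - 2) (hi : IsMonomialCurve i) {i' : Yt ⟶ projSpace k N} (hii : j ≫ i' = i)
    (h₀ : V₀ ≤ i'.left ⁻¹ᵁ chart k N 0) (h₁ : V₁ ≤ i'.left ⁻¹ᵁ chart k N (Fin.last N)) :
    (∀ l, pull i'.left h₀ (aff k N 0 l) ∈ (ropeRings C hs e₀ e₁).A₀.sub ψ hx) ∧
      ∀ l, pull i'.left h₁ (aff k N (Fin.last N) l) ∈ (ropeRings C hs e₀ e₁).A₁.sub ψ hy := by
  obtain ⟨w₀, w₁, hw, H₀, H₁⟩ := exists_rel_of_extension C hs e₀ e₁ hx hy hε hi hii h₀ h₁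
  have h (m : ℕ) (hm : m < N) := hw.func_eq_zero _ hψ hN hψε hm
  refine ⟨fun l ↦ ?_, fun l ↦ ?_⟩
  · rw [H₀]
    exact ThickLine.seq_mem_sub _ fun m hm ↦ (h m (by omega)).1
  · rw [H₁]
    exact ThickLine.seq_mem_sub _ fun m hm ↦ (h m (by omega)).2

/-- Extensions of the monomial curve of degree at most `a - 2` are not closed immersions if the
obstruction vanishes along a functional. -/
lemma not_isClosedImmersion_of_extension (hx : (ropeRings C hs e₀ e₁).A₀.π x = .X)
    (hy : (ropeRings C hs e₀ e₁).A₁.π y = .X)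
    (hε : (ropeRings C hs e₀ e₁).ρ₀ x * (ropeRings C hs e₀ e₁).ρ₁ y =
      1 + (ropeRings C hs e₀ e₁).ι ε) (hψ0 : ψ ≠ 0) (hψ : ∀ s, ψ s ≠ 0 → degs a b s = -a)
    (hψε : lfunc ψ ε = 0) (hN : (N : ℤ) ≤ a - 2) (hi : IsMonomialCurve i)
    {i' : Yt ⟶ projSpace k N} (hii : j ≫ i' = i) : ¬ IsClosedImmersion i'.left := by
  intro hcl
  obtain ⟨h₀, h₁⟩ := le_preimage_of_extension hs e₀ e₁ hi hii
  have hmem := (aff_mem_sub_of_extension C hs e₀ e₁ hx hy hε hψ hψε hN hi hii h₀ h₁).1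
  -- For a closed immersion every function on `V₀` would lie in the subring cut out by `ψ`, but the
  -- basis vector of the ideal at an index where `ψ` is nonzero does not.
  obtain ⟨s, hsψ⟩ := Function.ne_iff.mp hψ0
  obtain ⟨c, hc⟩ := pull_surjective_of_eq (preimage_eq_of_extension hs hii e₀ hi.preimage₀)
    (i'.left.app_surjective _ (isAffineOpen_chart 0))
    ((ropeRings C hs e₀ e₁).A₀.ι (Pi.single s 1))
  have h := range_le_of_aff_mem _ _ hmem (fun c ↦ by
    rw [pull_scal]
    exact ThickLine.c_mem_sub _ c) c
  rw [hc, ThickLine.ι_mem_sub, func, Finset.sum_eq_single s, Pi.single_eq_same, mul_one,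
    Polynomial.C_eq_zero] at h
  · exact hsψ h
  · intro t _ ht
    rw [Pi.single_eq_of_ne ht, mul_zero]
  · simp

/-- Extensions of the monomial curve factor through any projection which contains the functions cut
out by a functional along which the obstruction vanishes. -/
lemma exists_factor_of_extension (hx : (ropeRings C hs e₀ e₁).A₀.π x = .X)
    (hy : (ropeRings C hs e₀ e₁).A₁.π y = .X)
    (hε : (ropeRings C hs e₀ e₁).ρ₀ x * (ropeRings C hs e₀ e₁).ρ₁ y =
      1 + (ropeRings C hs e₀ e₁).ι ε) (hψ : ∀ s, ψ s ≠ 0 → degs a b s = -a)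
    (hψε : lfunc ψ ε = 0) {p : Yt ⟶ Yh} [IsSchemeTheoreticallyDominant p.left]
    {L : (projSpace k 1).left.Modules} (h : IsRope (j ≫ p) L) {Z₀ Z₁ : Yh.left.Opens}
    (z₀ : p.left ⁻¹ᵁ Z₀ = V₀) (z₁ : p.left ⁻¹ᵁ Z₁ = V₁)
    (hr₀ : ∀ r ∈ (ropeRings C hs e₀ e₁).A₀.sub ψ hx, ∃ s, pull p.left z₀.ge s = r)
    (hr₁ : ∀ r ∈ (ropeRings C hs e₀ e₁).A₁.sub ψ hy, ∃ s, pull p.left z₁.ge s = r)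
    (hN : (N : ℤ) ≤ a - 2) (hi : IsMonomialCurve i) {i' : Yt ⟶ projSpace k N} (hii : j ≫ i' = i) :
    ∃ g : Yh ⟶ projSpace k N, p ≫ g = i' := by
  obtain ⟨h₀, h₁⟩ := le_preimage_of_extension hs e₀ e₁ hi hii
  obtain ⟨m₀, m₁⟩ := aff_mem_sub_of_extension C hs e₀ e₁ hx hy hε hψ hψε hN hi hii h₀ h₁
  have := quasiCompact_of_isRope hs h
  exact exists_factor p (sup_eq_top_of_projection h.surjective e₀ e₁ z₀ z₁) z₀ z₁ h₀ h₁
    (fun l ↦ hr₀ _ (m₀ l)) fun l ↦ hr₁ _ (m₁ l)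

/-- If there is no projection onto a ribbon, the monomial curve of degree `a - 2` extends to an
embedding. -/
lemma exists_isClosedImmersion (hx : (ropeRings C hs e₀ e₁).A₀.π x = .X)
    (hy : (ropeRings C hs e₀ e₁).A₁.π y = .X)
    (hε : (ropeRings C hs e₀ e₁).ρ₀ x * (ropeRings C hs e₀ e₁).ρ₁ y =
      1 + (ropeRings C hs e₀ e₁).ι ε) (hab : b ≤ a) (hN : (N : ℤ) = a - 2) (hN4 : 4 ≤ N)
    (H : ∀ ψ : Fin 2 → k, ψ ≠ 0 → (∀ s, ψ s ≠ 0 → degs a b s = -a) →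
      ∃ n, 1 - a < n ∧ n < -1 ∧ (lfunc ψ ε).coeff n ≠ 0) (hi : IsMonomialCurve i) :
    ∃ i' : Yt ⟶ projSpace k N, j ≫ i' = i ∧ IsClosedImmersion i'.left := by
  obtain ⟨w₀, w₁, hw, gen₀, gen₁⟩ :=
    (ropeRings C hs e₀ e₁).exists_rel_generating hx hy hab hN hN4 H
  obtain ⟨q, hq, h₀, h₁, H₀, H₁⟩ := exists_extension C hs e₀ e₁ hx hy hε hw hi
  have q₀ := preimage_eq_of_extension hs hq e₀ hi.preimage₀
  have q₁ := preimage_eq_of_extension hs hq e₁ hi.preimage₁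
  have a₀ : IsAffineOpen V₀ := (C.frame₀ e₀.le).isAffineOpen hs (e₀ ▸ isAffineOpen_chart 0)
    (genericPoint_mem_preimage e₀)
  have a₁ : IsAffineOpen V₁ := (C.frame₁ e₁.le).isAffineOpen hs (e₁ ▸ isAffineOpen_chart 1)
    (genericPoint_mem_preimage' e₁)
  have r₀ := gen₀ (pull q.left h₀).range (fun c ↦ ⟨scal _ _ c, pull_scal q h₀ c⟩)
    fun l hl ↦ ⟨aff k N 0 ⟨l, by omega⟩, H₀ _⟩
  have r₁ := gen₁ (pull q.left h₁).range (fun c ↦ ⟨scal _ _ c, pull_scal q h₁ c⟩)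
    fun l hl ↦ ⟨aff k N (Fin.last N) ⟨N - l, by omega⟩, (H₁ _).trans (by
      rw [show N - (N - l) = l by omega])⟩
  subst q₀ q₁
  refine ⟨q, hq, isClosedImmersion_of_sup_eq_top q.left (isAffineOpen_chart 0)
    (isAffineOpen_chart (Fin.last N)) a₀ a₁ (fun s ↦ ?_) (fun s ↦ ?_)
    (sup_eq_top_of_preimage hs e₀ e₁) ?_⟩
  · simp only [app_eq_pull]
    exact r₀.ge trivial
  · simp only [app_eq_pull]
    exact r₁.ge trivial
  · have h : Set.range q.left = Set.range i.left := by
      rw [← hq]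
      exact (hs.range_comp q.left).symm
    rw [h]
    exact isClosed_range i

end

/-! ### The theorem for the monomial curve, and linear changes of coordinates -/

noncomputable section

variable {k : Type u} [Field k] {Yt : Over (Spec (.of k))} {j : projSpace k 1 ⟶ Yt} {a b : ℤ}
  {N : ℕ} {i : projSpace k 1 ⟶ projSpace k N}

/-- Lifts of the coordinates of the projective line to a rope. -/
lemma exists_ropeRings_lifts (hj : IsRope j (twist k (-a) ⊞ twist k (-b))) :
    ∃ (_ : IsClosedImmersion j.left) (hs : Function.Surjective j.left)
      (C : SplitConormal j.left fun s ↦ transition k ^ degs a b s) (V₀ V₁ : Yt.left.Opens)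
      (e₀ : j.left ⁻¹ᵁ V₀ = chart k 1 0) (e₁ : j.left ⁻¹ᵁ V₁ = chart k 1 1) (x : Γ(Yt.left, V₀))
      (y : Γ(Yt.left, V₁)) (ε : Fin 2 → LaurentPolynomial k),
      (ropeRings C hs e₀ e₁).A₀.π x = .X ∧ (ropeRings C hs e₀ e₁).A₁.π y = .X ∧
      (ropeRings C hs e₀ e₁).ρ₀ x * (ropeRings C hs e₀ e₁).ρ₁ y =
        1 + (ropeRings C hs e₀ e₁).ι ε := by
  have hcl := hj.isClosedImmersion
  have hs := hj.surjective
  obtain ⟨C⟩ := hj.nonempty_splitConormal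
  obtain ⟨V₀, e₀⟩ := exists_preimage_eq j.left (chart k 1 0)
  obtain ⟨V₁, e₁⟩ := exists_preimage_eq j.left (chart k 1 1)
  obtain ⟨x, hx⟩ := (ropeRings C hs e₀ e₁).A₀.π_surjective .X
  obtain ⟨y, hy⟩ := (ropeRings C hs e₀ e₁).A₁.π_surjective .X
  obtain ⟨ε, hε⟩ := (ropeRings C hs e₀ e₁).exists_eps hx hy
  exact ⟨hcl, hs, C, V₀, V₁, e₀, e₁, x, y, ε, hx, hy, hε⟩

/-- If the class of the rope vanished along some admissible `ψ`, the lifts could be changed to make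
`ψ(ε) = 0`, and `exists_ribbon` would give a forbidden projection. So the class is nonzero along
every `ψ`, as the construction of the embedding requires. -/
lemma exists_embedding_monomialCurve (hab : b ≤ a)
    (hj : IsRope j (twist k (-a) ⊞ twist k (-b))) (hN : (N : ℤ) = a - 2) (hN4 : 4 ≤ N)
    (H : ¬ ProjectsOntoRibbon j (twist k (-b))) (hi : IsMonomialCurve i) :
    ∃ i' : Yt ⟶ projSpace k N, j ≫ i' = i ∧ IsClosedImmersion i'.left := by
  obtain ⟨_, hs, C, V₀, V₁, e₀, e₁, x, y, ε, hx, hy, hε⟩ := exists_ropeRings_lifts hj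
  refine exists_isClosedImmersion C hs e₀ e₁ hx hy hε hab hN hN4 (fun ψ hψ0 hψ ↦ ?_) hi
  by_contra! hcoeff
  obtain ⟨x', y', ε', hx', hy', hε', hψε⟩ :=
    (ropeRings C hs e₀ e₁).exists_lifts hx hy hε hψ hψ0 hcoeff
  obtain ⟨Yh, p, -, -, -, -, hr, hp, -⟩ := exists_ribbon C hs e₀ e₁ hx' hy' hε' hψ0 hψ hψε
  exact H ⟨Yh, j ≫ p, p, hr, rfl, hp⟩

/-- The degrees `N + 1 - a = -1` and `N + 1 - b` are both at least `-1`, so there is no obstruction.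
-/
lemma exists_extension_monomialCurve (hab : b ≤ a)
    (hj : IsRope j (twist k (-a) ⊞ twist k (-b))) (hN : (N : ℤ) = a - 2) (hi : IsMonomialCurve i) :
    ∃ i' : Yt ⟶ projSpace k N, j ≫ i' = i := by
  obtain ⟨_, hs, C, V₀, V₁, e₀, e₁, x, y, ε, hx, hy, hε⟩ := exists_ropeRings_lifts hj
  obtain ⟨w₁, hw⟩ := (ropeRings C hs e₀ e₁).exists_rel_of_coeff (N := N)
    (fun s ↦ by fin_cases s <;> simp <;> omega) ε (v := 0) (fun _ _ _ _ ↦ rfl)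
  obtain ⟨i', hi', -⟩ := exists_extension C hs e₀ e₁ hx hy hε hw hi
  exact ⟨i', hi'⟩

lemma factor_monomialCurve_of_projectsOntoRibbon (hab : b ≤ a)
    (hj : IsRope j (twist k (-a) ⊞ twist k (-b))) (hN : (N : ℤ) ≤ a - 2) (hi : IsMonomialCurve i)
    (h : ProjectsOntoRibbon j (twist k (-b))) :
    ExtensionsFactorThroughRibbon j i (twist k (-b)) ∧
      ∀ i' : Yt ⟶ projSpace k N, j ≫ i' = i → ¬ IsClosedImmersion i'.left := by
  obtain ⟨Yh, _, p, hr, rfl, hp⟩ := h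
  have hcl := hj.isClosedImmersion
  have hs := hj.surjective
  obtain ⟨C⟩ := hj.nonempty_splitConormal
  obtain ⟨Z₀, Z₁, e₀, e₁, x, y, ε, ψ, hx, hy, hε, hψ0, hψ, hψε, hr₀, hr₁⟩ :=
    exists_functional_of_projection C hs hab hr
  refine ⟨⟨Yh, _, p, _, hr, ⟨𝟙 _, inferInstance⟩, ⟨rfl, hp⟩, fun i' hii ↦ ?_⟩, fun i' hii ↦ ?_⟩
  · exact exists_factor_of_extension C hs e₀ e₁ hx hy hε hψ hψε hr.toIsRope rfl rfl hr₀ hr₁ hN hi hii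
  · exact not_isClosedImmersion_of_extension C hs e₀ e₁ hx hy hε hψ0 hψ hψε hN hi hii

/-- The existence of one extension forces the class along `𝒪(-a)` to vanish. With `ψ` the first
coordinate, the resulting ribbon serves for all extensions, and its conormal bundle is `𝒪(-b)`
itself. -/
lemma factor_monomialCurve_of_extension (hN1 : 1 ≤ N) (hj : IsRope j (twist k (-a) ⊞ twist k (-b)))
    (hN : (N : ℤ) ≤ a - 3) (hi : IsMonomialCurve i) (h : ∃ i' : Yt ⟶ projSpace k N, j ≫ i' = i) :
    ExtensionsFactorThroughRibbon j i (twist k (-b)) ∧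
      ∀ i' : Yt ⟶ projSpace k N, j ≫ i' = i → ¬ IsClosedImmersion i'.left := by
  obtain ⟨i', hii⟩ := h
  obtain ⟨_, hs, C, V₀, V₁, e₀, e₁, x, y, ε, hx, hy, hε⟩ := exists_ropeRings_lifts hj
  obtain ⟨h₀, h₁⟩ := le_preimage_of_extension hs e₀ e₁ hi hii
  obtain ⟨w₀, w₁, hw, -⟩ := exists_rel_of_extension C hs e₀ e₁ hx hy hε hi hii h₀ h₁
  have hψ0 : (![1, 0] : Fin 2 → k) ≠ 0 := fun h ↦ one_ne_zero (congrFun h 0)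
  have hψ (s : Fin 2) (h : (![1, 0] : Fin 2 → k) s ≠ 0) : degs a b s = -a := by
    fin_cases s
    · rfl
    · simp at h
  obtain ⟨x', y', ε', hx', hy', hε', hψε⟩ := (ropeRings C hs e₀ e₁).exists_lifts hx hy hε hψ hψ0
    fun n hn hn' ↦ hw.coeff_eq_zero _ hψ hN hN1 hn hn'
  obtain ⟨Yh, p, Z₀, Z₁, z₀, z₁, hr, hp, hr₀, hr₁⟩ :=
    exists_ribbon C hs e₀ e₁ hx' hy' hε' hψ0 hψ hψε
  refine ⟨⟨Yh, _, p, _, hr, ⟨𝟙 _, inferInstance⟩, ⟨rfl, hp⟩, fun i' hii ↦ ?_⟩, fun i' hii ↦ ?_⟩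
  · exact exists_factor_of_extension C hs e₀ e₁ hx' hy' hε' hψ hψε hr.toIsRope z₀ z₁ hr₀ hr₁
      (by omega) hi hii
  · exact not_isClosedImmersion_of_extension C hs e₀ e₁ hx' hy' hε' hψ0 hψ hψε (by omega) hi hii

section Transport

variable {i₀ : projSpace k 1 ⟶ projSpace k N} {θ : projSpace k N ≅ projSpace k N}

lemma ExtensionsFactorThroughRibbon.comp_iso {M : (projSpace k 1).left.Modules}
    (h : ExtensionsFactorThroughRibbon j i₀ M) (hθ : i₀ ≫ θ.hom = i) :
    ExtensionsFactorThroughRibbon j i M := by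
  obtain ⟨Yh, j', p, L, hL, hLM, hp, H⟩ := h
  refine ⟨Yh, j', p, L, hL, hLM, hp, fun i' hi' ↦ ?_⟩
  obtain ⟨g, hg⟩ := H (i' ≫ θ.inv) (by rw [← Category.assoc, hi', ← hθ, Category.assoc,
    Iso.hom_inv_id, Category.comp_id])
  exact ⟨g ≫ θ.hom, by rw [← Category.assoc, hg, Category.assoc, Iso.inv_hom_id, Category.comp_id]⟩

lemma isClosedImmersion_comp_iso {i' : Yt ⟶ projSpace k N} (h : IsClosedImmersion i'.left) :
    IsClosedImmersion (i' ≫ θ.hom).left := by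
  have : IsIso θ.hom.left := inferInstanceAs (IsIso ((Over.forget _).map θ.hom))
  exact inferInstanceAs (IsClosedImmersion (i'.left ≫ θ.hom.left))

end Transport

end

end RopesOnP1

open RopesOnP1

theorem theorem4p4 {k : Type u} [Field k] [IsAlgClosed k] [CharZero k]
    (N : ℕ) (hN : 1 ≤ N) (a b : ℤ) (hab : b ≤ a)
    (Yt : Over (Spec (.of k))) (j : projSpace k 1 ⟶ Yt)
    (hj : IsRope j (twist k (-a) ⊞ twist k (-b))) :
    (∀ i : projSpace k 1 ⟶ projSpace k N, IsRationalNormalCurve i →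
      ((N : ℤ) = a - 2 → 4 ≤ N → ¬ ProjectsOntoRibbon j (twist k (-b)) →
        ∃ i' : Yt ⟶ projSpace k N, j ≫ i' = i ∧ IsClosedImmersion i'.left) ∧
      ((N : ℤ) = a - 2 → ProjectsOntoRibbon j (twist k (-b)) →
        (∃ i' : Yt ⟶ projSpace k N, j ≫ i' = i) ∧
          ExtensionsFactorThroughRibbon j i (twist k (-b))) ∧
      ((N : ℤ) ≤ a - 3 → (∃ i' : Yt ⟶ projSpace k N, j ≫ i' = i) →
        ExtensionsFactorThroughRibbon j i (twist k (-b)))) ∧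
    ((N : ℤ) < a - 1 →
      ((∃ i : projSpace k 1 ⟶ projSpace k N, IsRationalNormalCurve i ∧
          ∃ i' : Yt ⟶ projSpace k N, j ≫ i' = i ∧ IsClosedImmersion i'.left) →
        (N : ℤ) = a - 2 ∧ ¬ ProjectsOntoRibbon j (twist k (-b))) ∧
      (4 ≤ N → (N : ℤ) = a - 2 ∧ ¬ ProjectsOntoRibbon j (twist k (-b)) →
        ∃ i : projSpace k 1 ⟶ projSpace k N, IsRationalNormalCurve i ∧
          ∃ i' : Yt ⟶ projSpace k N, j ≫ i' = i ∧ IsClosedImmersion i'.left)) := by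
  obtain ⟨i₀, hi₀, p₀, p₁, hp₀, hp₁⟩ := exists_monomialCurve (k := k) hN
  have hm : IsMonomialCurve i₀ := ⟨p₀, p₁, hp₀, hp₁⟩
  refine ⟨fun i hi ↦ ?_, fun hlt ↦ ⟨?_, fun hN4 h ↦ ⟨i₀, hi₀, ?_⟩⟩⟩
  -- Composition with the linear automorphism `θ` carries extensions of the monomial curve to
  -- extensions of `i`, and preserves closed immersions and factorizations.
  · obtain ⟨θ, hθ⟩ := hi₀.exists_iso hi
    refine ⟨fun hNa hN4 H ↦ ?_, fun hNa H ↦ ⟨?_, ?_⟩, fun hNa ⟨i', hi'⟩ ↦ ?_⟩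
    · obtain ⟨i', h, hcl⟩ := exists_embedding_monomialCurve hab hj hNa hN4 H hm
      exact ⟨i' ≫ θ.hom, by rw [← Category.assoc, h, hθ], isClosedImmersion_comp_iso hcl⟩
    · obtain ⟨i', h⟩ := exists_extension_monomialCurve hab hj hNa hm
      exact ⟨i' ≫ θ.hom, by rw [← Category.assoc, h, hθ]⟩
    · exact (factor_monomialCurve_of_projectsOntoRibbon hab hj hNa.le hm H).1.comp_iso hθ
    · refine (factor_monomialCurve_of_extension hN hj hNa hm ⟨i' ≫ θ.inv, ?_⟩).1.comp_iso hθ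
      rw [← Category.assoc, hi', ← hθ, Category.assoc, Iso.hom_inv_id, Category.comp_id]
  · rintro ⟨i, hi, i', hi', hcl⟩
    obtain ⟨θ, hθ⟩ := hi.exists_iso hi₀
    have h : j ≫ i' ≫ θ.hom = i₀ := by rw [← Category.assoc, hi', hθ]
    have hcl' := isClosedImmersion_comp_iso (θ := θ) hcl
    have hNa : (N : ℤ) = a - 2 := by
      by_contra hne
      exact (factor_monomialCurve_of_extension hN hj (by omega) hm ⟨_, h⟩).2 _ h hcl'
    exact ⟨hNa, fun H ↦
      (factor_monomialCurve_of_projectsOntoRibbon hab hj hNa.le hm H).2 _ h hcl'⟩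
  · exact exists_embedding_monomialCurve hab hj h.1 hN4 h.2 hm
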